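/- Let $n\ge 2$. For a set $E\subset\mathbb R^n$ of finite perimeter let $\mu_E$ be its Gauss–Green measure ($\int_E\nabla\varphi\,dx=\int\varphi\,d\mu_E$ for all $\varphi\in C^1_c(\mathbb R^n)$), $P(E,U)=|\mu_E|(U)$ its perimeter in $U$, $\partial^*E$ its reduced boundary, $\nu_E$ its measure-theoretic outward unit normal, and let $$\partial E=\{x:\ 0<|E\cap B_\rho(x)|\ \text{ and }\ 0<|B_\rho(x)\setminus E|\ \text{ for all }\rho>0\}$$ be its boundary in the sense of measure, where $B_\rho(x)$ denotes the open ball. A uniformly elliptic and regular anisotropy with constants $\lambda\ge1$, $\ell\ge0$ is a lower semicontinuous $\Phi:\mathbb R^n\times\mathbb R^n\to[0,\infty)$ such that each $\Phi(x,\cdot)$ is convex, satisfies $\Phi(x,t\nu)=t\Phi(x,\nu)$ for $t>0$, is of class $C^2$ away from the origin, and such that for all $x,y,e\in\mathbb R^n$ and $\nu,\nu'\in\mathbb S^{n-1}$, $\nu\neq\nu'$, $$\tfrac1\lambda\le\Phi(x,\nu)\le\lambda,\qquad |\Phi(x,\nu)-\Phi(y,\nu)|+|\nabla\Phi(x,\nu)-\nabla\Phi(y,\nu)|\le\ell|x-y|,$$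 $$|\nabla\Phi(x,\nu)|+|\nabla^2\Phi(x,\nu)|+\frac{|\nabla^2\Phi(x,\nu)-\nabla^2\Phi(x,\nu')|}{|\nu-\nu'|}\le\lambda,\qquad \nabla^2\Phi(x,\nu)e\cdot e\ge\frac{|e-(e\cdot\nu)\nu|^2}{\lambda},$$ where $\nabla,\nabla^2$ are taken in the second variable and $|\nabla^2\Phi|$ is the operator norm. Put $P_\Phi(E)=\int_{\partial^*E}\Phi(x,\nu_E(x))\,d\mathcal H^{n-1}(x)$. For $\Lambda,r_0>0$, a set $E$ of finite perimeter is a $(\Lambda,r_0)$-minimizer of $P_\Phi$ if for all $x\in\mathbb R^n$, $0<r\le r_0$ and all sets $F$ of finite perimeter with $E\Delta F\subset B_r(x)$, $$P_\Phi(E)\le P_\Phi(F)+\Lambda r^{n-1}.$$ **Proposition.** For every $n\ge2$ and $\lambda\ge1$ there are constants $\varepsilon,c,C>0$, depending only on $n$ and $\lambda$, such that for every $\ell\ge0$, every uniformly elliptic and regular anisotropy $\Phi$ with constants $\lambda,\ell$, all $r_0>0$ and $0<\Lambda<\varepsilon$, every $(\Lambda,r_0)$-minimizer $E$ of $P_\Phi$,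 every $x\in\partial E$ and every $0<r\le r_0$, $$\min\big(|E\cap B_r(x)|,\,|B_r(x)\setminus E|\big)\ge c\,r^n\qquad\text{and}\qquad c\,r^{n-1}\le P(E,B_r(x))\le C\,r^{n-1}.$$ -/

import Mathlib

open MeasureTheory Filter Set
open scoped Topology ENNReal Gradient

/-! ### Sets of finite perimeter -/

/-- The finite `ℝⁿ`-valued Borel measure `μ` is the Gauss–Green measure of `E`, i.e.
`∫_E ∇φ dx = ∫ φ dμ` for every `φ ∈ C¹_c(ℝⁿ)`; equivalently `μ = -D1_E`. -/
def IsGaussGreenMeasure {n : ℕ} (E : Set (EuclideanSpace ℝ (Fin n)))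
    (μ : VectorMeasure (EuclideanSpace ℝ (Fin n)) (EuclideanSpace ℝ (Fin n))) : Prop :=
  IsFiniteMeasure μ.variation ∧
    ∀ φ : EuclideanSpace ℝ (Fin n) → ℝ, ContDiff ℝ 1 φ → HasCompactSupport φ →
      ∫ x in E, ∇ φ x = ∫ᵛ x, φ x ∂•μ

/-- `E` is a (Lebesgue measurable) set of finite perimeter in `ℝⁿ`: the distributional
derivative of its indicator function is a finite vector-valued measure. -/
def HasFinitePerimeter {n : ℕ} (E : Set (EuclideanSpace ℝ (Fin n))) : Prop :=
  NullMeasurableSet E volume ∧ ∃ μ, IsGaussGreenMeasure E μ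

open Classical in
/-- The Gauss–Green measure `μ_E` of a set of finite perimeter (it is unique).
It is only used for sets of finite perimeter. -/
noncomputable def gaussGreenMeasure {n : ℕ} (E : Set (EuclideanSpace ℝ (Fin n))) :
    VectorMeasure (EuclideanSpace ℝ (Fin n)) (EuclideanSpace ℝ (Fin n)) :=
  if h : ∃ μ, IsGaussGreenMeasure E μ then h.choose else 0

/-- The relative perimeter `P(E, U) = |μ_E|(U)` of a set `E` of finite perimeter, where `|μ_E|` is
the total variation measure of `μ_E`. -/
noncomputable def perimeter {n : ℕ} (E U : Set (EuclideanSpace ℝ (Fin n))) : ℝ≥0∞ :=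
  (gaussGreenMeasure E).variation U

/-- `x` is in the support of `|μ_E|` and `ν` is the unit vector
`lim_{r → 0⁺} μ_E(B_r(x)) / |μ_E|(B_r(x))`. -/
def IsOuterNormalAt {n : ℕ} (E : Set (EuclideanSpace ℝ (Fin n)))
    (x ν : EuclideanSpace ℝ (Fin n)) : Prop :=
  (∀ r : ℝ, 0 < r → 0 < perimeter E (Metric.ball x r)) ∧ ‖ν‖ = 1 ∧
    Tendsto (fun r : ℝ => (perimeter E (Metric.ball x r)).toReal⁻¹ •
      gaussGreenMeasure E (Metric.ball x r)) (𝓝[>] 0) (𝓝 ν)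

/-- The reduced boundary `∂*E`. -/
def reducedBoundary {n : ℕ} (E : Set (EuclideanSpace ℝ (Fin n))) :
    Set (EuclideanSpace ℝ (Fin n)) :=
  {x | ∃ ν, IsOuterNormalAt E x ν}

open Classical in
/-- The measure-theoretic outward unit normal `ν_E`, defined on the reduced boundary
(and given the value `0` elsewhere). -/
noncomputable def outerNormal {n : ℕ} (E : Set (EuclideanSpace ℝ (Fin n)))
    (x : EuclideanSpace ℝ (Fin n)) : EuclideanSpace ℝ (Fin n) :=
  if h : ∃ ν, IsOuterNormalAt E x ν then h.choose else 0

/-- The boundary `∂E` in the sense of measure: the points every neighbourhood of which meets both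
`E` and its complement in positive measure. It contains the essential boundary, i.e. all points at
which the density of `E` is neither `0` nor `1`. -/
def measureBoundary {n : ℕ} (E : Set (EuclideanSpace ℝ (Fin n))) :
    Set (EuclideanSpace ℝ (Fin n)) :=
  {x | ∀ r : ℝ, 0 < r →
    0 < volume (E ∩ Metric.ball x r) ∧ 0 < volume (Metric.ball x r \ E)}

/-! ### Anisotropies and almost minimizers -/

/-- `Φ` is an elliptic integrand: nonnegative, lower semicontinuous, and positively
`1`-homogeneous and convex in the second variable. -/
structure IsEllipticIntegrand {n : ℕ}
    (Φ : EuclideanSpace ℝ (Fin n) → EuclideanSpace ℝ (Fin n) → ℝ) : Prop where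
  nonneg : ∀ x ν, 0 ≤ Φ x ν
  lowerSemicontinuous :
    LowerSemicontinuous
      (fun p : EuclideanSpace ℝ (Fin n) × EuclideanSpace ℝ (Fin n) => Φ p.1 p.2)
  homogeneous : ∀ (x ν : EuclideanSpace ℝ (Fin n)) (t : ℝ), 0 < t → Φ x (t • ν) = t * Φ x ν
  convex : ∀ x, ConvexOn ℝ univ (Φ x)

/-- `Φ` is a uniformly elliptic and regular anisotropy with constants `lam ≥ 1` and `ell ≥ 0`.
The gradient `∇ (Φ x)` and the Hessian `fderiv ℝ (∇ (Φ x))` are taken in the second variable;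
by homogeneity, regularity on the unit sphere is regularity away from the origin. -/
structure IsRegularAnisotropy {n : ℕ} (lam ell : ℝ)
    (Φ : EuclideanSpace ℝ (Fin n) → EuclideanSpace ℝ (Fin n) → ℝ) : Prop
    extends IsEllipticIntegrand Φ where
  one_le_lam : 1 ≤ lam
  ell_nonneg : 0 ≤ ell
  contDiffOn : ∀ x, ContDiffOn ℝ 2 (Φ x) {0}ᶜ
  bounds : ∀ x ν, ‖ν‖ = 1 → 1 / lam ≤ Φ x ν ∧ Φ x ν ≤ lam
  lipschitz : ∀ x y ν, ‖ν‖ = 1 →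
    |Φ x ν - Φ y ν| + ‖∇ (Φ x) ν - ∇ (Φ y) ν‖ ≤ ell * ‖x - y‖
  derivBounds : ∀ x ν ν', ‖ν‖ = 1 → ‖ν'‖ = 1 →
    ‖∇ (Φ x) ν‖ + ‖fderiv ℝ (∇ (Φ x)) ν‖
      + ‖fderiv ℝ (∇ (Φ x)) ν - fderiv ℝ (∇ (Φ x)) ν'‖ / ‖ν - ν'‖ ≤ lam
  elliptic : ∀ x ν e, ‖ν‖ = 1 →
    ‖e - inner ℝ e ν • ν‖ ^ 2 / lam ≤ inner ℝ (fderiv ℝ (∇ (Φ x)) ν e) e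

/-- The anisotropic perimeter `P_Φ(E) = ∫ Φ(x, ν_E(x)) dH^{n-1}(x)` of a set of finite perimeter,
the integral being over the reduced boundary, where `ν_E` is defined. Here `μHE[n - 1]` is the
`(n-1)`-dimensional Hausdorff measure with the Euclidean normalization. -/
noncomputable def anisotropicPerimeter {n : ℕ}
    (Φ : EuclideanSpace ℝ (Fin n) → EuclideanSpace ℝ (Fin n) → ℝ)
    (E : Set (EuclideanSpace ℝ (Fin n))) : ℝ≥0∞ :=
  ∫⁻ x in reducedBoundary E, ENNReal.ofReal (Φ x (outerNormal E x)) ∂μHE[n - 1]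

/-- `E` is a `(Lam, r₀)`-minimizer of `P_Φ`: it has finite perimeter and
`P_Φ(E) ≤ P_Φ(F) + Lam r^{n-1}` for all `x`, all `0 < r ≤ r₀` and all sets `F` of finite perimeter
with `E ∆ F ⊆ B_r(x)`. -/
def IsAlmostMinimizer {n : ℕ} (Φ : EuclideanSpace ℝ (Fin n) → EuclideanSpace ℝ (Fin n) → ℝ)
    (Lam r₀ : ℝ) (E : Set (EuclideanSpace ℝ (Fin n))) : Prop :=
  HasFinitePerimeter E ∧
    ∀ (x : EuclideanSpace ℝ (Fin n)) (r : ℝ), 0 < r → r ≤ r₀ →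
      ∀ F : Set (EuclideanSpace ℝ (Fin n)), HasFinitePerimeter F →
        symmDiff E F ⊆ Metric.ball x r →
          anisotropicPerimeter Φ E ≤
            anisotropicPerimeter Φ F + ENNReal.ofReal (Lam * r ^ (n - 1))

/-! Write V(s) for the volume of E in the closed ball of radius s about x. The anisotropy enters
through the bounds 1/λ ≤ Φ ≤ λ on unit vectors, and the competitor is always E with a closed ball
removed.

Cutting. V is monotone, hence differentiable at almost every s. At such s, testing the Gauss–Green
formula with radial cutoffs shows that E minus the closed ball has finite perimeter, is unchanged
outside, and carries perimeter at most K V'(s) on the closed ball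
(`IsGaussGreenPair.sdiff_closedBall`). The crude cutoffs give a constant K instead of 1, which is
harmless. Almost minimality then yields P(E, B_s) ≤ C (V'(s) + Λ r^(n-1)) for s < r ≤ r₀
(`exists_perimeter_closedBall_le`). Since V'(s) ≤ n ω s^(n-1), where ω is the volume of the unit
ball, the upper perimeter bound follows.

Volume bound. Suppose V(r) ≤ δ r^n and Λ ≤ δ. Some s in (r/2, r) has V'(s) ≤ 2δ r^(n-1), so P(E,
B_{r/2}) ≤ 3Cδ r^(n-1), and the local isoperimetric inequality gives V(r/4) ≤ C' δ^(n/(n-1)) r^n,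
which is at most δ (r/4)^n for small δ (`exists_ballVolume_decay`). The term Λ r^(n-1) has the same
scaling as perimeter, so iteration only preserves small density and does not make V vanish. But it
applies at every centre y in B_{r/2}(x) once V(r) ≤ δ (r/2)^n, so no such y has density 1; by
Lebesgue's theorem E is null in B_{r/2}(x), contradicting x ∈ ∂E. The complement of E is an almost
minimizer for Φ(x, -ν), which gives the other volume bound, and the relative isoperimetric
inequality turns the two into the lower perimeter bound.

Perimeter and Hausdorff measure. P_Φ is an integral against the Hausdorff measure on ∂*E, whereas
the estimates concern |μ_E|. In place of De Giorgi's structure theorem, comparability up to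
dimensional constants suffices (`exists_perimeter_comparable`). At a point of ∂*E the flux of μ_E
through small balls is at least half their mass, and the flux is bounded by volume growth; this
gives the upper density of |μ_E|, and a De Giorgi iteration gives volume density of E and of its
complement, hence the lower density. Covering arguments convert density bounds into comparison of
measures. -/

/-! ### Vector measures as measures with density -/

section VectorMeasureDensity

variable {α : Type*} {mα : MeasurableSpace α} {n : ℕ}

/-- Integrability with respect to the total variation of `f m`. -/
theorem integrable_variation_withDensityᵥ_iff {F : Type*} [NormedAddCommGroup F] [NormedSpace ℝ F]
    [CompleteSpace F] {m : Measure α} {f : α → F} (hf : Integrable f m) (φ : α → ℝ) :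
    Integrable φ (m.withDensityᵥ f).variation ↔ Integrable (fun x => ‖f x‖ • φ x) m := by
  rw [Measure.variation_withDensityᵥ hf,
    integrable_withDensity_iff_integrable_smul₀' hf.aestronglyMeasurable.enorm (by simp)]
  simp

theorem integrable_smul_of_integrable_norm_smul {F : Type*} [NormedAddCommGroup F]
    [NormedSpace ℝ F] {m : Measure α} {f : α → F} (hf : Integrable f m) {φ : α → ℝ}
    (h : Integrable (fun x => ‖f x‖ • φ x) m) : Integrable (fun x => φ x • f x) m := by
  -- φ may fail to be measurable where f vanishes, so φ • f is recovered from the measurable product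
  -- ‖f‖ φ by dividing by ‖f‖.
  have h1 : AEStronglyMeasurable (fun x => ‖f x‖⁻¹ • (‖f x‖ • φ x) • f x) m :=
    (hf.aestronglyMeasurable.norm.inv₀).smul (h.1.smul hf.1)
  refine h.norm.mono' (h1.congr (Eventually.of_forall fun x => ?_))
    (Eventually.of_forall fun x => ?_)
  · rcases eq_or_ne (f x) 0 with h0 | h0
    · simp [h0]
    · have : ‖f x‖ ≠ 0 := by simpa using h0
      simp only [smul_eq_mul, smul_smul]
      rw [← mul_assoc, inv_mul_cancel₀ this, one_mul]
  · simp [norm_smul, mul_comm]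

/-- Integrating a real function against the vector measure `f m` amounts to integrating
`φ • f` against `m`. -/
theorem integral_withDensityᵥ_eq {F : Type*} [NormedAddCommGroup F] [NormedSpace ℝ F]
    [CompleteSpace F] {m : Measure α} {f : α → F} (hf : Integrable f m) {φ : α → ℝ}
    (hφ : Integrable φ (m.withDensityᵥ f).variation) :
    ∫ᵛ x, φ x ∂•(m.withDensityᵥ f) = ∫ x, φ x • f x ∂m := by
  have hint {φ : α → ℝ} (h : Integrable φ (m.withDensityᵥ f).variation) :
      Integrable (fun x => φ x • f x) m :=
    integrable_smul_of_integrable_norm_smul hf ((integrable_variation_withDensityᵥ_iff hf φ).1 h)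
  have hV : (m.withDensityᵥ f).variation = m.withDensity (fun x => ‖f x‖ₑ) :=
    Measure.variation_withDensityᵥ hf
  have hfin : IsFiniteMeasure (m.withDensityᵥ f).variation := by
    rw [hV]; exact ⟨by simpa using! hf.2⟩
  have hVint (ψ : α → ℝ) : ∫ x, ψ x ∂(m.withDensityᵥ f).variation = ∫ x, ‖f x‖ * ψ x ∂m := by
    rw [hV, integral_withDensity_eq_integral_toReal_smul₀ hf.aestronglyMeasurable.enorm (by simp)]
    simp
  refine Integrable.induction (μ := (m.withDensityᵥ f).variation)
    (fun φ : α → ℝ => ∫ᵛ x, φ x ∂•(m.withDensityᵥ f) = ∫ x, φ x • f x ∂m) ?_ ?_ ?_ ?_ hφ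
  · intro c s hs _
    rw [VectorMeasure.integral_indicator hs]
    have : IsFiniteMeasure ((m.withDensityᵥ f).restrict s).variation :=
      isFiniteMeasure_of_le _
        ((VectorMeasure.variation_restrict_le).trans Measure.restrict_le_self)
    rw [VectorMeasure.integral_const]
    simp only [VectorMeasure.restrict_apply _ hs MeasurableSet.univ, univ_inter,
      ContinuousLinearMap.lsmul_apply]
    rw [withDensityᵥ_apply hf hs, ← integral_smul, ← integral_indicator hs]
    congr with x
    by_cases hx : x ∈ s <;> simp [hx]
  · intro g h _ hg hh ihg ihh
    rw [VectorMeasure.integral_add hg hh, ihg, ihh, ← integral_add (hint hg) (hint hh)]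
    simp [add_smul]
  -- Both sides are continuous on L¹ of the variation. The right side is 1-Lipschitz because the
  -- variation has density ‖f‖ with respect to m.
  · refine isClosed_eq VectorMeasure.continuous_integral ?_
    refine (LipschitzWith.of_dist_le_mul (K := 1) fun g h => ?_).continuous
    have hg := L1.integrable_coeFn g
    have hh := L1.integrable_coeFn h
    rw [dist_eq_norm, ← integral_sub (hint hg) (hint hh), NNReal.coe_one, one_mul, dist_eq_norm,
      L1.norm_eq_integral_norm, integral_congr_ae (g := fun x => ‖g x - h x‖)
        ((Lp.coeFn_sub g h).mono fun x hx => by simp only [hx, Pi.sub_apply])]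
    refine (norm_integral_le_integral_norm _).trans_eq ?_
    rw [hVint]
    congr with x
    rw [← sub_smul, norm_smul]
    simp [mul_comm]
  · intro g h hgh hg ih
    rw [← VectorMeasure.integral_congr_ae hgh, ih]
    refine integral_congr_ae ?_
    rw [hV, Filter.EventuallyEq, ae_withDensity_iff' hf.aestronglyMeasurable.enorm] at hgh
    filter_upwards [hgh] with x hx
    -- Equality with respect to the variation says nothing where f = 0, but there both integrands
    -- vanish.
    rcases eq_or_ne (f x) 0 with h0 | h0
    · simp [h0]
    · rw [hx (by simpa using h0)]

/-- Polar decomposition of a vector measure of finite total variation. -/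
theorem exists_withDensityᵥ_variation (μ : VectorMeasure α (EuclideanSpace ℝ (Fin n)))
    (hμ : IsFiniteMeasure μ.variation) :
    ∃ f : α → EuclideanSpace ℝ (Fin n), Measurable f ∧ (∀ x, ‖f x‖ ≤ 1) ∧
      (∀ᵐ x ∂μ.variation, ‖f x‖ = 1) ∧ μ = μ.variation.withDensityᵥ f := by
  let coord (i : Fin n) : EuclideanSpace ℝ (Fin n) →L[ℝ] ℝ := EuclideanSpace.proj i
  let s (i : Fin n) : SignedMeasure α :=
    μ.mapRange (coord i : EuclideanSpace ℝ (Fin n) →+ ℝ) (coord i).continuous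
  have hs (i : Fin n) (A : Set α) : s i A = μ A i := rfl
  have hac (i : Fin n) : s i ≪ᵥ μ.variation.toENNRealVectorMeasure := by
    refine VectorMeasure.AbsolutelyContinuous.mk fun A hA h => ?_
    rw [Measure.toENNRealVectorMeasure_apply_measurable hA] at h
    have : μ A = 0 := by
      have := VectorMeasure.enorm_measure_le_variation μ A
      rw [h] at this
      simpa using this
    simp [hs, this]
  let g : α → EuclideanSpace ℝ (Fin n) := fun x =>
    WithLp.toLp 2 fun i => (s i).rnDeriv μ.variation x
  have hgm : Measurable g := by
    refine (WithLp.measurable_toLp 2 _).comp (measurable_pi_lambda _ fun i => ?_)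
    exact SignedMeasure.measurable_rnDeriv _ _
  have hgi : Integrable g μ.variation :=
    Integrable.of_eval_piLp fun i => SignedMeasure.integrable_rnDeriv _ _
  have hμg : μ = μ.variation.withDensityᵥ g := by
    ext A hA i
    have h1 := congrArg (fun ν : SignedMeasure α => ν A)
      (SignedMeasure.withDensityᵥ_rnDeriv_eq (s i) μ.variation (hac i))
    simp only [withDensityᵥ_apply (SignedMeasure.integrable_rnDeriv _ _) hA, hs] at h1
    rw [withDensityᵥ_apply hgi hA, ← h1,
      eval_integral_piLp (f := g) (μ := μ.variation.restrict A)
        fun i => (SignedMeasure.integrable_rnDeriv (s i) _).integrableOn]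
  -- The variation of g times |μ| is ‖g‖ |μ|, and it is also |μ| itself; hence ‖g‖ = 1 almost
  -- everywhere.
  have hg1 : ∀ᵐ x ∂μ.variation, ‖g x‖ = 1 := by
    have h1 : μ.variation.withDensity (fun x => ‖g x‖ₑ) = μ.variation.withDensity 1 := by
      rw [← Measure.variation_withDensityᵥ hgi, ← hμg, withDensity_one]
    have h2 := (withDensity_eq_iff_of_sigmaFinite hgm.enorm.aemeasurable
      (measurable_one.aemeasurable)).1 h1
    filter_upwards [h2] with x hx
    rw [← toReal_enorm, hx]; simp
  have hset : MeasurableSet {x | ‖g x‖ = 1} := measurableSet_eq_fun hgm.norm measurable_const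
  have hfg : {x | ‖g x‖ = 1}.indicator g =ᵐ[μ.variation] g := by
    filter_upwards [hg1] with x hx
    exact indicator_of_mem (show x ∈ {x | ‖g x‖ = 1} from hx) _
  -- Setting g to zero on the exceptional null set makes the bound ‖f‖ ≤ 1 hold everywhere.
  refine ⟨{x | ‖g x‖ = 1}.indicator g, hgm.indicator hset, fun x => ?_, ?_, ?_⟩
  · by_cases hx : x ∈ {x | ‖g x‖ = 1}
    · rw [indicator_of_mem hx]; exact le_of_eq hx
    · simp [indicator_of_notMem hx]
  · filter_upwards [hfg, hg1] with x hx h1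
    rw [hx, h1]
  · rw [WithDensityᵥEq.congr_ae hfg, ← hμg]

end VectorMeasureDensity

/-! ### Gauss–Green pairs -/

section GaussGreenPair

variable {n : ℕ}

/-- The measure `m` and the density `f` represent the Gauss–Green measure `f m` of `E`. -/
structure IsGaussGreenPair (E : Set (EuclideanSpace ℝ (Fin n)))
    (m : Measure (EuclideanSpace ℝ (Fin n)))
    (f : EuclideanSpace ℝ (Fin n) → EuclideanSpace ℝ (Fin n)) : Prop where
  finite : IsFiniteMeasure m
  measurable : Measurable f
  norm_le : ∀ x, ‖f x‖ ≤ 1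
  gauss_green : ∀ φ : EuclideanSpace ℝ (Fin n) → ℝ, ContDiff ℝ 1 φ → HasCompactSupport φ →
    ∫ x in E, ∇ φ x = ∫ x, φ x • f x ∂m

variable {E : Set (EuclideanSpace ℝ (Fin n))} {m : Measure (EuclideanSpace ℝ (Fin n))}
  {f : EuclideanSpace ℝ (Fin n) → EuclideanSpace ℝ (Fin n)}

theorem IsGaussGreenPair.integrable (h : IsGaussGreenPair E m f) : Integrable f m :=
  have := h.finite
  Integrable.of_bound h.measurable.aestronglyMeasurable 1 (Eventually.of_forall h.norm_le)

/-- The polar density of the difference integrates to zero against all test functions, so it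
vanishes almost everywhere; since it also has norm 1 almost everywhere, the variation is zero. This
allows the chosen `gaussGreenMeasure` to be computed from any Gauss–Green pair. -/
theorem IsGaussGreenMeasure.unique {μ ν : VectorMeasure (EuclideanSpace ℝ (Fin n))
    (EuclideanSpace ℝ (Fin n))} (hμ : IsGaussGreenMeasure E μ) (hν : IsGaussGreenMeasure E ν) :
    μ = ν := by
  have := hμ.1
  have := hν.1
  have hfin : IsFiniteMeasure (μ - ν).variation :=
    isFiniteMeasure_of_le _ VectorMeasure.variation_sub_le
  obtain ⟨f, hfm, hf1, hfa, hf⟩ := exists_withDensityᵥ_variation (μ - ν) hfin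
  have hfi : Integrable f (μ - ν).variation :=
    Integrable.of_bound hfm.aestronglyMeasurable 1 (Eventually.of_forall hf1)
  have h0 : ∀ᵐ x ∂(μ - ν).variation, f x = 0 := by
    refine ae_eq_zero_of_integral_contDiff_smul_eq_zero hfi.locallyIntegrable fun φ hφ hc => ?_
    have hi (m : Measure (EuclideanSpace ℝ (Fin n))) [IsFiniteMeasure m] : Integrable φ m :=
      hφ.continuous.integrable_of_hasCompactSupport hc
    have h1 := VectorMeasure.integral_sub_vectorMeasure (μ := μ) (ν := ν)
      (B := ContinuousLinearMap.lsmul ℝ ℝ) (hi μ.variation) (hi ν.variation)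
    rw [← hμ.2 φ (hφ.of_le (by simp)) hc, ← hν.2 φ (hφ.of_le (by simp)) hc, sub_self] at h1
    rw [← integral_withDensityᵥ_eq hfi, ← hf, h1]
    rw [← hf]
    exact hi _
  have hzero : (μ - ν).variation = 0 := by
    rw [← ae_eq_bot, ← Filter.eventually_false_iff_eq_bot]
    filter_upwards [h0, hfa] with x h1 h2
    simp [h1] at h2
  exact sub_eq_zero.1 (VectorMeasure.variation_eq_zero.1 hzero)

theorem IsGaussGreenPair.isGaussGreenMeasure (h : IsGaussGreenPair E m f) :
    IsGaussGreenMeasure E (m.withDensityᵥ f) := by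
  have := h.finite
  have hfin : IsFiniteMeasure (m.withDensityᵥ f).variation := by
    rw [Measure.variation_withDensityᵥ h.integrable]; exact ⟨by simpa using! h.integrable.2⟩
  refine ⟨hfin, fun φ hφ hc => ?_⟩
  rw [h.gauss_green φ hφ hc, integral_withDensityᵥ_eq h.integrable
    (hφ.continuous.integrable_of_hasCompactSupport hc)]

theorem gaussGreenMeasure_spec (h : ∃ μ, IsGaussGreenMeasure E μ) :
    IsGaussGreenMeasure E (gaussGreenMeasure E) := by
  rw [gaussGreenMeasure, dif_pos h]
  exact h.choose_spec

theorem IsGaussGreenPair.gaussGreenMeasure_eq (h : IsGaussGreenPair E m f) :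
    gaussGreenMeasure E = m.withDensityᵥ f :=
  (gaussGreenMeasure_spec ⟨_, h.isGaussGreenMeasure⟩).unique h.isGaussGreenMeasure

theorem IsGaussGreenPair.perimeter_eq (h : IsGaussGreenPair E m f) :
    perimeter E = m.withDensity fun x => ‖f x‖ₑ := by
  ext A
  rw [perimeter, h.gaussGreenMeasure_eq, Measure.variation_withDensityᵥ h.integrable]

/-- The perimeter measure and the measure-theoretic normal of a set of finite perimeter. -/
theorem exists_isGaussGreenPair (h : ∃ μ, IsGaussGreenMeasure E μ) :
    ∃ m f, IsGaussGreenPair E m f ∧ (∀ᵐ x ∂m, ‖f x‖ = 1) ∧ perimeter E = m := by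
  have hE := gaussGreenMeasure_spec h
  have := hE.1
  obtain ⟨f, hfm, hf1, hfa, hf⟩ := exists_withDensityᵥ_variation (gaussGreenMeasure E) hE.1
  have hfi : Integrable f (gaussGreenMeasure E).variation :=
    Integrable.of_bound hfm.aestronglyMeasurable 1 (Eventually.of_forall hf1)
  refine ⟨_, f, ⟨hE.1, hfm, hf1, fun φ hφ hc => ?_⟩, hfa, rfl⟩
  rw [hE.2 φ hφ hc, ← integral_withDensityᵥ_eq hfi, ← hf]
  rw [← hf]
  exact hφ.continuous.integrable_of_hasCompactSupport hc

theorem integrable_gradient {φ : EuclideanSpace ℝ (Fin n) → ℝ} (hφ : ContDiff ℝ 1 φ)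
    (hc : HasCompactSupport φ) : Integrable (∇ φ) := by
  have h1 : Continuous (∇ φ) :=
    (InnerProductSpace.toDual ℝ _).symm.continuous.comp (hφ.continuous_fderiv one_ne_zero)
  refine h1.integrable_of_hasCompactSupport ?_
  exact (hc.fderiv (𝕜 := ℝ)).comp_left (g := (InnerProductSpace.toDual ℝ _).symm) (by simp)

/-- Integration by parts against the constant 1, in each direction v. -/
theorem integral_gradient_eq_zero {φ : EuclideanSpace ℝ (Fin n) → ℝ} (hφ : ContDiff ℝ 1 φ)
    (hc : HasCompactSupport φ) : ∫ x, ∇ φ x = 0 := by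
  refine ext_inner_right ℝ fun v => ?_
  rw [inner_zero_left, real_inner_comm, ← integral_inner (integrable_gradient hφ hc)]
  have h2 : ∀ x, inner ℝ v (∇ φ x) = fderiv ℝ φ x v := fun x => by
    rw [real_inner_comm]; simp [gradient]
  simp_rw [h2]
  have := integral_mul_fderiv_eq_neg_fderiv_mul_of_integrable (𝕜 := ℝ) (μ := volume) (v := v)
    (f := fun _ : EuclideanSpace ℝ (Fin n) => (1 : ℝ)) (g := φ) (by simp)
    (by
      simp only [one_mul]
      exact ((hφ.continuous_fderiv one_ne_zero).clm_apply continuous_const).integrable_of_hasCompactSupport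
        (hc.fderiv_apply (𝕜 := ℝ) v))
    (by simpa using hφ.continuous.integrable_of_hasCompactSupport hc)
    (fun _ _ => differentiableAt_const _)
    (fun x _ => hφ.differentiable one_ne_zero x)
  simpa using this

/-- The complement of `E` has the opposite Gauss–Green measure. -/
theorem IsGaussGreenPair.compl (h : IsGaussGreenPair E m f) (hE : NullMeasurableSet E) :
    IsGaussGreenPair Eᶜ m (-f) := by
  refine ⟨h.finite, h.measurable.neg, fun x => by simpa using h.norm_le x, fun φ hφ hc => ?_⟩
  have h1 := integral_add_compl₀ hE (integrable_gradient hφ hc)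
  rw [integral_gradient_eq_zero hφ hc, h.gauss_green φ hφ hc] at h1
  rw [eq_neg_of_add_eq_zero_right h1, ← integral_neg]
  simp

end GaussGreenPair

/-! ### Radial cutoff functions -/

section Cutoff

variable {n : ℕ}

theorem exists_deriv_smoothTransition_le : ∃ K : ℝ, 0 < K ∧ ∀ t, deriv Real.smoothTransition t ≤ K := by
  have hc : Continuous (deriv Real.smoothTransition) :=
    (Real.smoothTransition.contDiff (n := 1)).continuous_deriv_one
  obtain ⟨K, hK⟩ := (isCompact_Icc (a := (0 : ℝ)) (b := 1)).bddAbove_image hc.continuousOn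
  refine ⟨max K 1, by positivity, fun t => ?_⟩
  by_cases ht : t ∈ Icc (0 : ℝ) 1
  · exact le_max_of_le_left (hK (mem_image_of_mem _ ht))
  · refine le_max_of_le_right ?_
    have : deriv Real.smoothTransition t = 0 := by
      rw [mem_Icc, not_and_or, not_le, not_le] at ht
      rcases ht with ht | ht
      · have : Real.smoothTransition =ᶠ[𝓝 t] fun _ => 0 := by
          filter_upwards [Iio_mem_nhds ht] with u hu
          exact Real.smoothTransition.zero_of_nonpos (le_of_lt hu)
        rw [this.deriv_eq, deriv_const]
      · have : Real.smoothTransition =ᶠ[𝓝 t] fun _ => 1 := by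
          filter_upwards [Ioi_mem_nhds ht] with u hu
          exact Real.smoothTransition.one_of_one_le (le_of_lt hu)
        rw [this.deriv_eq, deriv_const]
    rw [this]; norm_num

/-- An upper bound for the derivative of `Real.smoothTransition`. -/
noncomputable def transitionBound : ℝ := exists_deriv_smoothTransition_le.choose

theorem transitionBound_pos : 0 < transitionBound :=
  exists_deriv_smoothTransition_le.choose_spec.1

theorem deriv_smoothTransition_le (t : ℝ) : deriv Real.smoothTransition t ≤ transitionBound :=
  exists_deriv_smoothTransition_le.choose_spec.2 t

theorem deriv_smoothTransition_nonneg (t : ℝ) : 0 ≤ deriv Real.smoothTransition t :=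
  Real.smoothTransition.monotone.deriv_nonneg

theorem deriv_smoothTransition_eq_zero_of_nonpos {t : ℝ} (ht : t ≤ 0) :
    deriv Real.smoothTransition t = 0 := by
  refine IsLocalMin.deriv_eq_zero (Eventually.of_forall fun u => ?_)
  rw [Real.smoothTransition.zero_of_nonpos ht]
  exact Real.smoothTransition.nonneg u

theorem deriv_smoothTransition_eq_zero_of_one_le {t : ℝ} (ht : 1 ≤ t) :
    deriv Real.smoothTransition t = 0 := by
  refine IsLocalMax.deriv_eq_zero (Eventually.of_forall fun u => ?_)
  rw [Real.smoothTransition.one_of_one_le ht]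
  exact Real.smoothTransition.le_one u

/-- A smooth radial function vanishing on the ball of radius `s` and equal to `1` outside the ball
of radius `s + ε`. -/
noncomputable def outerCutoff (x : EuclideanSpace ℝ (Fin n)) (s ε : ℝ)
    (y : EuclideanSpace ℝ (Fin n)) : ℝ :=
  Real.smoothTransition ((‖y - x‖ ^ 2 - s ^ 2) / ((s + ε) ^ 2 - s ^ 2))

variable {x y : EuclideanSpace ℝ (Fin n)} {s ε : ℝ}

/-- The cutoff is a function of the squared distance so as to be smooth at the centre as well. -/
theorem contDiff_outerCutoff : ContDiff ℝ 1 (outerCutoff x s ε) := by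
  refine (Real.smoothTransition.contDiff (n := 1)).comp ?_
  exact ((((contDiff_id.sub contDiff_const).norm_sq ℝ).sub contDiff_const).div_const _)

theorem outerCutoff_nonneg : 0 ≤ outerCutoff x s ε y := Real.smoothTransition.nonneg _

theorem outerCutoff_le_one : outerCutoff x s ε y ≤ 1 := Real.smoothTransition.le_one _

theorem sq_sub_sq_pos (hs : 0 ≤ s) (hε : 0 < ε) : 0 < (s + ε) ^ 2 - s ^ 2 := by
  nlinarith [mul_nonneg hs hε.le]

theorem outerCutoff_eq_zero (hs : 0 ≤ s) (hε : 0 < ε) (hy : ‖y - x‖ ≤ s) :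
    outerCutoff x s ε y = 0 := by
  refine Real.smoothTransition.zero_of_nonpos (div_nonpos_of_nonpos_of_nonneg ?_
    (sq_sub_sq_pos hs hε).le)
  have := norm_nonneg (y - x)
  nlinarith

theorem outerCutoff_eq_one (hs : 0 ≤ s) (hε : 0 < ε) (hy : s + ε ≤ ‖y - x‖) :
    outerCutoff x s ε y = 1 := by
  refine Real.smoothTransition.one_of_one_le ?_
  rw [one_le_div (sq_sub_sq_pos hs hε)]
  have : (s + ε) ^ 2 ≤ ‖y - x‖ ^ 2 := by gcongr
  linarith

theorem gradient_outerCutoff (y : EuclideanSpace ℝ (Fin n)) :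
    ∇ (outerCutoff x s ε) y =
      (deriv Real.smoothTransition ((‖y - x‖ ^ 2 - s ^ 2) / ((s + ε) ^ 2 - s ^ 2)) *
        (2 / ((s + ε) ^ 2 - s ^ 2))) • (y - x) := by
  refine HasGradientAt.gradient ?_
  rw [hasGradientAt_iff_hasFDerivAt]
  have h1 : HasFDerivAt (fun y : EuclideanSpace ℝ (Fin n) =>
      (‖y - x‖ ^ 2 - s ^ 2) / ((s + ε) ^ 2 - s ^ 2))
      (((s + ε) ^ 2 - s ^ 2)⁻¹ • (2 • innerSL ℝ (y - x))) y := by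
    have h2 := ((hasFDerivAt_id y).sub_const x).norm_sq
    have h3 := (h2.sub_const (s ^ 2)).mul_const ((s + ε) ^ 2 - s ^ 2)⁻¹
    simpa [div_eq_mul_inv] using h3
  have h2 : HasDerivAt Real.smoothTransition
      (deriv Real.smoothTransition ((‖y - x‖ ^ 2 - s ^ 2) / ((s + ε) ^ 2 - s ^ 2)))
      ((‖y - x‖ ^ 2 - s ^ 2) / ((s + ε) ^ 2 - s ^ 2)) :=
    ((Real.smoothTransition.contDiff (n := 1)).differentiable one_ne_zero _).hasDerivAt
  refine HasFDerivAt.congr_fderiv (h2.comp_hasFDerivAt y h1) ?_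
  ext v
  simp
  ring

/-- Norm of the gradient of the cutoff, as a density supported in an annulus. -/
theorem norm_gradient_outerCutoff_le (hs : 0 ≤ s) (hε : 0 < ε) (y : EuclideanSpace ℝ (Fin n)) :
    ‖∇ (outerCutoff x s ε) y‖ ≤
      (Metric.closedBall x (s + ε) \ Metric.closedBall x s).indicator
        (fun _ => 2 * transitionBound / ε) y := by
  have hpos := sq_sub_sq_pos hs hε
  rw [gradient_outerCutoff]
  by_cases hy : y ∈ Metric.closedBall x (s + ε) \ Metric.closedBall x s
  · rw [indicator_of_mem hy, norm_smul, Real.norm_eq_abs, abs_of_nonneg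
      (mul_nonneg (deriv_smoothTransition_nonneg _) (by positivity))]
    have h1 : ‖y - x‖ ≤ s + ε := by simpa [dist_eq_norm] using hy.1
    calc _ ≤ transitionBound * (2 / ((s + ε) ^ 2 - s ^ 2)) * (s + ε) := by
          gcongr
          · exact mul_nonneg transitionBound_pos.le (by positivity)
          · exact deriv_smoothTransition_le _
      _ = 2 * transitionBound * ((s + ε) / ((s + ε) ^ 2 - s ^ 2)) := by ring
      -- Here (s + ε)² - s² = ε (2s + ε) ≥ ε (s + ε).
      _ ≤ 2 * transitionBound * (1 / ε) := by
          have := transitionBound_pos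
          gcongr 2 * transitionBound * ?_
          rw [div_le_div_iff₀ hpos hε]
          nlinarith [mul_nonneg hs hε.le]
      _ = _ := by ring
  · rw [indicator_of_notMem hy]
    have : deriv Real.smoothTransition ((‖y - x‖ ^ 2 - s ^ 2) / ((s + ε) ^ 2 - s ^ 2)) = 0 := by
      rw [Set.mem_sdiff, not_and_or, not_not, Metric.mem_closedBall, Metric.mem_closedBall,
        dist_eq_norm, not_le] at hy
      rcases hy with hy | hy
      · refine deriv_smoothTransition_eq_zero_of_one_le ?_
        rw [one_le_div hpos]
        have : (s + ε) ^ 2 ≤ ‖y - x‖ ^ 2 := by gcongr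
        linarith
      · refine deriv_smoothTransition_eq_zero_of_nonpos (div_nonpos_of_nonpos_of_nonneg ?_ hpos.le)
        have : ‖y - x‖ ^ 2 ≤ s ^ 2 := by gcongr
        linarith
    simp [this]

/-- The gradient of the cutoff is radial. -/
theorem gradient_outerCutoff_eq_norm_smul (hs : 0 < s) (hε : 0 < ε)
    (y : EuclideanSpace ℝ (Fin n)) :
    ∇ (outerCutoff x s ε) y =
      ‖∇ (outerCutoff x s ε) y‖ • ((max ‖y - x‖ s)⁻¹ • (y - x)) := by
  -- On the annulus the maximum equals ‖y - x‖; off it the gradient is zero. The maximum with s only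
  -- serves to make the radial field continuous at the centre.
  by_cases hy : y ∈ Metric.closedBall x (s + ε) \ Metric.closedBall x s
  · have h1 : s < ‖y - x‖ := by simpa [dist_eq_norm] using hy.2
    have h2 : ‖y - x‖ ≠ 0 := (hs.trans h1).ne'
    rw [max_eq_left h1.le, gradient_outerCutoff, norm_smul, Real.norm_eq_abs, abs_of_nonneg
      (mul_nonneg (deriv_smoothTransition_nonneg _)
        (div_nonneg zero_le_two (sq_sub_sq_pos hs.le hε).le)), smul_smul, mul_assoc _ ‖y - x‖,
      mul_inv_cancel₀ h2, mul_one]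
  · have h := norm_gradient_outerCutoff_le (x := x) hs.le hε y
    rw [indicator_of_notMem hy] at h
    have h0 : ∇ (outerCutoff x s ε) y = 0 := norm_le_zero_iff.1 h
    simp [h0]

theorem continuous_gradient_outerCutoff : Continuous (∇ (outerCutoff x s ε)) :=
  (InnerProductSpace.toDual ℝ _).symm.continuous.comp
    (contDiff_outerCutoff.continuous_fderiv one_ne_zero)

theorem hasCompactSupport_one_sub_outerCutoff (hs : 0 ≤ s) (hε : 0 < ε) :
    HasCompactSupport fun y => 1 - outerCutoff x s ε y := by
  refine HasCompactSupport.intro (isCompact_closedBall x (s + ε)) fun y hy => ?_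
  rw [outerCutoff_eq_one hs hε, sub_self]
  simpa [dist_eq_norm] using (le_of_lt (not_le.1 hy))

theorem tendsto_outerCutoff (hs : 0 ≤ s) {e : ℕ → ℝ} (he : ∀ k, 0 < e k)
    (he0 : Tendsto e atTop (𝓝 0)) (y : EuclideanSpace ℝ (Fin n)) :
    Tendsto (fun k => outerCutoff x s (e k) y) atTop
      (𝓝 ((Metric.closedBall x s)ᶜ.indicator 1 y)) := by
  by_cases hy : y ∈ Metric.closedBall x s
  · rw [indicator_of_notMem (by simpa using hy)]
    refine tendsto_const_nhds.congr fun k => ?_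
    rw [outerCutoff_eq_zero hs (he k) (by simpa [dist_eq_norm] using hy)]
  · rw [indicator_of_mem (by simpa using hy)]
    have hy' : 0 < ‖y - x‖ - s := by
      rw [sub_pos]; simpa [dist_eq_norm] using hy
    refine tendsto_const_nhds.congr' ?_
    filter_upwards [he0.eventually (Iio_mem_nhds hy')] with k hk
    rw [outerCutoff_eq_one hs (he k) (by linarith [show e k < ‖y - x‖ - s from hk]), Pi.one_apply]

end Cutoff

/-! ### Volume growth in balls -/

section Growth

variable {n : ℕ}

/-- The volume of `E` in the closed ball of radius `t`. -/
noncomputable def ballVolume (E : Set (EuclideanSpace ℝ (Fin n))) (x : EuclideanSpace ℝ (Fin n))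
    (t : ℝ) : ℝ :=
  volume.real (E ∩ Metric.closedBall x t)

variable {E : Set (EuclideanSpace ℝ (Fin n))} {x : EuclideanSpace ℝ (Fin n)}

theorem volume_inter_closedBall_ne_top (t : ℝ) : volume (E ∩ Metric.closedBall x t) ≠ ∞ :=
  measure_ne_top_of_subset inter_subset_right measure_closedBall_lt_top.ne

theorem ballVolume_nonneg (t : ℝ) : 0 ≤ ballVolume E x t := measureReal_nonneg

theorem ofReal_ballVolume (t : ℝ) :
    ENNReal.ofReal (ballVolume E x t) = volume (E ∩ Metric.closedBall x t) :=
  ofReal_measureReal (volume_inter_closedBall_ne_top t)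

theorem monotone_ballVolume : Monotone (ballVolume E x) := fun _ _ h =>
  measureReal_mono (inter_subset_inter_right _ (Metric.closedBall_subset_closedBall h))
    (volume_inter_closedBall_ne_top _)

theorem measureReal_annulus {s t : ℝ} (hst : s ≤ t) :
    volume.real (E ∩ (Metric.closedBall x t \ Metric.closedBall x s)) =
      ballVolume E x t - ballVolume E x s := by
  have h := measureReal_inter_add_sdiff (μ := (volume : Measure (EuclideanSpace ℝ (Fin n))))
    (s := E ∩ Metric.closedBall x t) (Metric.isClosed_closedBall (x := x) (ε := s)).measurableSet
    (volume_inter_closedBall_ne_top t)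
  rw [inter_assoc, inter_eq_right.2 (Metric.closedBall_subset_closedBall hst)] at h
  rw [ballVolume, ballVolume, ← h, inter_sdiff_assoc]
  ring

/-- Some radius realizes at most the average growth rate. -/
theorem exists_hasDerivAt_le {g : ℝ → ℝ} (hg : Monotone g) {ρ r : ℝ} (h : ρ < r) :
    ∃ s ∈ Ioo ρ r, ∃ d, HasDerivAt g d s ∧ d ≤ (g r - g ρ) / (r - ρ) := by
  have hint : IntegrableOn (deriv g) (Ioo ρ r) := by
    have := (hg.monotoneOn (uIcc ρ r)).intervalIntegrable_deriv
    rw [intervalIntegrable_iff_integrableOn_Ioo_of_le h.le] at this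
    exact this
  have hle : ∫ t in Ioo ρ r, deriv g t ≤ g r - g ρ := by
    have := (hg.monotoneOn (uIcc ρ r)).intervalIntegral_deriv_mem_uIcc
    rw [uIcc_of_le (sub_nonneg.2 (hg h.le)), intervalIntegral.integral_of_le h.le,
      integral_Ioc_eq_integral_Ioo] at this
    exact this.2
  have hne : volume.restrict (Ioo ρ r) ≠ 0 := by
    rw [Ne, Measure.restrict_eq_zero, Real.volume_Ioo]
    simpa using h
  -- The radius has to avoid this null set. Including the complement of the interval forces the
  -- radius into the interval.
  have hN : volume.restrict (Ioo ρ r) ({t | ¬ DifferentiableAt ℝ g t} ∪ (Ioo ρ r)ᶜ) = 0 := by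
    refine measure_union_null ?_ ?_
    · exact nonpos_iff_eq_zero.1 ((Measure.restrict_apply_le _ _).trans_eq hg.ae_differentiableAt)
    · rw [Measure.restrict_apply measurableSet_Ioo.compl, compl_inter_self, measure_empty]
  obtain ⟨s, hs, hs2⟩ := exists_notMem_null_le_average hne hint hN
  simp only [mem_union, not_or, mem_compl_iff, not_not, mem_ofPred_eq] at hs
  refine ⟨s, hs.2, deriv g s, hs.1.hasDerivAt, hs2.trans ?_⟩
  rw [setAverage_eq, smul_eq_mul, Real.volume_real_Ioo_of_le h.le, div_eq_inv_mul]
  have : 0 < r - ρ := sub_pos.2 h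
  gcongr

theorem tendsto_slope_of_hasDerivAt {g : ℝ → ℝ} {d s : ℝ} (h : HasDerivAt g d s) {e : ℕ → ℝ}
    (he : ∀ k, 0 < e k) (he0 : Tendsto e atTop (𝓝 0)) :
    Tendsto (fun k => (g (s + e k) - g s) / e k) atTop (𝓝 d) := by
  have h1 := (hasDerivAt_iff_tendsto_slope_zero.1 h).comp
    (tendsto_nhdsWithin_iff.2 ⟨he0, Eventually.of_forall fun k => (he k).ne'⟩)
  refine h1.congr fun k => ?_
  simp [div_eq_inv_mul]

/-- The growth rate of the volume is at most the one of balls. -/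
theorem hasDerivAt_ballVolume_le (hn : n ≠ 0) {d s : ℝ} (hs : 0 < s)
    (h : HasDerivAt (ballVolume E x) d s) :
    d ≤ n * volume.real (Metric.closedBall (0 : EuclideanSpace ℝ (Fin n)) 1) * s ^ (n - 1) := by
  set ω := volume.real (Metric.closedBall (0 : EuclideanSpace ℝ (Fin n)) 1)
  have : Nonempty (Fin n) := ⟨⟨0, Nat.pos_of_ne_zero hn⟩⟩
  have hball (t : ℝ) (ht : 0 ≤ t) : volume.real (Metric.closedBall x t) = ω * t ^ n := by
    rw [Measure.addHaar_real_closedBall _ _ ht]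
    simp [ω, mul_comm, Measure.addHaar_real_closedBall _ _ zero_le_one]
  have he (k : ℕ) : (0 : ℝ) < 1 / ((k : ℝ) + 1) := by positivity
  have h1 := tendsto_slope_of_hasDerivAt h he tendsto_one_div_add_atTop_nhds_zero_nat
  have h2 := tendsto_slope_of_hasDerivAt ((hasDerivAt_pow n s).const_mul ω) he
    tendsto_one_div_add_atTop_nhds_zero_nat
  refine (le_of_tendsto_of_tendsto' h1 h2 fun k => ?_).trans_eq (by ring)
  have hk := he k
  refine div_le_div_of_nonneg_right ?_ hk.le
  rw [← hball s hs.le, ← hball _ (by positivity), ← measureReal_annulus (by linarith)]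
  have h3 := measureReal_sdiff_add_inter (μ := (volume : Measure (EuclideanSpace ℝ (Fin n))))
    (s := Metric.closedBall x (s + 1 / ((k : ℝ) + 1)))
    (Metric.isClosed_closedBall (x := x) (ε := s)).measurableSet measure_closedBall_lt_top.ne
  rw [inter_eq_right.2 (Metric.closedBall_subset_closedBall (by linarith))] at h3
  rw [← h3, add_sub_cancel_right]
  exact measureReal_mono inter_subset_right
    (measure_ne_top_of_subset sdiff_subset measure_closedBall_lt_top.ne)

/-- The gradient is at most 2K/ε on an annulus of width ε, so its integral over E is controlled by a
difference quotient of the volume, which tends to V'(s) as ε → 0. -/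
theorem setIntegral_norm_gradient_outerCutoff_le {s ε : ℝ} (hs : 0 ≤ s)
    (hε : 0 < ε) :
    IntegrableOn (fun y => ‖∇ (outerCutoff x s ε) y‖) E ∧
    ∫ y in E, ‖∇ (outerCutoff x s ε) y‖ ≤
      2 * transitionBound * ((ballVolume E x (s + ε) - ballVolume E x s) / ε) := by
  have hA : MeasurableSet (Metric.closedBall x (s + ε) \ Metric.closedBall x s) :=
    Metric.isClosed_closedBall.measurableSet.diff Metric.isClosed_closedBall.measurableSet
  have hAE : volume.restrict E (Metric.closedBall x (s + ε) \ Metric.closedBall x s) ≠ ∞ :=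
    ne_top_of_le_ne_top (measure_ne_top_of_subset sdiff_subset measure_closedBall_lt_top.ne)
      (Measure.restrict_apply_le _ _)
  have hint : Integrable ((Metric.closedBall x (s + ε) \ Metric.closedBall x s).indicator
      (fun _ => 2 * transitionBound / ε)) (volume.restrict E) :=
    (integrable_indicator_iff hA).2 (integrableOn_const hAE)
  have hint2 : Integrable (fun y => ‖∇ (outerCutoff x s ε) y‖) (volume.restrict E) :=
    hint.mono' continuous_gradient_outerCutoff.norm.aestronglyMeasurable
      (Eventually.of_forall fun y => by simpa using norm_gradient_outerCutoff_le hs hε y)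
  refine ⟨hint2, (integral_mono hint2 hint (norm_gradient_outerCutoff_le hs hε)).trans_eq ?_⟩
  rw [integral_indicator hA, setIntegral_const, ← measureReal_annulus (by linarith),
    measureReal_restrict_apply hA, inter_comm, smul_eq_mul]
  ring

/-- The flux of the Gauss–Green measure through a ball is bounded by the growth of the volume. -/
theorem IsGaussGreenPair.norm_setIntegral_closedBall_le
    {m : Measure (EuclideanSpace ℝ (Fin n))}
    {f : EuclideanSpace ℝ (Fin n) → EuclideanSpace ℝ (Fin n)} (h : IsGaussGreenPair E m f)
    {s d : ℝ} (hs : 0 ≤ s) (hd : HasDerivAt (ballVolume E x) d s) :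
    ‖∫ y in Metric.closedBall x s, f y ∂m‖ ≤ 2 * transitionBound * d := by
  have := h.finite
  have he (k : ℕ) : (0 : ℝ) < 1 / ((k : ℝ) + 1) := by positivity
  have he0 := tendsto_one_div_add_atTop_nhds_zero_nat (𝕜 := ℝ)
  have h1 : Tendsto (fun k : ℕ => ∫ y, (1 - outerCutoff x s (1 / ((k : ℝ) + 1)) y) • f y ∂m) atTop
      (𝓝 (∫ y in Metric.closedBall x s, f y ∂m)) := by
    rw [← integral_indicator Metric.isClosed_closedBall.measurableSet]
    refine tendsto_integral_of_dominated_convergence (fun _ => 1) (fun k => ?_)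
      (integrable_const _) (fun k => Eventually.of_forall fun y => ?_)
      (Eventually.of_forall fun y => ?_)
    · exact ((continuous_const.sub contDiff_outerCutoff.continuous).aestronglyMeasurable.smul
        h.measurable.aestronglyMeasurable)
    · rw [norm_smul, Real.norm_eq_abs, abs_of_nonneg (sub_nonneg.2 outerCutoff_le_one)]
      have h1 : 1 - outerCutoff x s (1 / ((k : ℝ) + 1)) y ≤ 1 := by
        linarith [outerCutoff_nonneg (x := x) (s := s) (ε := 1 / ((k : ℝ) + 1)) (y := y)]
      exact mul_le_one₀ h1 (norm_nonneg _) (h.norm_le y)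
    · have h2 := ((tendsto_outerCutoff (x := x) hs he he0 y).const_sub 1).smul_const (f y)
      have h3 : (Metric.closedBall x s).indicator f y =
          (1 - (Metric.closedBall x s)ᶜ.indicator 1 y : ℝ) • f y := by
        by_cases hy : y ∈ Metric.closedBall x s <;> simp [hy]
      rw [h3]
      exact h2
  have h2 := (tendsto_slope_of_hasDerivAt hd he he0).const_mul (2 * transitionBound)
  refine le_of_tendsto_of_tendsto' h1.norm h2 fun k => ?_
  -- With 1 - η as test function, the flux becomes an integral of -∇η over E, bounded by the
  -- difference quotient.
  rw [← h.gauss_green _ (contDiff_const.sub contDiff_outerCutoff)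
    (hasCompactSupport_one_sub_outerCutoff hs (he k))]
  refine (norm_integral_le_integral_norm _).trans ?_
  refine le_trans (le_of_eq ?_) (setIntegral_norm_gradient_outerCutoff_le hs (he k)).2
  refine integral_congr_ae (Eventually.of_forall fun y => ?_)
  simp only [gradient, LinearIsometryEquiv.norm_map]
  rw [fderiv_const_sub, norm_neg]

end Growth

/-! ### Removing a ball from a set of finite perimeter -/

section Truncation

variable {n : ℕ}

/-- Weak convergence is tested on scalar functions; an orthonormal basis reduces the vector-valued
integrand to these. -/
theorem tendsto_integral_vector_of_tendsto_finiteMeasure {Ω ι : Type*} [MeasurableSpace Ω]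
    [TopologicalSpace Ω] [OpensMeasurableSpace Ω] {L : Filter ι} {μs : ι → FiniteMeasure Ω}
    {μ : FiniteMeasure Ω} (h : Tendsto μs L (𝓝 μ)) {F : Ω → EuclideanSpace ℝ (Fin n)}
    (hF : Continuous F) {C : ℝ} (hC : ∀ y, ‖F y‖ ≤ C) :
    Tendsto (fun i => ∫ y, F y ∂(μs i : Measure Ω)) L (𝓝 (∫ y, F y ∂(μ : Measure Ω))) := by
  let b := EuclideanSpace.basisFun (Fin n) ℝ
  have hint (ν : FiniteMeasure Ω) : Integrable F (ν : Measure Ω) :=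
    Integrable.of_bound hF.aestronglyMeasurable C (Eventually.of_forall hC)
  have key (ν : FiniteMeasure Ω) :
      ∫ y, F y ∂(ν : Measure Ω) = ∑ i, (∫ y, inner ℝ (b i) (F y) ∂(ν : Measure Ω)) • b i := by
    simp_rw [integral_inner (hint ν)]
    exact (b.sum_repr' _).symm
  simp_rw [key]
  refine tendsto_finsetSum _ fun i _ => Tendsto.smul_const ?_ _
  let G : BoundedContinuousFunction Ω ℝ := BoundedContinuousFunction.ofNormedAddCommGroup
    (fun y => inner ℝ (b i) (F y)) (continuous_const.inner hF) C fun y => by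
      refine (norm_inner_le_norm _ _).trans ?_
      rw [b.norm_eq_one, one_mul]
      exact hC y
  exact FiniteMeasure.tendsto_iff_forall_integral_tendsto.1 h G

/-- Weak limit points of finite measures supported in a compact set. -/
theorem exists_tendsto_hyperfilter_finiteMeasure {Ω : Type*} [MeasurableSpace Ω]
    [TopologicalSpace Ω] [T2Space Ω] [NormalSpace Ω] [BorelSpace Ω] {μs : ℕ → FiniteMeasure Ω}
    {C : NNReal} (hC : ∀ k, (μs k).mass ≤ C) {K : Set Ω} (hK : IsCompact K)
    (h0 : ∀ k, μs k Kᶜ = 0) :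
    ∃ μ : FiniteMeasure Ω, Tendsto μs (hyperfilter ℕ) (𝓝 μ) := by
  -- Prokhorov compactness. Taking the limit along a fixed ultrafilter replaces the extraction of a
  -- subsequence.
  have hcomp := isCompact_setOfPred_finiteMeasure_mass_le_compl_isCompact_le (E := Ω)
    (u := fun _ => 0) (K := fun _ => K) C tendsto_const_nhds (fun _ => hK) (Or.inr monotone_const)
  obtain ⟨μ, -, hμ⟩ := isCompact_iff_ultrafilter_le_nhds'.1 hcomp
    ((hyperfilter ℕ).map μs) (by
      rw [Ultrafilter.mem_map]
      exact Filter.univ_mem' fun k => ⟨hC k, fun _ => by simp [h0 k]⟩)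
  exact ⟨μ, hμ⟩

variable {E : Set (EuclideanSpace ℝ (Fin n))} {x : EuclideanSpace ℝ (Fin n)}
  {m : Measure (EuclideanSpace ℝ (Fin n))}
  {f : EuclideanSpace ℝ (Fin n) → EuclideanSpace ℝ (Fin n)}

theorem norm_inv_max_smul_le_one {s : ℝ} (hs : 0 < s) (y : EuclideanSpace ℝ (Fin n)) :
    ‖(max ‖y - x‖ s)⁻¹ • (y - x)‖ ≤ 1 := by
  have : 0 < max ‖y - x‖ s := lt_max_of_lt_right hs
  rw [norm_smul, norm_inv, Real.norm_eq_abs, abs_of_pos this, inv_mul_le_one₀ this]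
  exact le_max_left _ _

theorem continuous_inv_max_smul {s : ℝ} (hs : 0 < s) :
    Continuous fun y : EuclideanSpace ℝ (Fin n) => (max ‖y - x‖ s)⁻¹ • (y - x) := by
  have h : ∀ y : EuclideanSpace ℝ (Fin n), max ‖y - x‖ s ≠ 0 := fun y =>
    (lt_max_of_lt_right hs).ne'
  exact (Continuous.inv₀ (by fun_prop) h).smul (by fun_prop)

/-- The limit of the densities `‖∇η‖` on `E` as the cutoff functions `η` approach the indicator of
the complement of a ball: a measure on the sphere representing the trace of `E`. -/
theorem exists_trace_measure {s d : ℝ} (hs : 0 < s)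
    (hd : HasDerivAt (ballVolume E x) d s) :
    ∃ τ : Measure (EuclideanSpace ℝ (Fin n)), τ univ ≤ ENNReal.ofReal (2 * transitionBound * d) ∧
      τ (Metric.closedBall x s)ᶜ = 0 ∧
      ∀ φ : EuclideanSpace ℝ (Fin n) → ℝ, Continuous φ → HasCompactSupport φ →
        Tendsto (fun k : ℕ => ∫ y in E, φ y • ∇ (outerCutoff x s (1 / ((k : ℝ) + 1))) y)
          (hyperfilter ℕ) (𝓝 (∫ y, φ y • ((max ‖y - x‖ s)⁻¹ • (y - x)) ∂τ)) := by
  set e : ℕ → ℝ := fun k => 1 / ((k : ℝ) + 1) with he_def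
  have he (k : ℕ) : 0 < e k := by positivity
  have he1 (k : ℕ) : e k ≤ 1 := by
    rw [he_def]; simp only
    rw [div_le_one (by positivity)]
    linarith [(Nat.cast_nonneg k : (0 : ℝ) ≤ k)]
  have he0 : Tendsto e atTop (𝓝 0) := tendsto_one_div_add_atTop_nhds_zero_nat
  set w : EuclideanSpace ℝ (Fin n) → EuclideanSpace ℝ (Fin n) :=
    fun y => (max ‖y - x‖ s)⁻¹ • (y - x) with hw
  set D : ℕ → EuclideanSpace ℝ (Fin n) → ℝ := fun k y => ‖∇ (outerCutoff x s (e k)) y‖ with hD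
  have hDc (k : ℕ) : Continuous (D k) := continuous_gradient_outerCutoff.norm
  have hDi (k : ℕ) : IntegrableOn (D k) E :=
    (setIntegral_norm_gradient_outerCutoff_le hs.le (he k)).1
  set M : ℕ → ℝ := fun k => 2 * transitionBound *
    ((ballVolume E x (s + e k) - ballVolume E x s) / e k) with hM
  have hMlim : Tendsto M atTop (𝓝 (2 * transitionBound * d)) :=
    (tendsto_slope_of_hasDerivAt hd he he0).const_mul _
  have hDM (k : ℕ) : ∫ y in E, D k y ≤ M k :=
    (setIntegral_norm_gradient_outerCutoff_le hs.le (he k)).2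
  -- The masses of these measures are bounded by difference quotients converging to 2K d, and their
  -- supports stay in the ball of radius s + 1.
  let ν : ℕ → Measure (EuclideanSpace ℝ (Fin n)) := fun k =>
    (volume.restrict E).withDensity fun y => ENNReal.ofReal (D k y)
  have hνuniv (k : ℕ) : ν k univ = ENNReal.ofReal (∫ y in E, D k y) := by
    rw [withDensity_apply _ MeasurableSet.univ, Measure.restrict_univ,
      ofReal_integral_eq_lintegral_ofReal (hDi k) (Eventually.of_forall fun y => norm_nonneg _)]
  have hνfin (k : ℕ) : IsFiniteMeasure (ν k) := ⟨by rw [hνuniv]; exact ENNReal.ofReal_lt_top⟩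
  let νf : ℕ → FiniteMeasure (EuclideanSpace ℝ (Fin n)) := fun k => ⟨ν k, hνfin k⟩
  have hνint {F : Type} [NormedAddCommGroup F] [NormedSpace ℝ F]
      (g : EuclideanSpace ℝ (Fin n) → F) (k : ℕ) : ∫ y, g y ∂(ν k) = ∫ y in E, D k y • g y := by
    rw [integral_withDensity_eq_integral_toReal_smul (hDc k).measurable.ennreal_ofReal
      (Eventually.of_forall fun y => ENNReal.ofReal_lt_top)]
    refine integral_congr_ae (Eventually.of_forall fun y => ?_)
    simp only
    rw [ENNReal.toReal_ofReal (norm_nonneg _)]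
  obtain ⟨C, hC⟩ := hMlim.bddAbove_range
  have hsupp (k : ℕ) : ν k (Metric.closedBall x (s + 1))ᶜ = 0 := by
    rw [withDensity_apply _ Metric.isClosed_closedBall.measurableSet.compl]
    refine setLIntegral_eq_zero Metric.isClosed_closedBall.measurableSet.compl fun y hy => ?_
    have h1 := norm_gradient_outerCutoff_le (x := x) hs.le (he k) y
    rw [indicator_of_notMem] at h1
    · simp only [hD, Pi.zero_apply, ENNReal.ofReal_eq_zero]; exact h1
    · intro h2
      exact hy (Metric.closedBall_subset_closedBall (by linarith [he1 k]) h2.1)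
  obtain ⟨τ, hτ⟩ := exists_tendsto_hyperfilter_finiteMeasure (μs := νf) (C := C.toNNReal)
    (K := Metric.closedBall x (s + 1)) (fun k => by
      have h1 : ν k univ ≤ ENNReal.ofReal C := by
        rw [hνuniv]
        exact ENNReal.ofReal_le_ofReal ((hDM k).trans (hC (mem_range_self k)))
      exact ENNReal.toNNReal_mono ENNReal.ofReal_ne_top h1) (isCompact_closedBall _ _)
    (fun k => by
      change (ν k _).toNNReal = 0
      rw [hsupp k, ENNReal.toNNReal_zero])
  have hle : (hyperfilter ℕ : Filter ℕ) ≤ atTop := Nat.hyperfilter_le_atTop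
  refine ⟨τ, ?_, ?_, fun φ hφ hc => ?_⟩
  · have h1 := (FiniteMeasure.tendsto_iff_forall_integral_tendsto.1 hτ)
      (BoundedContinuousFunction.const _ (1 : ℝ))
    simp only [BoundedContinuousFunction.const_apply] at h1
    have h2 : ∫ _, (1 : ℝ) ∂(τ : Measure (EuclideanSpace ℝ (Fin n))) ≤
        2 * transitionBound * d := by
      refine le_of_tendsto_of_tendsto' h1 (hMlim.mono_left hle) fun k => ?_
      refine le_trans (le_of_eq ?_) (hDM k)
      change ∫ _, (1 : ℝ) ∂(ν k) = _
      rw [hνint]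
      simp
    rw [integral_const, smul_eq_mul, mul_one, measureReal_def] at h2
    exact (ENNReal.le_ofReal_iff_toReal_le (measure_ne_top _ _)
      (ENNReal.toReal_nonneg.trans h2)).2 h2
  -- The truncated distance to the ball is at most `e k` on the annulus carrying `ν k`, so its
  -- integral tends to 0 and the limit measure does not charge the exterior, where h > 0.
  · let h : BoundedContinuousFunction (EuclideanSpace ℝ (Fin n)) ℝ :=
      BoundedContinuousFunction.ofNormedAddCommGroup
        (fun y => min 1 (max 0 (‖y - x‖ - s))) (by fun_prop) 1 fun y => by
          rw [Real.norm_eq_abs, abs_of_nonneg (le_min zero_le_one (le_max_left _ _))]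
          exact min_le_left _ _
    have hh (y : EuclideanSpace ℝ (Fin n)) : h y = min 1 (max 0 (‖y - x‖ - s)) := rfl
    have hh0 (y : EuclideanSpace ℝ (Fin n)) : 0 ≤ h y := le_min zero_le_one (le_max_left _ _)
    have h1 := (FiniteMeasure.tendsto_iff_forall_integral_tendsto.1 hτ) h
    have h2 : Tendsto (fun k => e k * M k) (hyperfilter ℕ) (𝓝 0) := by
      have := (he0.mul hMlim).mono_left hle
      rwa [zero_mul] at this
    have h3 : ∫ y, h y ∂(τ : Measure (EuclideanSpace ℝ (Fin n))) = 0 := by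
      refine le_antisymm (le_of_tendsto_of_tendsto' h1 h2 fun k => ?_)
        (integral_nonneg hh0)
      change ∫ y, h y ∂(ν k) ≤ _
      rw [hνint]
      calc ∫ y in E, D k y • h y ≤ ∫ y in E, e k * D k y := by
            refine integral_mono_of_nonneg (Eventually.of_forall fun y =>
              mul_nonneg (norm_nonneg _) (hh0 y)) ((hDi k).const_mul _)
              (Eventually.of_forall fun y => ?_)
            simp only [smul_eq_mul]
            by_cases hy : y ∈ Metric.closedBall x (s + e k) \ Metric.closedBall x s
            · rw [mul_comm]
              refine mul_le_mul_of_nonneg_right ?_ (norm_nonneg _)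
              rw [hh]
              refine (min_le_right _ _).trans (max_le (he k).le ?_)
              have : ‖y - x‖ ≤ s + e k := by simpa [dist_eq_norm] using hy.1
              linarith
            · have h1 := norm_gradient_outerCutoff_le (x := x) hs.le (he k) y
              rw [indicator_of_notMem hy] at h1
              have h0 : D k y = 0 := le_antisymm h1 (norm_nonneg _)
              simp [h0]
        _ ≤ e k * M k := by
            rw [integral_const_mul]
            exact mul_le_mul_of_nonneg_left (hDM k) (he k).le
    have h4 : h =ᵐ[(τ : Measure (EuclideanSpace ℝ (Fin n)))] 0 :=
      (integral_eq_zero_iff_of_nonneg hh0 (h.integrable _)).1 h3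
    refine measure_mono_null (fun y hy => ?_) (ae_iff.1 h4)
    have hy' : 0 < ‖y - x‖ - s := by
      rw [sub_pos]; simpa [dist_eq_norm] using hy
    change h y ≠ 0
    rw [hh]
    exact (lt_min zero_lt_one (lt_max_of_lt_right hy')).ne'
  · obtain ⟨B, hB⟩ := hφ.bounded_above_of_compact_support hc
    have hwc : Continuous w := continuous_inv_max_smul hs
    have h1 := tendsto_integral_vector_of_tendsto_finiteMeasure hτ (F := fun y => φ y • w y)
      (hφ.smul hwc) (C := B) (fun y => by
        rw [norm_smul]
        exact (mul_le_of_le_one_right (norm_nonneg _) (norm_inv_max_smul_le_one hs y)).trans (hB y))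
    refine h1.congr fun k => ?_
    change ∫ y, φ y • w y ∂(ν k) = _
    rw [hνint]
    refine integral_congr_ae (Eventually.of_forall fun y => ?_)
    simp only
    -- ∇η is its norm times a fixed continuous field w, so weak convergence of the norms as
    -- densities is enough.
    rw [gradient_outerCutoff_eq_norm_smul hs (he k) y, smul_comm]

open Classical in
/-- At a radius where the volume growth is differentiable, removing the ball from `E` leaves a set
of finite perimeter, unchanged outside the ball, and with perimeter on the sphere controlled by the
growth rate. -/
theorem IsGaussGreenPair.sdiff_closedBall (h : IsGaussGreenPair E m f) {s d : ℝ} (hs : 0 < s)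
    (hd : HasDerivAt (ballVolume E x) d s) :
    ∃ m' f', IsGaussGreenPair (E \ Metric.closedBall x s) m' f' ∧
      m'.restrict (Metric.closedBall x s)ᶜ = m.restrict (Metric.closedBall x s)ᶜ ∧
      EqOn f' f (Metric.closedBall x s)ᶜ ∧
      m' (Metric.closedBall x s) ≤ ENNReal.ofReal (2 * transitionBound * d) := by
  obtain ⟨τ, hτm, hτ0, hτ⟩ := exists_trace_measure hs hd
  have hmfin := h.finite
  have hτfin : IsFiniteMeasure τ := ⟨hτm.trans_lt ENNReal.ofReal_lt_top⟩
  set B := Metric.closedBall x s with hBdef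
  have hB : MeasurableSet B := Metric.isClosed_closedBall.measurableSet
  set w : EuclideanSpace ℝ (Fin n) → EuclideanSpace ℝ (Fin n) :=
    fun y => (max ‖y - x‖ s)⁻¹ • (y - x) with hw
  have hwc : Continuous w := continuous_inv_max_smul hs
  set f' : EuclideanSpace ℝ (Fin n) → EuclideanSpace ℝ (Fin n) := B.piecewise (-w) f with hf'
  have hf'm : Measurable f' := hwc.measurable.neg.piecewise hB h.measurable
  have hf'1 : ∀ y, ‖f' y‖ ≤ 1 := fun y => by
    by_cases hy : y ∈ B
    · rw [hf', piecewise_eq_of_mem _ _ _ hy, Pi.neg_apply, norm_neg]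
      exact norm_inv_max_smul_le_one hs y
    · rw [hf', piecewise_eq_of_notMem _ _ _ hy]
      exact h.norm_le y
  -- The old measure survives outside the ball, and the trace measure is added with density -w,
  -- since the outward normal of E \ B on the sphere points into the ball.
  refine ⟨m.restrict Bᶜ + τ, f', ⟨inferInstance, hf'm, hf'1, fun φ hφ hc => ?_⟩, ?_, fun y hy => ?_,
    ?_⟩
  · obtain ⟨C, hC⟩ := hφ.continuous.bounded_above_of_compact_support hc
    have he (k : ℕ) : (0 : ℝ) < 1 / ((k : ℝ) + 1) := by positivity
    have he0 : Tendsto (fun k : ℕ => 1 / ((k : ℝ) + 1)) atTop (𝓝 0) :=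
      tendsto_one_div_add_atTop_nhds_zero_nat
    set η : ℕ → EuclideanSpace ℝ (Fin n) → ℝ := fun k => outerCutoff x s (1 / ((k : ℝ) + 1))
      with hη
    have hηb (k : ℕ) (y : EuclideanSpace ℝ (Fin n)) : |η k y| ≤ 1 := by
      rw [abs_of_nonneg outerCutoff_nonneg]; exact outerCutoff_le_one
    have hη1 (k : ℕ) : ContDiff ℝ 1 (η k) := contDiff_outerCutoff
    have hle : (hyperfilter ℕ : Filter ℕ) ≤ atTop := Nat.hyperfilter_le_atTop
    have hgi := integrable_gradient hφ hc
    have L1 : Tendsto (fun k => ∫ y in E, η k y • ∇ φ y) atTop (𝓝 (∫ y in E \ B, ∇ φ y)) := by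
      have hset : ∫ y in E \ B, ∇ φ y = ∫ y in E, Bᶜ.indicator (∇ φ) y := by
        rw [integral_indicator hB.compl, Measure.restrict_restrict hB.compl, inter_comm]
        rfl
      rw [hset]
      refine tendsto_integral_of_dominated_convergence (fun y => ‖∇ φ y‖) (fun k => ?_)
        hgi.norm.integrableOn (fun k => Eventually.of_forall fun y => ?_)
        (Eventually.of_forall fun y => ?_)
      · exact (hη1 k).continuous.aestronglyMeasurable.smul hgi.1.restrict
      · rw [norm_smul]
        exact mul_le_of_le_one_left (norm_nonneg _) (hηb k y)
      · have h3 : Bᶜ.indicator (∇ φ) y = (Bᶜ.indicator 1 y : ℝ) • ∇ φ y := by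
          by_cases hy : y ∈ B <;> simp [hy]
        rw [h3]
        exact (tendsto_outerCutoff hs.le he he0 y).smul_const _
    have L2 : Tendsto (fun k => ∫ y, (φ y * η k y) • f y ∂m) atTop
        (𝓝 (∫ y in Bᶜ, φ y • f y ∂m)) := by
      rw [← integral_indicator hB.compl]
      refine tendsto_integral_of_dominated_convergence (fun _ => C) (fun k => ?_)
        (integrable_const _) (fun k => Eventually.of_forall fun y => ?_)
        (Eventually.of_forall fun y => ?_)
      · exact (hφ.continuous.mul (hη1 k).continuous).aestronglyMeasurable.smul
          h.measurable.aestronglyMeasurable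
      · rw [norm_smul, norm_mul]
        exact (mul_le_of_le_one_right (by positivity) (h.norm_le y)).trans
          ((mul_le_of_le_one_right (norm_nonneg _) (hηb k y)).trans (hC y))
      · have h3 : Bᶜ.indicator (fun y => φ y • f y) y = (φ y * Bᶜ.indicator 1 y : ℝ) • f y := by
          by_cases hy : y ∈ B <;> simp [hy]
        rw [h3]
        exact ((tendsto_outerCutoff hs.le he he0 y).const_mul _).smul_const _
    have L3 := hτ φ hφ.continuous hc
    -- The Gauss–Green formula for E tested with φ η and the product rule; in the limit the first
    -- term becomes the trace term and the second the integral of ∇φ over E \ B.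
    have key (k : ℕ) : ∫ y, (φ y * η k y) • f y ∂m =
        (∫ y in E, φ y • ∇ (η k) y) + ∫ y in E, η k y • ∇ φ y := by
      rw [← h.gauss_green (fun y => φ y * η k y) (hφ.mul (hη1 k)) hc.mul_right]
      have hgrad (y : EuclideanSpace ℝ (Fin n)) :
          ∇ (fun y => φ y * η k y) y = φ y • ∇ (η k) y + η k y • ∇ φ y := by
        simp only [gradient]
        rw [fderiv_fun_mul (hφ.differentiable one_ne_zero y) ((hη1 k).differentiable one_ne_zero y)]
        simp
      simp_rw [hgrad]
      refine integral_add ?_ ?_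
      · exact ((hφ.continuous.smul continuous_gradient_outerCutoff).integrable_of_hasCompactSupport
          hc.smul_right).integrableOn
      · refine (hgi.norm.mono' ((hη1 k).continuous.aestronglyMeasurable.smul hgi.1)
          (Eventually.of_forall fun y => ?_)).integrableOn
        rw [Pi.smul_apply', norm_smul]
        exact mul_le_of_le_one_left (norm_nonneg _) (hηb k y)
    have hlim := tendsto_nhds_unique (L2.mono_left hle)
      ((L3.add (L1.mono_left hle)).congr fun k => (key k).symm)
    have hint (ν : Measure (EuclideanSpace ℝ (Fin n))) [IsFiniteMeasure ν] :
        Integrable (fun y => φ y • f' y) ν := by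
      refine Integrable.of_bound (hφ.continuous.aestronglyMeasurable.smul
        hf'm.aestronglyMeasurable) C (Eventually.of_forall fun y => ?_)
      rw [norm_smul]
      exact (mul_le_of_le_one_right (norm_nonneg _) (hf'1 y)).trans (hC y)
    rw [integral_add_measure (hint _) (hint _)]
    have e1 : ∫ y in Bᶜ, φ y • f' y ∂m = ∫ y in Bᶜ, φ y • f y ∂m := by
      refine setIntegral_congr_fun hB.compl fun y hy => ?_
      simp only [hf']
      rw [piecewise_eq_of_notMem _ _ _ hy]
    have e2 : ∫ y, φ y • f' y ∂τ = - ∫ y, φ y • w y ∂τ := by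
      rw [← integral_neg]
      refine integral_congr_ae ?_
      have : ∀ᵐ y ∂τ, y ∈ B := by
        rw [ae_iff]; exact hτ0
      filter_upwards [this] with y hy
      simp only [hf']
      rw [piecewise_eq_of_mem _ _ _ hy, Pi.neg_apply, smul_neg]
    rw [e1, e2, hlim]
    simp only [hw]
    abel
  · rw [Measure.restrict_add, Measure.restrict_restrict hB.compl, inter_self,
      Measure.restrict_eq_zero.2 hτ0, add_zero]
  · exact piecewise_eq_of_notMem _ _ _ hy
  · rw [Measure.add_apply, Measure.restrict_apply hB, inter_compl_self, measure_empty, zero_add]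
    exact (measure_mono (subset_univ _)).trans hτm

end Truncation

/-! ### Mollification -/

section Mollification

open scoped Convolution

variable {n : ℕ} {E : Set (EuclideanSpace ℝ (Fin n))}
  {m : Measure (EuclideanSpace ℝ (Fin n))}
  {f : EuclideanSpace ℝ (Fin n) → EuclideanSpace ℝ (Fin n)}

theorem IsGaussGreenPair.congr_set (h : IsGaussGreenPair E m f)
    {F : Set (EuclideanSpace ℝ (Fin n))} (hEF : E =ᵐ[volume] F) : IsGaussGreenPair F m f :=
  ⟨h.finite, h.measurable, h.norm_le, fun φ hφ hc => by
    rw [← setIntegral_congr_set hEF, h.gauss_green φ hφ hc]⟩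

/-- The derivative of the mollified indicator falls on the kernel, and the Gauss–Green formula with
the translated kernel as test function turns it into the mollification of -f m, where ‖f‖ ≤ 1. -/
theorem enorm_fderiv_normed_convolution_le (h : IsGaussGreenPair E m f) (hE : MeasurableSet E)
    (φ : ContDiffBump (0 : EuclideanSpace ℝ (Fin n))) (x₀ : EuclideanSpace ℝ (Fin n)) :
    ‖fderiv ℝ (φ.normed volume ⋆[ContinuousLinearMap.lsmul ℝ ℝ, volume]
      (E.indicator fun _ => (1 : ℝ))) x₀‖ₑ ≤ ∫⁻ y, ENNReal.ofReal (φ.normed volume (x₀ - y)) ∂m := by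
  have := h.finite
  have hg : LocallyIntegrable (E.indicator fun _ => (1 : ℝ))
      (volume : Measure (EuclideanSpace ℝ (Fin n))) :=
    (locallyIntegrable_const (1 : ℝ)).indicator hE
  have hφ1 : ContDiff ℝ 1 (φ.normed volume) := φ.contDiff_normed
  have hφc : HasCompactSupport (φ.normed (volume : Measure (EuclideanSpace ℝ (Fin n)))) :=
    φ.hasCompactSupport_normed
  set ψ : EuclideanSpace ℝ (Fin n) → ℝ := fun y => φ.normed volume (x₀ - y) with hψ
  have hψ1 : ContDiff ℝ 1 ψ := hφ1.comp (contDiff_const.sub contDiff_id)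
  have hψc : HasCompactSupport ψ := hφc.comp_homeomorph (Homeomorph.subLeft x₀)
  have hψi : Integrable ψ m := hψ1.continuous.integrable_of_hasCompactSupport hψc
  have hψ0 : ∀ y, 0 ≤ ψ y := fun y => φ.nonneg_normed _
  rw [(hφc.hasFDerivAt_convolution_left (ContinuousLinearMap.lsmul ℝ ℝ) hφ1 hg x₀).fderiv]
  rw [← ofReal_integral_eq_lintegral_ofReal hψi (Eventually.of_forall hψ0), ← ofReal_norm]
  refine ENNReal.ofReal_le_ofReal ?_
  refine ContinuousLinearMap.opNorm_le_bound _ (integral_nonneg hψ0) fun v => ?_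
  have hψfd (y : EuclideanSpace ℝ (Fin n)) :
      fderiv ℝ ψ y = - fderiv ℝ (φ.normed volume) (x₀ - y) := by
    have h1 := ((hφ1.differentiable one_ne_zero) (x₀ - y)).hasFDerivAt.comp y
      ((hasFDerivAt_id y).const_sub x₀)
    refine h1.fderiv.trans ?_
    ext v; simp
  have hconv : (fderiv ℝ (φ.normed volume) ⋆[(ContinuousLinearMap.lsmul ℝ ℝ).precompL _, volume]
      (E.indicator fun _ => (1 : ℝ))) x₀ = ∫ y in E, - fderiv ℝ ψ y := by
    rw [convolution_eq_swap, ← integral_indicator hE]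
    refine integral_congr_ae (Eventually.of_forall fun y => ?_)
    ext v
    simp only [ContinuousLinearMap.precompL_apply]
    by_cases hy : y ∈ E
    · simp [hy, hψfd]
    · simp [hy]
  have hψfi : Integrable (fderiv ℝ ψ) volume :=
    (hψ1.continuous_fderiv one_ne_zero).integrable_of_hasCompactSupport (hψc.fderiv (𝕜 := ℝ))
  have key : (∫ y in E, - fderiv ℝ ψ y) v = - inner ℝ (∫ y in E, ∇ ψ y) v := by
    rw [integral_neg, neg_apply,
      ContinuousLinearMap.integral_apply hψfi.integrableOn, real_inner_comm,
      ← integral_inner (integrable_gradient hψ1 hψc).integrableOn]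
    congr 1
    refine integral_congr_ae (Eventually.of_forall fun y => ?_)
    simp only
    rw [real_inner_comm]
    simp [gradient]
  rw [hconv]
  rw [key, norm_neg, h.gauss_green ψ hψ1 hψc]
  refine (norm_inner_le_norm _ _).trans (mul_le_mul_of_nonneg_right ?_ (norm_nonneg _))
  refine (norm_integral_le_integral_norm _).trans (integral_mono_of_nonneg
    (Eventually.of_forall fun y => norm_nonneg _) hψi (Eventually.of_forall fun y => ?_))
  simp only
  rw [norm_smul, Real.norm_eq_abs, abs_of_nonneg (hψ0 y)]
  exact mul_le_of_le_one_right (hψ0 y) (h.norm_le y)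

/-- Approximation of the indicator of a set of finite perimeter by smooth functions. -/
theorem IsGaussGreenPair.exists_mollification (h : IsGaussGreenPair E m f)
    (hE : NullMeasurableSet E) :
    ∃ u : ℕ → EuclideanSpace ℝ (Fin n) → ℝ, (∀ k, ContDiff ℝ 1 (u k)) ∧
      (∀ k y, 0 ≤ u k y ∧ u k y ≤ 1) ∧
      (∀ᵐ y, Tendsto (fun k => u k y) atTop (𝓝 (E.indicator (fun _ => 1) y))) ∧
      ∀ k x r, ∫⁻ y in Metric.ball x r, ‖fderiv ℝ (u k) y‖ₑ ≤
        m (Metric.ball x (r + 1 / ((k : ℝ) + 1))) := by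
  -- Replacing E by a measurable set that agrees with it almost everywhere changes neither the
  -- Gauss–Green pair nor the limit of the mollifications.
  wlog hEm : MeasurableSet E generalizing E
  · obtain ⟨F, hF, hEF⟩ := hE.exists_measurable_superset_ae_eq
    obtain ⟨u, h1, h2, h3, h4⟩ := this (h.congr_set hEF.2.symm) hEF.1.nullMeasurableSet hEF.1
    refine ⟨u, h1, h2, ?_, h4⟩
    filter_upwards [h3, hEF.2] with y hy hy2
    have : E.indicator (fun _ => (1 : ℝ)) y = F.indicator (fun _ => 1) y := by
      have hiff : y ∈ F ↔ y ∈ E := iff_of_eq hy2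
      by_cases hyE : y ∈ E <;> simp [hyE, hiff]
    rwa [this]
  have := h.finite
  have hg : LocallyIntegrable (E.indicator fun _ => (1 : ℝ))
      (volume : Measure (EuclideanSpace ℝ (Fin n))) :=
    (locallyIntegrable_const (1 : ℝ)).indicator hEm
  -- Inner radius half of the outer one: the bounded ratio is what convergence at almost every point
  -- requires.
  let φ : ℕ → ContDiffBump (0 : EuclideanSpace ℝ (Fin n)) := fun k =>
    ⟨1 / ((k : ℝ) + 1) / 2, 1 / ((k : ℝ) + 1), by positivity, half_lt_self (by positivity)⟩
  have hφout (k : ℕ) : (φ k).rOut = 1 / ((k : ℝ) + 1) := rfl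
  have hφin (k : ℕ) : (φ k).rIn = 1 / ((k : ℝ) + 1) / 2 := rfl
  refine ⟨fun k => (φ k).normed volume ⋆[ContinuousLinearMap.lsmul ℝ ℝ, volume]
      (E.indicator fun _ => (1 : ℝ)), fun k => ?_, fun k y => ?_, ?_, fun k x r => ?_⟩
  · exact (φ k).hasCompactSupport_normed.contDiff_convolution_left _ (φ k).contDiff_normed hg
  · have hint : Integrable (fun t => (φ k).normed volume t) volume := (φ k).integrable_normed
    have hle (t : EuclideanSpace ℝ (Fin n)) :
        E.indicator (fun _ => (1 : ℝ)) (y - t) ∈ Icc (0 : ℝ) 1 := by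
      by_cases ht : y - t ∈ E <;> simp [ht]
    simp only [convolution_def, ContinuousLinearMap.lsmul_apply, smul_eq_mul]
    refine ⟨integral_nonneg fun t => mul_nonneg ((φ k).nonneg_normed t) (hle t).1, ?_⟩
    refine le_of_le_of_eq ?_ ((φ k).integral_normed (μ := volume))
    refine integral_mono_of_nonneg (Eventually.of_forall fun t =>
      mul_nonneg ((φ k).nonneg_normed t) (hle t).1) hint (Eventually.of_forall fun t => ?_)
    exact mul_le_of_le_one_right ((φ k).nonneg_normed t) (hle t).2
  · refine ContDiffBump.ae_convolution_tendsto_right_of_locallyIntegrable (K := 2) ?_ ?_ hg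
    · simp_rw [hφout]; exact tendsto_one_div_add_atTop_nhds_zero_nat
    · refine Eventually.of_forall fun k => ?_
      rw [hφout, hφin]; linarith
  · calc ∫⁻ y in Metric.ball x r, ‖fderiv ℝ ((φ k).normed volume
          ⋆[ContinuousLinearMap.lsmul ℝ ℝ, volume] (E.indicator fun _ => (1 : ℝ))) y‖ₑ
        ≤ ∫⁻ y in Metric.ball x r, ∫⁻ z, ENNReal.ofReal ((φ k).normed volume (y - z)) ∂m :=
          lintegral_mono fun y => enorm_fderiv_normed_convolution_le h hEm (φ k) y
      -- After exchanging the integrals, the kernel centred at z has mass at most 1 in the ball, and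
      -- mass 0 when z is at distance r + 1/(k+1) or more from x.
      _ = ∫⁻ z, (∫⁻ y in Metric.ball x r, ENNReal.ofReal ((φ k).normed volume (y - z))) ∂m := by
          refine lintegral_lintegral_swap ?_
          exact (ENNReal.continuous_ofReal.comp ((φ k).contDiff_normed (n := 1).continuous.comp
            (continuous_fst.sub continuous_snd))).aemeasurable
      _ ≤ ∫⁻ z, (Metric.ball x (r + 1 / ((k : ℝ) + 1))).indicator (fun _ => 1) z ∂m := by
          refine lintegral_mono fun z => ?_
          by_cases hz : z ∈ Metric.ball x (r + 1 / ((k : ℝ) + 1))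
          · rw [indicator_of_mem hz]
            calc _ ≤ ∫⁻ y, ENNReal.ofReal ((φ k).normed volume (y - z)) :=
                  setLIntegral_le_lintegral _ _
              _ = ∫⁻ y, ENNReal.ofReal ((φ k).normed volume y) :=
                  lintegral_sub_right_eq_self
                    (fun y => ENNReal.ofReal ((φ k).normed volume y)) z
              _ = 1 := by
                  rw [← ofReal_integral_eq_lintegral_ofReal (φ k).integrable_normed
                    (Eventually.of_forall fun y => (φ k).nonneg_normed y), (φ k).integral_normed,
                    ENNReal.ofReal_one]
          · rw [indicator_of_notMem hz]
            refine le_of_eq (setLIntegral_eq_zero Metric.isOpen_ball.measurableSet fun y hy => ?_)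
            have hns : y - z ∉ Function.support ((φ k).normed
                (volume : Measure (EuclideanSpace ℝ (Fin n)))) := by
              rw [(φ k).support_normed_eq, hφout, mem_ball_zero_iff, not_lt]
              rw [Metric.mem_ball, not_lt] at hz
              rw [Metric.mem_ball] at hy
              have := dist_triangle z y x
              rw [dist_comm z y, dist_eq_norm y z] at this
              linarith
            simp only [Function.mem_support, not_not] at hns
            simp [hns]
      _ = m (Metric.ball x (r + 1 / ((k : ℝ) + 1))) := by
          rw [lintegral_indicator Metric.isOpen_ball.measurableSet]
          simp

end Mollification

/-! ### Poincaré and isoperimetric inequalities -/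

section Inequalities

variable {n : ℕ}

/-- Fundamental theorem of calculus on the segment from y to y + h. -/
theorem enorm_sub_le_lintegral_fderiv {u : EuclideanSpace ℝ (Fin n) → ℝ} (hu : ContDiff ℝ 1 u)
    (y h : EuclideanSpace ℝ (Fin n)) :
    ‖u (y + h) - u y‖ₑ ≤ ∫⁻ t in Ioc (0 : ℝ) 1, ‖fderiv ℝ u (y + t • h)‖ₑ * ‖h‖ₑ := by
  have hderiv (t : ℝ) : HasDerivAt (fun t : ℝ => u (y + t • h)) (fderiv ℝ u (y + t • h) h) t := by
    have h1 : HasDerivAt (fun t : ℝ => y + t • h) h t := by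
      simpa using ((hasDerivAt_id t).smul_const h).const_add y
    exact ((hu.differentiable one_ne_zero _).hasFDerivAt).comp_hasDerivAt t h1
  have hcont : Continuous fun t : ℝ => fderiv ℝ u (y + t • h) h :=
    ((hu.continuous_fderiv one_ne_zero).comp (by fun_prop)).clm_apply continuous_const
  have h1 := intervalIntegral.integral_eq_sub_of_hasDerivAt (fun t _ => hderiv t)
    (hcont.intervalIntegrable 0 1)
  simp only [one_smul, zero_smul, add_zero] at h1
  rw [← h1, intervalIntegral.integral_of_le zero_le_one]
  refine (enorm_integral_le_lintegral_enorm _).trans (lintegral_mono fun t => ?_)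
  exact ContinuousLinearMap.le_opENorm _ _

/-- The `L¹` Poincaré inequality on balls, in a symmetric form. -/
theorem lintegral_lintegral_enorm_sub_le {u : EuclideanSpace ℝ (Fin n) → ℝ} (hu : ContDiff ℝ 1 u)
    (x : EuclideanSpace ℝ (Fin n)) (r : ℝ) :
    ∫⁻ y in Metric.ball x r, ∫⁻ z in Metric.ball x r, ‖u z - u y‖ₑ ≤
      ENNReal.ofReal (2 * r) * volume (Metric.ball (0 : EuclideanSpace ℝ (Fin n)) (2 * r)) *
        ∫⁻ y in Metric.ball x r, ‖fderiv ℝ u y‖ₑ := by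
  set B := Metric.ball x r
  have hB : MeasurableSet B := Metric.isOpen_ball.measurableSet
  set I := ∫⁻ y in B, ‖fderiv ℝ u y‖ₑ
  have hfd : Continuous fun y => ‖fderiv ℝ u y‖ₑ := (hu.continuous_fderiv one_ne_zero).enorm
  -- After the substitution z = y + h the increment h is fixed. The segment stays in the ball by
  -- convexity, and translation invariance makes each t contribute at most ‖h‖ I; increments of
  -- length 2r or more contribute nothing.
  have hone (h : EuclideanSpace ℝ (Fin n)) :
      ∫⁻ y, B.indicator (fun y => B.indicator (fun z => ‖u z - u y‖ₑ) (y + h)) y ≤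
        (Metric.ball (0 : EuclideanSpace ℝ (Fin n)) (2 * r)).indicator
          (fun _ => ENNReal.ofReal (2 * r) * I) h := by
    by_cases hh : h ∈ Metric.ball (0 : EuclideanSpace ℝ (Fin n)) (2 * r)
    · rw [indicator_of_mem hh]
      calc _ ≤ ∫⁻ y, ∫⁻ t in Ioc (0 : ℝ) 1,
              B.indicator (fun z => ‖fderiv ℝ u z‖ₑ * ‖h‖ₑ) (y + t • h) := by
            refine lintegral_mono fun y => ?_
            by_cases hy : y ∈ B
            · rw [indicator_of_mem hy]
              by_cases hyh : y + h ∈ B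
              · rw [indicator_of_mem hyh]
                refine (enorm_sub_le_lintegral_fderiv hu y h).trans ?_
                refine setLIntegral_mono' measurableSet_Ioc fun t ht => ?_
                rw [indicator_of_mem]
                have hseg := (convex_ball x r).add_smul_sub_mem hy hyh (t := t) ⟨ht.1.le, ht.2⟩
                simpa [B] using hseg
              · rw [indicator_of_notMem hyh]; exact zero_le
            · rw [indicator_of_notMem hy]; exact zero_le
        _ = ∫⁻ t in Ioc (0 : ℝ) 1, (∫⁻ y,
              B.indicator (fun z => ‖fderiv ℝ u z‖ₑ * ‖h‖ₑ) (y + t • h)) := by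
            refine lintegral_lintegral_swap ?_
            refine Measurable.aemeasurable ?_
            refine ((hfd.measurable.mul_const _).indicator hB).comp ?_
            exact (measurable_fst.add (measurable_snd.smul_const h))
        _ = ∫⁻ t in Ioc (0 : ℝ) 1, ‖h‖ₑ * I := by
            refine lintegral_congr fun t => ?_
            rw [lintegral_add_right_eq_self
              (fun y => B.indicator (fun z => ‖fderiv ℝ u z‖ₑ * ‖h‖ₑ) y) (t • h),
              lintegral_indicator hB, lintegral_mul_const _ hfd.measurable, mul_comm]
        _ = ‖h‖ₑ * I := by simp
        _ ≤ ENNReal.ofReal (2 * r) * I := by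
            gcongr
            rw [← ofReal_norm]
            exact ENNReal.ofReal_le_ofReal (mem_ball_zero_iff.1 hh).le
    · rw [indicator_of_notMem hh]
      refine le_of_eq ?_
      rw [← lintegral_zero (μ := (volume : Measure (EuclideanSpace ℝ (Fin n))))]
      refine lintegral_congr fun y => ?_
      by_cases hy : y ∈ B
      · rw [indicator_of_mem hy, indicator_of_notMem]
        intro hyh
        refine hh (mem_ball_zero_iff.2 ?_)
        have h1 := dist_triangle_right (y + h) y x
        rw [Metric.mem_ball] at hyh hy
        rw [dist_eq_norm, add_sub_cancel_left] at h1
        linarith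
      · rw [indicator_of_notMem hy]
  calc ∫⁻ y in B, ∫⁻ z in B, ‖u z - u y‖ₑ
      = ∫⁻ y, B.indicator (fun y => ∫⁻ h, B.indicator (fun z => ‖u z - u y‖ₑ) (y + h)) y := by
        rw [lintegral_indicator hB]
        refine lintegral_congr fun y => ?_
        rw [lintegral_add_left_eq_self (fun z => B.indicator (fun z => ‖u z - u y‖ₑ) z) y,
          lintegral_indicator hB]
    _ = ∫⁻ y, ∫⁻ h, B.indicator (fun y => B.indicator (fun z => ‖u z - u y‖ₑ) (y + h)) y := by
        refine lintegral_congr fun y => ?_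
        by_cases hy : y ∈ B
        · simp only [indicator_of_mem hy]
        · simp only [indicator_of_notMem hy, lintegral_zero]
    _ = ∫⁻ h, ∫⁻ y, B.indicator (fun y => B.indicator (fun z => ‖u z - u y‖ₑ) (y + h)) y := by
        refine lintegral_lintegral_swap (Measurable.aemeasurable ?_)
        have hS : MeasurableSet {p : EuclideanSpace ℝ (Fin n) × EuclideanSpace ℝ (Fin n) |
            p.1 ∈ B ∧ p.1 + p.2 ∈ B} :=
          (measurable_fst hB).inter ((measurable_fst.add measurable_snd) hB)
        have hF : Measurable fun p : EuclideanSpace ℝ (Fin n) × EuclideanSpace ℝ (Fin n) =>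
            ‖u (p.1 + p.2) - u p.1‖ₑ := by
          have := hu.continuous
          exact (show Continuous _ by fun_prop).measurable
        convert hF.indicator hS using 1
        ext ⟨y, h⟩
        simp only [Function.uncurry_apply_pair]
        by_cases hy : y ∈ B <;> by_cases hyh : y + h ∈ B <;> simp [hy, hyh]
    _ ≤ ∫⁻ h, (Metric.ball (0 : EuclideanSpace ℝ (Fin n)) (2 * r)).indicator
          (fun _ => ENNReal.ofReal (2 * r) * I) h := lintegral_mono hone
    _ = _ := by
        rw [lintegral_indicator Metric.isOpen_ball.measurableSet, setLIntegral_const]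
        ring

variable {E : Set (EuclideanSpace ℝ (Fin n))} {m : Measure (EuclideanSpace ℝ (Fin n))}
  {f : EuclideanSpace ℝ (Fin n) → EuclideanSpace ℝ (Fin n)}

/-- Relative isoperimetric inequality in a ball, in product form. -/
theorem IsGaussGreenPair.volume_mul_volume_le (h : IsGaussGreenPair E m f)
    (hE : NullMeasurableSet E) (x : EuclideanSpace ℝ (Fin n)) {r : ℝ} (hr : 0 < r) :
    volume (E ∩ Metric.ball x r) * volume (Metric.ball x r \ E) ≤
      ENNReal.ofReal (2 * r) * volume (Metric.ball (0 : EuclideanSpace ℝ (Fin n)) (2 * r)) *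
        m (Metric.ball x (2 * r)) := by
  obtain ⟨u, hu1, hu2, hu3, hu4⟩ := h.exists_mollification hE
  set B := Metric.ball x r
  have hB : MeasurableSet B := Metric.isOpen_ball.measurableSet
  have hBn : NullMeasurableSet B := hB.nullMeasurableSet
  have hmeas (k : ℕ) (y : EuclideanSpace ℝ (Fin n)) : Measurable fun z => ‖u k z - u k y‖ₑ :=
    ((hu1 k).continuous.sub continuous_const).enorm.measurable
  have hmeas2 (k : ℕ) (A : Set (EuclideanSpace ℝ (Fin n))) :
      Measurable fun y => ∫⁻ z in A, ‖u k z - u k y‖ₑ := by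
    refine Measurable.lintegral_prod_right' (f := fun p : EuclideanSpace ℝ (Fin n) ×
      EuclideanSpace ℝ (Fin n) => ‖u k p.2 - u k p.1‖ₑ) ?_
    have := (hu1 k).continuous
    exact (show Continuous _ by fun_prop).measurable
  calc volume (E ∩ B) * volume (B \ E)
      = ∫⁻ y in E ∩ B, ∫⁻ z in B \ E, 1 := by simp [mul_comm]
    -- For almost every y ∈ E and z ∉ E the difference of the mollified indicators tends to 1 in
    -- absolute value; Fatou's lemma is then applied twice.
    _ = ∫⁻ y in E ∩ B, ∫⁻ z in B \ E, liminf (fun k => ‖u k z - u k y‖ₑ) atTop := by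
        refine lintegral_congr_ae ?_
        filter_upwards [ae_restrict_of_ae hu3, ae_restrict_mem₀ (hE.inter hBn)] with y hy hyE
        refine lintegral_congr_ae ?_
        filter_upwards [ae_restrict_of_ae hu3, ae_restrict_mem₀ (hBn.diff hE)] with z hz hzE
        have h1 : Tendsto (fun k => ‖u k z - u k y‖ₑ) atTop (𝓝 ‖(0 : ℝ) - 1‖ₑ) := by
          rw [indicator_of_mem hyE.1] at hy
          rw [indicator_of_notMem hzE.2] at hz
          exact (hz.sub hy).enorm
        rw [h1.liminf_eq]
        simp
    _ ≤ ∫⁻ y in E ∩ B, liminf (fun k => ∫⁻ z in B \ E, ‖u k z - u k y‖ₑ) atTop :=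
        lintegral_mono fun y => lintegral_liminf_le fun k => hmeas k y
    _ ≤ liminf (fun k => ∫⁻ y in E ∩ B, ∫⁻ z in B \ E, ‖u k z - u k y‖ₑ) atTop :=
        lintegral_liminf_le fun k => hmeas2 k _
    _ ≤ _ := by
        refine liminf_le_of_frequently_le' (Eventually.frequently ?_)
        have he0 : Tendsto (fun k : ℕ => 1 / ((k : ℝ) + 1)) atTop (𝓝 0) :=
          tendsto_one_div_add_atTop_nhds_zero_nat
        filter_upwards [he0.eventually (gt_mem_nhds hr)] with k hk
        calc ∫⁻ y in E ∩ B, ∫⁻ z in B \ E, ‖u k z - u k y‖ₑ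
            ≤ ∫⁻ y in B, ∫⁻ z in B, ‖u k z - u k y‖ₑ := by
              refine (lintegral_mono_set inter_subset_right).trans (lintegral_mono fun y => ?_)
              exact lintegral_mono_set sdiff_subset
          _ ≤ _ := lintegral_lintegral_enorm_sub_le (hu1 k) x r
          _ ≤ _ := by
              gcongr
              -- Mollification enlarges the ball by 1/(k+1) < r, whence the radius 2r.
              refine (hu4 k x r).trans (measure_mono (Metric.ball_subset_ball ?_))
              linarith

/-- Local isoperimetric inequality, with an error term from the cutoff. -/
theorem exists_volume_closedBall_le (hn : 2 ≤ n) :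
    ∃ C : NNReal, 0 < C ∧ ∀ (E : Set (EuclideanSpace ℝ (Fin n)))
      (m : Measure (EuclideanSpace ℝ (Fin n)))
      (f : EuclideanSpace ℝ (Fin n) → EuclideanSpace ℝ (Fin n)),
      IsGaussGreenPair E m f → NullMeasurableSet E →
      ∀ (x : EuclideanSpace ℝ (Fin n)) (ρ r : ℝ), 0 ≤ ρ → ρ < r →
        volume (E ∩ Metric.closedBall x ρ) ^ (n - 1) ≤
          C * (m (Metric.ball x r) + ENNReal.ofReal (4 * transitionBound / (r - ρ)) *
            volume (E ∩ Metric.closedBall x r)) ^ n := by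
  have hn1 : (1 : ℝ) < n := by exact_mod_cast hn
  -- p = n/(n-1) is the Sobolev exponent for p = 1; the result is stated with the powers n - 1 and n
  -- to avoid real exponents.
  set p : ℝ := (n : ℝ).conjExponent with hp
  have hpc : Real.HolderConjugate (Module.finrank ℝ (EuclideanSpace ℝ (Fin n)) : ℝ) p := by
    rw [finrank_euclideanSpace_fin]
    exact Real.HolderConjugate.conjExponent hn1
  have hp0 : 0 < p := hpc.symm.pos
  have hpn : p * ((n - 1 : ℕ) : ℝ) = n := by
    rw [hp, Real.conjExponent, Nat.cast_sub (by omega), Nat.cast_one]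
    have : (n : ℝ) - 1 ≠ 0 := by linarith
    field_simp
  set C₀ : NNReal := lintegralPowLePowLIntegralFDerivConst
    (volume : Measure (EuclideanSpace ℝ (Fin n))) p
  -- The summand 1 only guarantees a positive constant.
  refine ⟨C₀ ^ (n - 1) + 1, by positivity, fun E m f h hE x ρ r hρ hρr => ?_⟩
  -- The Sobolev inequality is applied to a cutoff times the mollified indicators.
  have hmfin := h.finite
  obtain ⟨u, hu1, hu2, hu3, hu4⟩ := h.exists_mollification hE
  -- The cutoff falls from 1 to 0 between ρ and the midpoint t, so its slope is at most 4K/(r - ρ);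
  -- the room between t and r absorbs the mollification radius.
  set t := (ρ + r) / 2 with ht
  have hρt : ρ < t := by rw [ht]; linarith
  have htr : t < r := by rw [ht]; linarith
  set ζ : EuclideanSpace ℝ (Fin n) → ℝ := fun y => 1 - outerCutoff x ρ (t - ρ) y with hζ
  have hζ1 : ContDiff ℝ 1 ζ := contDiff_const.sub contDiff_outerCutoff
  have hζc : HasCompactSupport ζ := hasCompactSupport_one_sub_outerCutoff hρ (sub_pos.2 hρt)
  have hζ01 (y : EuclideanSpace ℝ (Fin n)) : 0 ≤ ζ y ∧ ζ y ≤ 1 := by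
    constructor
    · exact sub_nonneg.2 outerCutoff_le_one
    · exact sub_le_self _ outerCutoff_nonneg
  have hζball {y : EuclideanSpace ℝ (Fin n)} (hy : y ∈ Metric.closedBall x ρ) : ζ y = 1 := by
    simp only [hζ]
    rw [outerCutoff_eq_zero hρ (sub_pos.2 hρt) (by simpa [dist_eq_norm] using hy), sub_zero]
  have hζout {y : EuclideanSpace ℝ (Fin n)} (hy : y ∉ Metric.closedBall x t) : ζ y = 0 := by
    simp only [hζ]
    rw [outerCutoff_eq_one hρ (sub_pos.2 hρt), sub_self]
    have : t < ‖y - x‖ := by simpa [dist_eq_norm] using hy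
    linarith
  set a := 4 * transitionBound / (r - ρ) with ha
  have ha0 : 0 ≤ a := div_nonneg (by linarith [transitionBound_pos]) (by linarith)
  have hζfd (y : EuclideanSpace ℝ (Fin n)) :
      ‖fderiv ℝ ζ y‖ ≤ (Metric.closedBall x t).indicator (fun _ => a) y := by
    have h1 := norm_gradient_outerCutoff_le (x := x) hρ (sub_pos.2 hρt) y
    have h2 : ‖fderiv ℝ ζ y‖ = ‖∇ (outerCutoff x ρ (t - ρ)) y‖ := by
      simp only [gradient, LinearIsometryEquiv.norm_map, hζ]
      rw [fderiv_const_sub, norm_neg]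
    rw [h2]
    refine h1.trans ?_
    have h3 : 2 * transitionBound / (t - ρ) = a := by
      have h4 : t - ρ = (r - ρ) / 2 := by rw [ht]; ring
      have : r - ρ ≠ 0 := by linarith
      rw [ha, h4]
      field_simp
      ring
    rw [h3, add_sub_cancel]
    exact indicator_le_indicator_of_subset sdiff_subset (fun _ => ha0) y
  have hcB : MeasurableSet (Metric.closedBall x t) := Metric.isClosed_closedBall.measurableSet
  set v : ℕ → EuclideanSpace ℝ (Fin n) → ℝ := fun k y => ζ y * u k y with hv
  have hv1 (k : ℕ) : ContDiff ℝ 1 (v k) := hζ1.mul (hu1 k)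
  have hvfd (k : ℕ) (y : EuclideanSpace ℝ (Fin n)) :
      ‖fderiv ℝ (v k) y‖ₑ ≤ (Metric.closedBall x t).indicator
        (fun y => ‖fderiv ℝ (u k) y‖ₑ + ENNReal.ofReal a * ENNReal.ofReal (u k y)) y := by
    have h1 : fderiv ℝ (v k) y = ζ y • fderiv ℝ (u k) y + u k y • fderiv ℝ ζ y :=
      fderiv_fun_mul (hζ1.differentiable one_ne_zero y) ((hu1 k).differentiable one_ne_zero y)
    rw [h1]
    have hz := hζfd y
    by_cases hy : y ∈ Metric.closedBall x t
    · rw [indicator_of_mem hy] at hz ⊢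
      have h2 : ‖ζ y • fderiv ℝ (u k) y + u k y • fderiv ℝ ζ y‖ ≤
          ‖fderiv ℝ (u k) y‖ + a * u k y := by
        refine (norm_add_le _ _).trans ?_
        rw [norm_smul, norm_smul, Real.norm_eq_abs, Real.norm_eq_abs, abs_of_nonneg (hζ01 y).1,
          abs_of_nonneg (hu2 k y).1, mul_comm (u k y)]
        exact add_le_add (mul_le_of_le_one_left (norm_nonneg _) (hζ01 y).2)
          (mul_le_mul_of_nonneg_right hz (hu2 k y).1)
      rw [← ofReal_norm, ← ofReal_norm, ← ENNReal.ofReal_mul ha0,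
        ← ENNReal.ofReal_add (norm_nonneg _) (mul_nonneg ha0 (hu2 k y).1)]
      exact ENNReal.ofReal_le_ofReal h2
    · rw [indicator_of_notMem hy] at hz ⊢
      rw [hζout hy, norm_le_zero_iff.1 hz, zero_smul, smul_zero, add_zero, ← ofReal_norm, norm_zero,
        ENNReal.ofReal_zero]
  set b := m (Metric.ball x r) + ENNReal.ofReal a * volume (E ∩ Metric.closedBall x r) with hb
  have hlimu : Tendsto (fun k => ∫⁻ y in Metric.closedBall x t, ENNReal.ofReal (u k y)) atTop
      (𝓝 (volume (E ∩ Metric.closedBall x t))) := by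
    have h1 : volume (E ∩ Metric.closedBall x t) =
        ∫⁻ y in Metric.closedBall x t, ENNReal.ofReal (E.indicator (fun _ => 1) y) := by
      have : (fun y => ENNReal.ofReal (E.indicator (fun _ => (1 : ℝ)) y)) =
          E.indicator (fun _ => 1) := by
        ext y
        by_cases hy : y ∈ E <;> simp [hy]
      rw [this, lintegral_indicator₀ (hE.mono_ac Measure.restrict_le_self.absolutelyContinuous),
        setLIntegral_const, one_mul, Measure.restrict_apply' hcB]
    rw [h1]
    refine tendsto_lintegral_of_dominated_convergence (fun _ => 1)
      (fun k => (hu1 k).continuous.measurable.ennreal_ofReal)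
      (fun k => Eventually.of_forall fun y => ENNReal.ofReal_le_one.2 (hu2 k y).2) ?_ ?_
    · simpa using measure_closedBall_lt_top.ne
    · filter_upwards [ae_restrict_of_ae hu3] with y hy
      exact (ENNReal.continuous_ofReal.tendsto _).comp hy
  have hlim2 : Tendsto (fun k => m (Metric.ball x r) + ENNReal.ofReal a *
      ∫⁻ y in Metric.closedBall x t, ENNReal.ofReal (u k y)) atTop
      (𝓝 (m (Metric.ball x r) + ENNReal.ofReal a * volume (E ∩ Metric.closedBall x t))) :=
    (ENNReal.Tendsto.const_mul hlimu (Or.inr ENNReal.ofReal_ne_top)).const_add _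
  have hk : ∀ᶠ k : ℕ in atTop, ∫⁻ y, ‖v k y‖ₑ ^ p ≤ C₀ * (m (Metric.ball x r) +
      ENNReal.ofReal a * ∫⁻ y in Metric.closedBall x t, ENNReal.ofReal (u k y)) ^ p := by
    have he0 : Tendsto (fun k : ℕ => 1 / ((k : ℝ) + 1)) atTop (𝓝 0) :=
      tendsto_one_div_add_atTop_nhds_zero_nat
    filter_upwards [he0.eventually (gt_mem_nhds (show 0 < (r - t) / 2 by linarith))] with k hk
    refine (lintegral_pow_le_pow_lintegral_fderiv volume (hv1 k) hζc.mul_right hpc).trans ?_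
    gcongr
    refine (lintegral_mono (hvfd k)).trans ?_
    rw [lintegral_indicator hcB, lintegral_add_left
      ((hu1 k).continuous_fderiv one_ne_zero).enorm.measurable,
      lintegral_const_mul _ (hu1 k).continuous.measurable.ennreal_ofReal]
    gcongr
    calc ∫⁻ y in Metric.closedBall x t, ‖fderiv ℝ (u k) y‖ₑ
        ≤ ∫⁻ y in Metric.ball x ((t + r) / 2), ‖fderiv ℝ (u k) y‖ₑ :=
          lintegral_mono_set (Metric.closedBall_subset_ball (by linarith))
      _ ≤ _ := hu4 k x _
      _ ≤ _ := measure_mono (Metric.ball_subset_ball (by linarith))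
  have hmain : volume (E ∩ Metric.closedBall x ρ) ≤ C₀ * b ^ p := by
    calc volume (E ∩ Metric.closedBall x ρ)
        = ∫⁻ y in E ∩ Metric.closedBall x ρ, 1 := by simp
      _ = ∫⁻ y in E ∩ Metric.closedBall x ρ, liminf (fun k => ‖v k y‖ₑ ^ p) atTop := by
          refine lintegral_congr_ae ?_
          filter_upwards [ae_restrict_of_ae hu3, ae_restrict_mem₀
            (hE.inter Metric.isClosed_closedBall.measurableSet.nullMeasurableSet)] with y hy hyE
          rw [indicator_of_mem hyE.1] at hy
          have h1 : Tendsto (fun k => ‖v k y‖ₑ ^ p) atTop (𝓝 (‖(1 : ℝ)‖ₑ ^ p)) := by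
            refine (ENNReal.continuous_rpow_const.tendsto _).comp ?_
            simp only [hv, hζball hyE.2, one_mul]
            exact hy.enorm
          rw [h1.liminf_eq]
          simp
      _ ≤ ∫⁻ y, liminf (fun k => ‖v k y‖ₑ ^ p) atTop := setLIntegral_le_lintegral _ _
      _ ≤ liminf (fun k => ∫⁻ y, ‖v k y‖ₑ ^ p) atTop :=
          lintegral_liminf_le fun k => ((hv1 k).continuous.enorm.measurable.pow_const p)
      _ ≤ liminf (fun k => C₀ * (m (Metric.ball x r) +
            ENNReal.ofReal a * ∫⁻ y in Metric.closedBall x t, ENNReal.ofReal (u k y)) ^ p) atTop :=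
          liminf_le_liminf hk
      _ = C₀ * (m (Metric.ball x r) + ENNReal.ofReal a * volume (E ∩ Metric.closedBall x t)) ^ p :=
          (ENNReal.Tendsto.const_mul ((ENNReal.continuous_rpow_const.tendsto _).comp hlim2)
            (Or.inr ENNReal.coe_ne_top)).liminf_eq
      _ ≤ C₀ * b ^ p := by
          rw [hb]
          gcongr
  calc volume (E ∩ Metric.closedBall x ρ) ^ (n - 1) ≤ (C₀ * b ^ p) ^ (n - 1) := by gcongr
    _ = C₀ ^ (n - 1) * b ^ n := by
        rw [mul_pow, ← ENNReal.rpow_natCast (b ^ p), ← ENNReal.rpow_mul, hpn, ENNReal.rpow_natCast]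
    _ ≤ _ := by
        gcongr
        push_cast
        exact le_self_add

end Inequalities

/-! ### Density estimates at points of the reduced boundary -/

section ReducedBoundaryDensity

variable {n : ℕ}

/-- The De Giorgi iteration: a superlinear decay estimate forces a small quantity to vanish. -/
theorem eq_zero_of_pow_le_mul_div_pow {N : ℕ} (hN : 1 ≤ N) {V : ℝ → ℝ} (hV : Monotone V)
    (hV0 : ∀ t, 0 ≤ V t) {A R δ : ℝ} (hR : 0 < R) (hA : 0 ≤ A) (hδ0 : 0 < δ)
    (hdecay : ∀ ρ r, R / 2 ≤ ρ → ρ < r → r ≤ R → V ρ ^ N ≤ A * (V r / (r - ρ)) ^ (N + 1))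
    (hδ : A * 4 ^ (N + 1) * δ * 2 ^ ((N + 1) * N) ≤ 1) (hVR : V R ≤ δ * R ^ (N + 1)) :
    V (R / 2) = 0 := by
  -- The ratio is chosen so that (2q)^(N+1) = q^N: geometric decay at rate q exactly compensates the
  -- gaps between radii, which shrink like 2^(-k).
  set q : ℝ := (1 / 2) ^ (N + 1) with hq
  have hq0 : 0 < q := by positivity
  set ρ : ℕ → ℝ := fun k => R / 2 + R / 2 * (1 / 2) ^ k with hρ
  have hρle (k : ℕ) : ρ k ≤ R := by
    have : ((1 : ℝ) / 2) ^ k ≤ 1 := pow_le_one₀ (by norm_num) (by norm_num)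
    simp only [hρ]; nlinarith
  have hρge (k : ℕ) : R / 2 ≤ ρ k := by
    simp only [hρ]
    have : 0 < R / 2 * (1 / 2) ^ k := by positivity
    linarith
  have hρsub (k : ℕ) : ρ k - ρ (k + 1) = R / 4 * (1 / 2) ^ k := by
    simp only [hρ, pow_succ]; ring
  have key (k : ℕ) : V (ρ k) ≤ δ * R ^ (N + 1) * q ^ k := by
    induction k with
    | zero => simpa [hρ] using hVR
    | succ k ih =>
      have hgap : 0 < R / 4 * (1 / 2) ^ k := by positivity
      have h1 := hdecay (ρ (k + 1)) (ρ k) (hρge _) (by linarith [hρsub k]) (hρle k)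
      rw [hρsub] at h1
      have h2 : V (ρ (k + 1)) ^ N ≤ (δ * R ^ (N + 1) * q ^ (k + 1)) ^ N := by
        calc V (ρ (k + 1)) ^ N ≤ A * (V (ρ k) / (R / 4 * (1 / 2) ^ k)) ^ (N + 1) := h1
          _ ≤ A * (δ * R ^ (N + 1) * q ^ k / (R / 4 * (1 / 2) ^ k)) ^ (N + 1) := by
              have := hV0 (ρ k)
              gcongr
          _ = A * 4 ^ (N + 1) * δ * ((δ * R ^ (N + 1)) ^ N * (q ^ k) ^ N) := by
              have e1 : δ * R ^ (N + 1) * q ^ k / (R / 4 * (1 / 2) ^ k) =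
                  4 * δ * R ^ N * (q ^ k * 2 ^ k) := by
                rw [div_pow, one_pow, pow_succ]
                field_simp
              have e2 : (q ^ k * 2 ^ k) ^ (N + 1) = (q ^ k) ^ N := by
                have : q * 2 = (1 / 2) ^ N := by rw [hq, pow_succ]; ring
                rw [← mul_pow, this, hq, ← pow_mul, ← pow_mul, ← pow_mul, ← pow_mul]
                congr 1; ring
              rw [e1, mul_pow, e2]
              ring
          _ ≤ (q ^ N) * ((δ * R ^ (N + 1)) ^ N * (q ^ k) ^ N) := by
              gcongr
              have e3 : q ^ N = 1 / 2 ^ ((N + 1) * N) := by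
                rw [hq, ← pow_mul, div_pow, one_pow]
              rw [e3, le_div_iff₀ (by positivity)]
              exact hδ
          _ = _ := by rw [mul_pow, pow_succ q k, mul_pow]; ring
      exact (pow_le_pow_iff_left₀ (hV0 _) (by positivity) (by omega)).1 h2
  have hq1 : q < 1 := pow_lt_one₀ (by norm_num) (by norm_num) (by omega)
  have hlim : Tendsto (fun k : ℕ => δ * R ^ (N + 1) * q ^ k) atTop (𝓝 0) := by
    simpa using (tendsto_pow_atTop_nhds_zero_of_lt_one hq0.le hq1).const_mul (δ * R ^ (N + 1))
  refine le_antisymm (ge_of_tendsto' hlim fun k => ?_) (hV0 _)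
  exact (hV (hρge k)).trans (key k)

variable {E : Set (EuclideanSpace ℝ (Fin n))} {x : EuclideanSpace ℝ (Fin n)}
  {m : Measure (EuclideanSpace ℝ (Fin n))}
  {f : EuclideanSpace ℝ (Fin n) → EuclideanSpace ℝ (Fin n)}

/-- The flux of `f m` through small balls around `x` controls their mass. -/
def FluxControlsMass (m : Measure (EuclideanSpace ℝ (Fin n)))
    (f : EuclideanSpace ℝ (Fin n) → EuclideanSpace ℝ (Fin n)) (x : EuclideanSpace ℝ (Fin n))
    (R : ℝ) : Prop :=
  ∀ s, 0 < s → s < R → m.real (Metric.closedBall x s) ≤ 2 * ‖∫ y in Metric.closedBall x s, f y ∂m‖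

theorem FluxControlsMass.neg {R : ℝ} (h : FluxControlsMass m f x R) :
    FluxControlsMass m (-f) x R := fun s hs hsR => by
  simpa [integral_neg] using h s hs hsR

/-- Mass is at most twice the flux, and the flux is bounded by V'(s) at a radius s between ρ and r
whose growth rate is at most the average one. -/
theorem IsGaussGreenPair.measureReal_ball_le_growth (h : IsGaussGreenPair E m f) {R : ℝ}
    (hflux : FluxControlsMass m f x R) {ρ r : ℝ} (hρ : 0 ≤ ρ) (hρr : ρ < r) (hr : r ≤ R) :
    m.real (Metric.closedBall x ρ) ≤
      4 * transitionBound * ((ballVolume E x r - ballVolume E x ρ) / (r - ρ)) := by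
  have := h.finite
  obtain ⟨s, hs, d, hd, hdle⟩ := exists_hasDerivAt_le (monotone_ballVolume (E := E) (x := x)) hρr
  have hs0 : 0 < s := hρ.trans_lt hs.1
  calc m.real (Metric.closedBall x ρ) ≤ m.real (Metric.closedBall x s) :=
        measureReal_mono (Metric.closedBall_subset_closedBall hs.1.le)
    _ ≤ 2 * (2 * transitionBound * d) := (hflux s hs0 (hs.2.trans_le hr)).trans
        (mul_le_mul_of_nonneg_left (h.norm_setIntegral_closedBall_le hs0.le hd) zero_le_two)
    _ ≤ 2 * (2 * transitionBound * ((ballVolume E x r - ballVolume E x ρ) / (r - ρ))) := by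
        have := transitionBound_pos
        gcongr
    _ = _ := by ring

/-- The same argument at any differentiability radius in (r, 2r), with V' bounded by the growth rate
of balls. This is the upper density bound for the perimeter. -/
theorem IsGaussGreenPair.measureReal_closedBall_le (h : IsGaussGreenPair E m f) (hn : n ≠ 0)
    {R : ℝ} (hflux : FluxControlsMass m f x R) {r : ℝ} (hr : 0 < r) (hrR : 2 * r ≤ R) :
    m.real (Metric.closedBall x r) ≤
      4 * transitionBound * (n * volume.real (Metric.closedBall (0 : EuclideanSpace ℝ (Fin n)) 1)) *
        2 ^ (n - 1) * r ^ (n - 1) := by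
  have := h.finite
  obtain ⟨s, hs, d, hd, -⟩ := exists_hasDerivAt_le (monotone_ballVolume (E := E) (x := x))
    (show r < 2 * r by linarith)
  have hs0 : 0 < s := hr.trans hs.1
  have hK := transitionBound_pos
  calc m.real (Metric.closedBall x r) ≤ m.real (Metric.closedBall x s) :=
        measureReal_mono (Metric.closedBall_subset_closedBall hs.1.le)
    _ ≤ 2 * (2 * transitionBound * d) := (hflux s hs0 (hs.2.trans_le hrR)).trans
        (mul_le_mul_of_nonneg_left (h.norm_setIntegral_closedBall_le hs0.le hd) zero_le_two)
    _ ≤ 2 * (2 * transitionBound *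
          (n * volume.real (Metric.closedBall (0 : EuclideanSpace ℝ (Fin n)) 1) *
            (2 * r) ^ (n - 1))) := by
        gcongr
        refine (hasDerivAt_ballVolume_le hn hs0 hd).trans ?_
        gcongr
        exact hs.2.le
    _ = _ := by rw [mul_pow]; ring

/-- Lower density bound for the volume, for points with large flux. -/
theorem exists_lt_ballVolume_of_fluxControlsMass (hn : 2 ≤ n) :
    ∃ δ : ℝ, 0 < δ ∧ ∀ (E : Set (EuclideanSpace ℝ (Fin n)))
      (m : Measure (EuclideanSpace ℝ (Fin n)))
      (f : EuclideanSpace ℝ (Fin n) → EuclideanSpace ℝ (Fin n)),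
      IsGaussGreenPair E m f → NullMeasurableSet E →
      ∀ (x : EuclideanSpace ℝ (Fin n)) (R : ℝ), FluxControlsMass m f x R →
        (∀ r, 0 < r → 0 < m (Metric.ball x r)) → ∀ r, 0 < r → r ≤ R →
          δ * r ^ n < ballVolume E x r := by
  obtain ⟨C, hC, hiso⟩ := exists_volume_closedBall_le hn
  have hK := transitionBound_pos
  obtain ⟨N, rfl⟩ : ∃ N, n = N + 1 := ⟨n - 1, by omega⟩
  set A : ℝ := C * (16 * transitionBound) ^ (N + 1) with hA
  have hA0 : 0 < A := by positivity
  -- This value turns the smallness condition of the De Giorgi iteration into an equality.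
  refine ⟨1 / (A * 4 ^ (N + 1) * 2 ^ ((N + 1) * N)), by positivity,
    fun E m f h hE x R hflux hpos r hr hrR => ?_⟩
  have hmfin := h.finite
  by_contra! hcon
  have hzero : ballVolume E x (r / 2) = 0 := by
    refine eq_zero_of_pow_le_mul_div_pow (by omega) monotone_ballVolume ballVolume_nonneg hr hA0.le
      (by positivity) (fun ρ t hρ hρt ht => ?_) ?_ hcon
    · have hρ0 : 0 ≤ ρ := by linarith
      -- Half of the gap is spent on the isoperimetric inequality, half on bounding the mass by
      -- volume growth; both contributions are at most 8K V(t)/(t - ρ).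
      set t' := (ρ + t) / 2 with ht'
      have h1 : ρ < t' := by rw [ht']; linarith
      have h2 : t' < t := by rw [ht']; linarith
      have h3 := hiso E m f h hE x ρ t' hρ0 h1
      have e1 : t' - ρ = (t - ρ) / 2 := by rw [ht']; ring
      have e2 : t - t' = (t - ρ) / 2 := by rw [ht']; ring
      have htρ : 0 < t - ρ := by linarith
      rw [← ofReal_ballVolume, ← ofReal_ballVolume, ← ofReal_measureReal (μ := m),
        ← ENNReal.ofReal_mul (by rw [e1]; positivity), ← ENNReal.ofReal_add measureReal_nonneg
          (mul_nonneg (by rw [e1]; positivity) (ballVolume_nonneg _)),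
        ← ENNReal.ofReal_pow (ballVolume_nonneg _), ← ENNReal.ofReal_pow
          (add_nonneg measureReal_nonneg (mul_nonneg (by rw [e1]; positivity)
            (ballVolume_nonneg _))), ← ENNReal.ofReal_coe_nnreal,
        ← ENNReal.ofReal_mul C.coe_nonneg, ENNReal.ofReal_le_ofReal_iff (mul_nonneg C.coe_nonneg
          (pow_nonneg (add_nonneg measureReal_nonneg (mul_nonneg (by rw [e1]; positivity)
            (ballVolume_nonneg _))) _))] at h3
      refine h3.trans ?_
      have h4 : m.real (Metric.ball x t') ≤ 8 * transitionBound * (ballVolume E x t / (t - ρ)) := by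
        calc m.real (Metric.ball x t') ≤ m.real (Metric.closedBall x t') :=
              measureReal_mono Metric.ball_subset_closedBall
          _ ≤ _ := h.measureReal_ball_le_growth hflux (by linarith) h2 (by linarith)
          _ ≤ 4 * transitionBound * (ballVolume E x t / ((t - ρ) / 2)) := by
              rw [e2]
              gcongr
              linarith [ballVolume_nonneg (E := E) (x := x) t']
          _ = _ := by field_simp; ring
      have h5 : 4 * transitionBound / (t' - ρ) * ballVolume E x t' ≤
          8 * transitionBound * (ballVolume E x t / (t - ρ)) := by
        calc _ ≤ 4 * transitionBound / ((t - ρ) / 2) * ballVolume E x t := by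
              rw [e1]
              gcongr
              exact monotone_ballVolume h2.le
          _ = _ := by field_simp; ring
      calc C * (m.real (Metric.ball x t') +
            4 * transitionBound / (t' - ρ) * ballVolume E x t') ^ (N + 1)
          ≤ C * (16 * transitionBound * (ballVolume E x t / (t - ρ))) ^ (N + 1) := by
            have : 0 ≤ 4 * transitionBound / (t' - ρ) * ballVolume E x t' :=
              mul_nonneg (by rw [e1]; positivity) (ballVolume_nonneg _)
            have : 0 ≤ m.real (Metric.ball x t') := measureReal_nonneg
            gcongr
            linarith
        _ = _ := by rw [hA, mul_pow]; ring
    · refine le_of_eq ?_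
      field_simp
  -- With no volume of E in the ball of radius r/2 there is no growth, hence no mass in the ball of
  -- radius r/4, against positivity.
  have h1 := h.measureReal_ball_le_growth hflux (x := x) (ρ := r / 4) (r := r / 2) (by linarith)
    (by linarith) (by linarith)
  have h2 : ballVolume E x (r / 4) = 0 :=
    le_antisymm (hzero ▸ monotone_ballVolume (by linarith)) (ballVolume_nonneg _)
  rw [hzero, h2, sub_zero, zero_div, mul_zero] at h1
  have h3 : m.real (Metric.closedBall x (r / 4)) = 0 := le_antisymm h1 measureReal_nonneg
  rw [measureReal_eq_zero_iff] at h3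
  exact (hpos (r / 4) (by linarith)).ne' (measure_mono_null Metric.ball_subset_closedBall h3)

theorem ballVolume_compl_closedBall_le {s r : ℝ} (h : s < r) :
    ENNReal.ofReal (ballVolume E x s) ≤ volume (E ∩ Metric.ball x r) ∧
    ENNReal.ofReal (ballVolume Eᶜ x s) ≤ volume (Metric.ball x r \ E) := by
  rw [ofReal_ballVolume, ofReal_ballVolume]
  refine ⟨measure_mono (inter_subset_inter_right _ (Metric.closedBall_subset_ball h)),
    measure_mono fun y hy => ⟨Metric.closedBall_subset_ball h hy.2, hy.1⟩⟩

/-- Two-sided volume density gives a lower bound on the mass of the Gauss–Green measure. -/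
theorem IsGaussGreenPair.le_measureReal_ball (h : IsGaussGreenPair E m f) (hn : 1 ≤ n)
    (hE : NullMeasurableSet E) {δ r : ℝ} (hδ : 0 < δ) (hr : 0 < r)
    (h1 : ENNReal.ofReal (δ * r ^ n) ≤ volume (E ∩ Metric.ball x r))
    (h2 : ENNReal.ofReal (δ * r ^ n) ≤ volume (Metric.ball x r \ E)) :
    ENNReal.ofReal (δ ^ 2 / (2 ^ (n + 1) *
      volume.real (Metric.closedBall (0 : EuclideanSpace ℝ (Fin n)) 1)) * r ^ (n - 1)) ≤
      m (Metric.ball x (2 * r)) := by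
  have := h.finite
  set ω := volume.real (Metric.closedBall (0 : EuclideanSpace ℝ (Fin n)) 1) with hω
  have hω0 : 0 < ω := ENNReal.toReal_pos
    (Metric.measure_closedBall_pos _ _ one_pos).ne' measure_closedBall_lt_top.ne
  have hball : volume (Metric.ball (0 : EuclideanSpace ℝ (Fin n)) (2 * r)) =
      ENNReal.ofReal (ω * (2 * r) ^ n) := by
    rw [Measure.addHaar_ball_of_pos _ _ (by positivity), hω,
      Measure.addHaar_real_closedBall _ _ zero_le_one, ENNReal.ofReal_mul (by positivity), mul_comm]
    simp [ofReal_measureReal measure_ball_lt_top.ne]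
  have h3 := h.volume_mul_volume_le hE x hr
  have h4 : ENNReal.ofReal (δ * r ^ n * (δ * r ^ n)) ≤
      ENNReal.ofReal (2 * r * (ω * (2 * r) ^ n) * m.real (Metric.ball x (2 * r))) := by
    rw [ENNReal.ofReal_mul (p := δ * r ^ n) (by positivity),
      ENNReal.ofReal_mul (p := 2 * r * (ω * (2 * r) ^ n)) (by positivity),
      ENNReal.ofReal_mul (p := 2 * r) (by positivity), ofReal_measureReal, ← hball]
    exact (mul_le_mul' h1 h2).trans h3
  rw [ENNReal.ofReal_le_ofReal_iff (by positivity)] at h4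
  rw [← ofReal_measureReal (μ := m) (s := Metric.ball x (2 * r))]
  refine ENNReal.ofReal_le_ofReal ?_
  obtain ⟨N, rfl⟩ : ∃ N, n = N + 1 := ⟨n - 1, by omega⟩
  rw [add_tsub_cancel_right, div_mul_eq_mul_div, div_le_iff₀ (by positivity)]
  have hpos : 0 < r ^ (N + 2) := by positivity
  refine le_of_mul_le_mul_right ?_ hpos
  calc _ = δ * r ^ (N + 1) * (δ * r ^ (N + 1)) := by ring
    _ ≤ _ := h4
    _ = _ := by rw [mul_pow]; ring

end ReducedBoundaryDensity

/-! ### Comparison of a measure with the Hausdorff measure -/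

section HausdorffComparison

variable {n : ℕ}

/-- A is exhausted by the sets `S k` where the bound holds below the uniform scale 1/(k+1). A
smaller set that meets `S k` lies in a ball about one of its points with radius its diameter, so
each covering of a Hausdorff sum bounds m. -/
theorem measure_le_hausdorffMeasure_of_closedBall_le {X : Type*} [MetricSpace X]
    [MeasurableSpace X] [BorelSpace X] {m : Measure X} {d : ℕ} {C : ℝ} (hC : 0 < C) {A : Set X}
    (h : ∀ x ∈ A, ∃ R > 0, ∀ r, 0 < r → r < R →
      m (Metric.closedBall x r) ≤ ENNReal.ofReal (C * r ^ d)) :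
    m A ≤ ENNReal.ofReal C * μH[d] A := by
  let S : ℕ → Set X := fun k => {x | x ∈ A ∧ ∀ r, 0 < r → r < 1 / ((k : ℝ) + 1) →
    m (Metric.closedBall x r) ≤ ENNReal.ofReal (C * r ^ d)}
  have hS : A = ⋃ k, S k := by
    ext x
    simp only [mem_iUnion]
    refine ⟨fun hx => ?_, fun ⟨k, hk⟩ => hk.1⟩
    obtain ⟨R, hR, hxR⟩ := h x hx
    obtain ⟨k, hk⟩ := exists_nat_one_div_lt hR
    exact ⟨k, hx, fun r hr hrk => hxR r hr (hrk.trans hk)⟩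
  have hmono : Monotone S := fun i j hij x hx =>
    ⟨hx.1, fun r hr hrj => hx.2 r hr (hrj.trans_le (Nat.one_div_le_one_div hij))⟩
  have hC' : ENNReal.ofReal C ≠ 0 := by simpa using hC
  have hk (k : ℕ) : m (S k) ≤ ENNReal.ofReal C * μH[d] A := by
    have hle : (ENNReal.ofReal C)⁻¹ • m.restrict (S k) ≤ μH[d] := by
      refine Measure.le_hausdorffMeasure d _ (ENNReal.ofReal (1 / (2 * ((k : ℝ) + 1))))
        (by simp; positivity) fun s hs => ?_
      set t := closure s with ht
      have hts : Metric.ediam t = Metric.ediam s := Metric.ediam_closure s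
      rw [Measure.smul_apply, smul_eq_mul]
      rw [ENNReal.inv_mul_le_iff hC' ENNReal.ofReal_ne_top]
      calc m.restrict (S k) s ≤ m.restrict (S k) t := measure_mono subset_closure
        _ = m (t ∩ S k) := Measure.restrict_apply isClosed_closure.measurableSet
        _ ≤ ENNReal.ofReal C * Metric.ediam s ^ (d : ℝ) := ?_
      rcases (t ∩ S k).eq_empty_or_nonempty with he | ⟨y, hyt, hyS⟩
      · simp [he]
      have hfin : Metric.ediam t ≠ ∞ := by
        rw [hts]; exact ne_top_of_le_ne_top ENNReal.ofReal_ne_top hs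
      set D := (Metric.ediam t).toReal with hD
      have hD0 : 0 ≤ D := ENNReal.toReal_nonneg
      have hDk : D < 1 / ((k : ℝ) + 1) := by
        have h1 : D ≤ 1 / (2 * ((k : ℝ) + 1)) :=
          ENNReal.toReal_le_of_le_ofReal (by positivity) (hts ▸ hs)
        refine h1.trans_lt (one_div_lt_one_div_of_lt (by positivity) ?_)
        linarith [(by positivity : (0 : ℝ) < (k : ℝ) + 1)]
      have hsub : t ⊆ Metric.closedBall y D := fun z hz => by
        rw [Metric.mem_closedBall, dist_edist, hD]
        exact ENNReal.toReal_mono hfin (Metric.edist_le_ediam_of_mem hz hyt)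
      -- The diameter D may be 0 while the density bound needs a positive radius; hence the limit r
      -- ↓ D.
      have hlim : m (Metric.closedBall y D) ≤ ENNReal.ofReal (C * D ^ d) := by
        have hcont : Tendsto (fun r : ℝ => ENNReal.ofReal (C * r ^ d)) (𝓝[>] D)
            (𝓝 (ENNReal.ofReal (C * D ^ d))) := by
          refine Tendsto.mono_left ?_ nhdsWithin_le_nhds
          exact (show Continuous fun r : ℝ => ENNReal.ofReal (C * r ^ d) from
            ENNReal.continuous_ofReal.comp (by fun_prop)).tendsto D
        refine ge_of_tendsto hcont ?_
        filter_upwards [Ioo_mem_nhdsGT hDk] with r hr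
        exact (measure_mono (Metric.closedBall_subset_closedBall hr.1.le)).trans
          (hyS.2 r (hD0.trans_lt hr.1) hr.2)
      calc m (t ∩ S k) ≤ m (Metric.closedBall y D) := measure_mono (inter_subset_left.trans hsub)
        _ ≤ ENNReal.ofReal (C * D ^ d) := hlim
        _ = ENNReal.ofReal C * Metric.ediam s ^ (d : ℝ) := by
            rw [ENNReal.ofReal_mul hC.le, ENNReal.ofReal_pow hD0, hD, ENNReal.ofReal_toReal hfin,
              hts, ENNReal.rpow_natCast]
    -- `S k` need not be measurable, so the inequality of measures is evaluated on a measurable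
    -- hull.
    have hT := hle (toMeasurable μH[d] (S k))
    rw [measure_toMeasurable, Measure.smul_apply, smul_eq_mul,
      Measure.restrict_apply (measurableSet_toMeasurable _ _),
      inter_eq_right.2 (subset_toMeasurable _ _),
      ENNReal.inv_mul_le_iff hC' ENNReal.ofReal_ne_top] at hT
    exact hT.trans (by gcongr; exact fun x hx => hx.1)
  calc m A = m (⋃ k, S k) := by rw [← hS]
    _ = ⨆ k, m (S k) := hmono.measure_iUnion
    _ ≤ _ := iSup_le hk

/-- Vitali covering: disjoint balls of small radius r inside an open U ⊇ A whose fivefold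
enlargements cover A. Their diameters are at most 10r, which accounts for 10^d, and disjointness
sums their masses to at most m(U); outer regularity lets U shrink to A. -/
theorem hausdorffMeasure_le_of_le_closedBall {m : Measure (EuclideanSpace ℝ (Fin n))}
    [IsFiniteMeasure m] {d : ℕ} {c : ℝ} (hc : 0 < c) {A : Set (EuclideanSpace ℝ (Fin n))}
    (h : ∀ x ∈ A, ∀ ε > 0, ∃ r, 0 < r ∧ r < ε ∧
      ENNReal.ofReal (c * r ^ d) ≤ m (Metric.closedBall x r)) :
    μH[d] A ≤ ENNReal.ofReal (10 ^ d / c) * m A := by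
  have hopen (U : Set (EuclideanSpace ℝ (Fin n))) (hU : IsOpen U) (hAU : A ⊆ U) :
      μH[d] A ≤ ENNReal.ofReal (10 ^ d / c) * m U := by
    let t : ℕ → Set (EuclideanSpace ℝ (Fin n) × ℝ) := fun k =>
      {p | p.1 ∈ A ∧ 0 < p.2 ∧ p.2 < 1 / ((k : ℝ) + 1) ∧ Metric.closedBall p.1 p.2 ⊆ U ∧
        ENNReal.ofReal (c * p.2 ^ d) ≤ m (Metric.closedBall p.1 p.2)}
    have hv (k : ℕ) := Vitali.exists_disjoint_subfamily_covering_enlargement_closedBall (t k)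
      Prod.fst Prod.snd (1 / ((k : ℝ) + 1)) (fun a ha => ha.2.2.1.le) 5 (by norm_num)
    choose u hut hud hucov using hv
    have hcount (k : ℕ) : (u k).Countable :=
      (hud k).countable_of_nonempty_interior fun a ha => by
        rw [interior_closedBall _ (hut k ha).2.1.ne']
        exact Metric.nonempty_ball.2 (hut k ha).2.1
    have : ∀ k, Countable (u k) := fun k => (hcount k).to_subtype
    have hdiam (k : ℕ) (i : u k) :
        Metric.ediam (Metric.closedBall i.1.1 (5 * i.1.2)) ≤ ENNReal.ofReal (10 * i.1.2) := by
      refine Metric.ediam_le_of_forall_dist_le fun y hy z hz => ?_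
      have h1 := dist_triangle_right y z i.1.1
      rw [Metric.mem_closedBall] at hy hz
      linarith
    have hkey := Measure.hausdorffMeasure_le_liminf_tsum (d : ℝ) A (l := atTop)
      (fun k : ℕ => ENNReal.ofReal (10 * (1 / ((k : ℝ) + 1)))) (by
        have h1 := (tendsto_one_div_add_atTop_nhds_zero_nat (𝕜 := ℝ)).const_mul 10
        rw [mul_zero] at h1
        have h2 := (ENNReal.continuous_ofReal.tendsto 0).comp h1
        rw [ENNReal.ofReal_zero] at h2
        exact h2)
      (fun k (i : u k) => Metric.closedBall i.1.1 (5 * i.1.2))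
      (Eventually.of_forall fun k i => (hdiam k i).trans (ENNReal.ofReal_le_ofReal (by
        linarith [(hut k i.2).2.2.1])))
      (Eventually.of_forall fun k x hx => by
        obtain ⟨ε, hε, hεU⟩ := Metric.isOpen_iff.1 hU x (hAU hx)
        obtain ⟨r, hr0, hr, hrm⟩ := h x hx (min ε (1 / ((k : ℝ) + 1))) (lt_min hε (by positivity))
        have hmem : (x, r) ∈ t k := ⟨hx, hr0, hr.trans_le (min_le_right _ _),
          (Metric.closedBall_subset_ball (hr.trans_le (min_le_left _ _))).trans hεU, hrm⟩
        obtain ⟨b, hb, hsub⟩ := hucov k _ hmem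
        exact mem_iUnion.2 ⟨⟨b, hb⟩, hsub (Metric.mem_closedBall_self hr0.le)⟩)
    refine hkey.trans (liminf_le_of_frequently_le' (Frequently.of_forall fun k => ?_))
    calc ∑' i : u k, Metric.ediam (Metric.closedBall i.1.1 (5 * i.1.2)) ^ (d : ℝ)
        ≤ ∑' i : u k, ENNReal.ofReal (10 ^ d / c) * m (Metric.closedBall i.1.1 i.1.2) := by
          refine ENNReal.tsum_le_tsum fun i => ?_
          have hi := hut k i.2
          rw [ENNReal.rpow_natCast]
          calc _ ≤ ENNReal.ofReal (10 * i.1.2) ^ d := by gcongr; exact hdiam k i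
            _ = ENNReal.ofReal (10 ^ d / c) * ENNReal.ofReal (c * i.1.2 ^ d) := by
                rw [← ENNReal.ofReal_pow (by linarith [hi.2.1]),
                  ← ENNReal.ofReal_mul (by positivity)]
                congr 1
                field_simp
                rw [mul_pow]
            _ ≤ _ := by gcongr; exact hi.2.2.2.2
      _ = ENNReal.ofReal (10 ^ d / c) * ∑' i : u k, m (Metric.closedBall i.1.1 i.1.2) :=
          ENNReal.tsum_mul_left
      _ = ENNReal.ofReal (10 ^ d / c) * m (⋃ i : u k, Metric.closedBall i.1.1 i.1.2) := by
          rw [measure_iUnion ((hud k).subtype _ _) fun i => Metric.isClosed_closedBall.measurableSet]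
      _ ≤ _ := by
          gcongr
          exact iUnion_subset fun i => (hut k i.2).2.2.2.1
  have hK : ENNReal.ofReal (10 ^ d / c) ≠ ∞ := ENNReal.ofReal_ne_top
  refine ENNReal.le_of_forall_pos_le_add fun ε hε _ => ?_
  have hK0 : 0 < 10 ^ d / c := by positivity
  obtain ⟨U, hAU, hU, hUm⟩ := A.exists_isOpen_lt_add (measure_ne_top m A)
    (ε := (ε : ℝ≥0∞) / ENNReal.ofReal (10 ^ d / c)) (by
      rw [Ne, ENNReal.div_eq_zero_iff]; simp [hε.ne'])
  refine (hopen U hU hAU).trans ((mul_le_mul_right hUm.le _).trans_eq ?_)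
  rw [mul_add, ENNReal.mul_div_cancel (by simpa using hK0) hK]

end HausdorffComparison

/-! ### The reduced boundary -/

section ReducedBoundary

variable {n : ℕ} {E : Set (EuclideanSpace ℝ (Fin n))} {m : Measure (EuclideanSpace ℝ (Fin n))}
  {f : EuclideanSpace ℝ (Fin n) → EuclideanSpace ℝ (Fin n)} {x : EuclideanSpace ℝ (Fin n)}

/-- Reduced boundaries are defined with open balls, while volume growth and Besicovitch
differentiation use closed ones; this limit and the next pass between the two. -/
theorem tendsto_setIntegral_closedBall_sub {X F : Type*} [PseudoMetricSpace X] [MeasurableSpace X]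
    [BorelSpace X] [NormedAddCommGroup F] [NormedSpace ℝ F] {m : Measure X} {g : X → F}
    (hg : Integrable g m) (x : X) (r : ℝ) :
    Tendsto (fun k : ℕ => ∫ y in Metric.closedBall x (r - 1 / ((k : ℝ) + 1)), g y ∂m) atTop
      (𝓝 (∫ y in Metric.ball x r, g y ∂m)) := by
  have hU : ⋃ k : ℕ, Metric.closedBall x (r - 1 / ((k : ℝ) + 1)) = Metric.ball x r := by
    ext y
    simp only [mem_iUnion, Metric.mem_closedBall, Metric.mem_ball]
    constructor
    · rintro ⟨k, hk⟩
      have : 0 < 1 / ((k : ℝ) + 1) := by positivity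
      linarith
    · intro h
      obtain ⟨k, hk⟩ := exists_nat_one_div_lt (sub_pos.2 h)
      exact ⟨k, by linarith⟩
  rw [← hU]
  refine tendsto_setIntegral_of_monotone
    (fun k => Metric.isClosed_closedBall.measurableSet) (fun i j hij => ?_) hg.integrableOn
  exact Metric.closedBall_subset_closedBall (by linarith [Nat.one_div_le_one_div (α := ℝ) hij])

theorem tendsto_setIntegral_ball_add {X F : Type*} [PseudoMetricSpace X] [MeasurableSpace X]
    [BorelSpace X] [NormedAddCommGroup F] [NormedSpace ℝ F] {m : Measure X} {g : X → F}
    (hg : Integrable g m) (x : X) (r : ℝ) :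
    Tendsto (fun k : ℕ => ∫ y in Metric.ball x (r + 1 / ((k : ℝ) + 1)), g y ∂m) atTop
      (𝓝 (∫ y in Metric.closedBall x r, g y ∂m)) := by
  have hU : ⋂ k : ℕ, Metric.ball x (r + 1 / ((k : ℝ) + 1)) = Metric.closedBall x r := by
    ext y
    simp only [mem_iInter, Metric.mem_closedBall, Metric.mem_ball]
    constructor
    · intro h
      by_contra! hlt
      obtain ⟨k, hk⟩ := exists_nat_one_div_lt (sub_pos.2 hlt)
      linarith [h k]
    · intro h k
      have : 0 < 1 / ((k : ℝ) + 1) := by positivity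
      linarith
  rw [← hU]
  refine tendsto_setIntegral_of_antitone
    (fun k => Metric.isOpen_ball.measurableSet) (fun i j hij => ?_) ⟨0, hg.integrableOn⟩
  exact Metric.ball_subset_ball (by linarith [Nat.one_div_le_one_div (α := ℝ) hij])

theorem tendsto_measureReal_closedBall_sub {X : Type*} [PseudoMetricSpace X] [MeasurableSpace X]
    [BorelSpace X] (m : Measure X) [IsFiniteMeasure m] (x : X) (r : ℝ) :
    Tendsto (fun k : ℕ => m.real (Metric.closedBall x (r - 1 / ((k : ℝ) + 1)))) atTop
      (𝓝 (m.real (Metric.ball x r))) := by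
  simpa using tendsto_setIntegral_closedBall_sub (m := m) (integrable_const (1 : ℝ)) x r

theorem tendsto_measureReal_ball_add {X : Type*} [PseudoMetricSpace X] [MeasurableSpace X]
    [BorelSpace X] (m : Measure X) [IsFiniteMeasure m] (x : X) (r : ℝ) :
    Tendsto (fun k : ℕ => m.real (Metric.ball x (r + 1 / ((k : ℝ) + 1)))) atTop
      (𝓝 (m.real (Metric.closedBall x r))) := by
  simpa using tendsto_setIntegral_ball_add (m := m) (integrable_const (1 : ℝ)) x r

theorem IsGaussGreenPair.gaussGreenMeasure_apply (h : IsGaussGreenPair E m f)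
    {A : Set (EuclideanSpace ℝ (Fin n))} (hA : MeasurableSet A) :
    gaussGreenMeasure E A = ∫ y in A, f y ∂m := by
  rw [h.gaussGreenMeasure_eq, withDensityᵥ_apply h.integrable hA]

/-- The averages of the Gauss–Green measure tend to a unit vector, so their norm eventually exceeds
1/2. -/
theorem IsGaussGreenPair.fluxControlsMass_of_mem_reducedBoundary (h : IsGaussGreenPair E m f)
    (hp : perimeter E = m) (hx : x ∈ reducedBoundary E) :
    ∃ R > 0, FluxControlsMass m f x R ∧ ∀ r, 0 < r → 0 < m (Metric.ball x r) := by
  have := h.finite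
  obtain ⟨ν, hpos, hν, hlim⟩ := hx
  rw [hp] at hpos hlim
  have h1 : ∀ᶠ r in 𝓝[>] (0 : ℝ), 1 / 2 < ‖(m (Metric.ball x r)).toReal⁻¹ •
      gaussGreenMeasure E (Metric.ball x r)‖ :=
    hlim.norm.eventually_const_lt (by rw [hν]; norm_num)
  obtain ⟨R, hR, hR1⟩ := (mem_nhdsGT_iff_exists_Ioo_subset).1 h1
  have hR : 0 < R := hR
  refine ⟨R, hR, fun s hs hsR => ?_, hpos⟩
  have hball (r : ℝ) (hr : 0 < r) (hrR : r < R) :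
      m.real (Metric.ball x r) ≤ 2 * ‖∫ y in Metric.ball x r, f y ∂m‖ := by
    have h2 := hR1 ⟨hr, hrR⟩
    have hm : 0 < m.real (Metric.ball x r) := ENNReal.toReal_pos (hpos r hr).ne' (measure_ne_top _ _)
    rw [mem_ofPred_eq, h.gaussGreenMeasure_apply Metric.isOpen_ball.measurableSet, norm_smul,
      norm_inv, Real.norm_of_nonneg ENNReal.toReal_nonneg, ← measureReal_def, inv_mul_eq_div,
      lt_div_iff₀ hm] at h2
    linarith
  refine le_of_tendsto_of_tendsto (tendsto_measureReal_ball_add m x s)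
    ((tendsto_setIntegral_ball_add h.integrable x s).norm.const_mul 2) ?_
  have h3 : ∀ᶠ k : ℕ in atTop, 1 / ((k : ℝ) + 1) < R - s :=
    (tendsto_one_div_add_atTop_nhds_zero_nat (𝕜 := ℝ)).eventually_lt_const (sub_pos.2 hsR)
  filter_upwards [h3] with k hk
  have : 0 < 1 / ((k : ℝ) + 1) := by positivity
  exact hball _ (by linarith) (by linarith)

/-- Besicovitch differentiation: at almost every point the averages of f over small closed balls
tend to f(x), a unit vector. -/
theorem IsGaussGreenPair.ae_isOuterNormalAt (h : IsGaussGreenPair E m f)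
    (hf1 : ∀ᵐ x ∂m, ‖f x‖ = 1) (hp : perimeter E = m) :
    ∀ᵐ x ∂m, IsOuterNormalAt E x (f x) := by
  have := h.finite
  filter_upwards [hf1, (Besicovitch.vitaliFamily m).ae_tendsto_average h.integrable.locallyIntegrable,
    (Besicovitch.vitaliFamily m).ae_eventually_measure_pos] with x hx1 hx2 hx3
  have hx2 := hx2.comp (Besicovitch.tendsto_filterAt m x)
  have hx3 := (Besicovitch.tendsto_filterAt m x).eventually hx3
  have hpos (r : ℝ) (hr : 0 < r) : 0 < m (Metric.ball x r) := by
    obtain ⟨s, hs, hsr⟩ := (hx3.and (Ioo_mem_nhdsGT hr)).exists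
    exact hs.trans_le (measure_mono (Metric.closedBall_subset_ball hsr.2))
  rw [IsOuterNormalAt, hp]
  refine ⟨hpos, hx1, ?_⟩
  rw [Metric.tendsto_nhdsWithin_nhds]
  intro ε hε
  have h1 := hx2.eventually (Metric.closedBall_mem_nhds (f x) (half_pos hε))
  obtain ⟨R, hR, hR1⟩ := (mem_nhdsGT_iff_exists_Ioo_subset).1 (h1.and hx3)
  refine ⟨R, hR, fun {r} hr hrR => ?_⟩
  have hr : 0 < r := hr
  have hrR : r < R := by rwa [Real.dist_eq, sub_zero, abs_of_pos hr] at hrR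
  -- Multiplied by the mass, the estimate is stable when closed balls increase to an open one.
  have hclosed (s : ℝ) (hs : 0 < s) (hsR : s < R) :
      ‖∫ y in Metric.closedBall x s, f y ∂m - m.real (Metric.closedBall x s) • f x‖ ≤
        ε / 2 * m.real (Metric.closedBall x s) := by
    obtain ⟨h2, h3⟩ := hR1 ⟨hs, hsR⟩
    have hm : 0 < m.real (Metric.closedBall x s) := ENNReal.toReal_pos h3.ne' (measure_ne_top _ _)
    have h2 : ‖⨍ y in Metric.closedBall x s, f y ∂m - f x‖ ≤ ε / 2 := by
      rw [← dist_eq_norm]; exact h2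
    rw [setAverage_eq] at h2
    have h4 : ∫ y in Metric.closedBall x s, f y ∂m - m.real (Metric.closedBall x s) • f x =
        m.real (Metric.closedBall x s) • ((m.real (Metric.closedBall x s))⁻¹ •
          ∫ y in Metric.closedBall x s, f y ∂m - f x) := by
      rw [smul_sub, smul_inv_smul₀ hm.ne']
    rw [h4, norm_smul, Real.norm_of_nonneg hm.le, mul_comm]
    gcongr
  have hopen : ‖∫ y in Metric.ball x r, f y ∂m - m.real (Metric.ball x r) • f x‖ ≤
      ε / 2 * m.real (Metric.ball x r) := by
    have hm := tendsto_measureReal_closedBall_sub m x r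
    refine le_of_tendsto_of_tendsto ((tendsto_setIntegral_closedBall_sub h.integrable x r).sub
      (hm.smul_const (f x))).norm (hm.const_mul _) ?_
    have h3 : ∀ᶠ k : ℕ in atTop, 1 / ((k : ℝ) + 1) < r :=
      (tendsto_one_div_add_atTop_nhds_zero_nat (𝕜 := ℝ)).eventually_lt_const hr
    filter_upwards [h3] with k hk
    have : 0 < 1 / ((k : ℝ) + 1) := by positivity
    exact hclosed _ (by linarith) (by linarith)
  have hm : 0 < m.real (Metric.ball x r) := ENNReal.toReal_pos (hpos r hr).ne' (measure_ne_top _ _)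
  rw [h.gaussGreenMeasure_apply Metric.isOpen_ball.measurableSet, ← measureReal_def, dist_eq_norm]
  have h5 : (m.real (Metric.ball x r))⁻¹ • ∫ y in Metric.ball x r, f y ∂m - f x =
      (m.real (Metric.ball x r))⁻¹ • (∫ y in Metric.ball x r, f y ∂m -
        m.real (Metric.ball x r) • f x) := by
    rw [smul_sub, inv_smul_smul₀ hm.ne']
  rw [h5, norm_smul, norm_inv, Real.norm_of_nonneg hm.le, inv_mul_eq_div, div_lt_iff₀ hm]
  nlinarith

theorem IsGaussGreenPair.measure_compl_reducedBoundary (h : IsGaussGreenPair E m f)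
    (hf1 : ∀ᵐ x ∂m, ‖f x‖ = 1) (hp : perimeter E = m) : m (reducedBoundary E)ᶜ = 0 := by
  have h1 : ∀ᵐ x ∂m, x ∈ reducedBoundary E :=
    (h.ae_isOuterNormalAt hf1 hp).mono fun x hx => ⟨_, hx⟩
  exact h1

theorem isOuterNormalAt_outerNormal (hx : x ∈ reducedBoundary E) :
    IsOuterNormalAt E x (outerNormal E x) := by
  have hx : ∃ ν, IsOuterNormalAt E x ν := hx
  rw [outerNormal, dif_pos hx]
  exact hx.choose_spec

theorem IsOuterNormalAt.outerNormal_eq {ν : EuclideanSpace ℝ (Fin n)}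
    (h : IsOuterNormalAt E x ν) : outerNormal E x = ν :=
  tendsto_nhds_unique (isOuterNormalAt_outerNormal ⟨ν, h⟩).2.2 h.2.2

end ReducedBoundary

/-! ### Perimeter measure against Hausdorff measure on the reduced boundary -/

section ReducedBoundaryHausdorff

variable {n : ℕ} {E : Set (EuclideanSpace ℝ (Fin n))} {m : Measure (EuclideanSpace ℝ (Fin n))}
  {f : EuclideanSpace ℝ (Fin n) → EuclideanSpace ℝ (Fin n)} {x : EuclideanSpace ℝ (Fin n)}

/-- Flux control is invariant under f ↦ -f, so the volume bound holds for E and for its complement;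
the product form of the isoperimetric inequality then bounds the mass below. -/
theorem exists_le_measure_closedBall_of_fluxControlsMass (hn : 2 ≤ n) : ∃ c : ℝ, 0 < c ∧
    ∀ (E : Set (EuclideanSpace ℝ (Fin n))) (m : Measure (EuclideanSpace ℝ (Fin n)))
      (f : EuclideanSpace ℝ (Fin n) → EuclideanSpace ℝ (Fin n)),
      IsGaussGreenPair E m f → NullMeasurableSet E → ∀ x R, FluxControlsMass m f x R →
      (∀ r, 0 < r → 0 < m (Metric.ball x r)) → ∀ r, 0 < r → r ≤ R →
        ENNReal.ofReal (c * r ^ (n - 1)) ≤ m (Metric.closedBall x r) := by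
  obtain ⟨δ, hδ, hvol⟩ := exists_lt_ballVolume_of_fluxControlsMass hn
  have : NeZero n := ⟨by omega⟩
  have hω : 0 < volume.real (Metric.closedBall (0 : EuclideanSpace ℝ (Fin n)) 1) :=
    ENNReal.toReal_pos (Metric.measure_closedBall_pos _ _ one_pos).ne' measure_closedBall_lt_top.ne
  refine ⟨(δ / 2 ^ n) ^ 2 / (2 ^ (n + 1) *
    volume.real (Metric.closedBall (0 : EuclideanSpace ℝ (Fin n)) 1)) / 2 ^ (n - 1), by positivity,
    fun E m f h hE x R hflux hpos r hr hrR => ?_⟩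
  -- One halving passes from closed to open balls; the other pays for the doubled radius in the
  -- isoperimetric inequality.
  have h1 := hvol E m f h hE x R hflux hpos (r / 2 / 2) (by positivity) (by linarith)
  have h2 := hvol Eᶜ m (-f) (h.compl hE) hE.compl x R hflux.neg hpos (r / 2 / 2) (by positivity)
    (by linarith)
  have h3 := ballVolume_compl_closedBall_le (E := E) (x := x) (show r / 2 / 2 < r / 2 by linarith)
  have heq : δ * (r / 2 / 2) ^ n = δ / 2 ^ n * (r / 2) ^ n := by rw [div_pow (r / 2)]; ring
  rw [heq] at h1 h2
  have h4 := h.le_measureReal_ball (by omega) hE (by positivity) (by positivity)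
    ((ENNReal.ofReal_le_ofReal h1.le).trans h3.1) ((ENNReal.ofReal_le_ofReal h2.le).trans h3.2)
  rw [mul_div_cancel₀ r two_ne_zero] at h4
  refine le_trans (le_of_eq ?_) (h4.trans (measure_mono Metric.ball_subset_closedBall))
  congr 1
  rw [div_pow r]
  ring

/-- On the reduced boundary, the perimeter measure and the Hausdorff measure are comparable, with
constants depending on the dimension only. -/
theorem exists_perimeter_comparable_of_subset (hn : 2 ≤ n) : ∃ C : NNReal, 0 < C ∧
    ∀ E : Set (EuclideanSpace ℝ (Fin n)), HasFinitePerimeter E → ∀ A ⊆ reducedBoundary E,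
      perimeter E A ≤ C * μHE[n - 1] A ∧ μHE[n - 1] A ≤ C * perimeter E A := by
  obtain ⟨c, hc, hlow⟩ := exists_le_measure_closedBall_of_fluxControlsMass hn
  have : NeZero n := ⟨by omega⟩
  have hω : 0 < volume.real (Metric.closedBall (0 : EuclideanSpace ℝ (Fin n)) 1) :=
    ENNReal.toReal_pos (Metric.measure_closedBall_pos _ _ one_pos).ne' measure_closedBall_lt_top.ne
  set C₁ : ℝ := 4 * transitionBound *
    (n * volume.real (Metric.closedBall (0 : EuclideanSpace ℝ (Fin n)) 1)) * 2 ^ (n - 1) with hC₁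
  have hC₁0 : 0 < C₁ := by
    have := transitionBound_pos
    have : (0 : ℝ) < n := by exact_mod_cast (by omega : 0 < n)
    positivity
  -- κ is the factor between the Euclidean normalization and the Hausdorff measure defined by
  -- diameters.
  obtain ⟨κ, hκ0, hκ⟩ : ∃ κ : NNReal, 0 < κ ∧
      (μHE[n - 1] : Measure (EuclideanSpace ℝ (Fin n))) = κ • μH[(n - 1 : ℕ)] :=
    ⟨_, pos_iff_ne_zero.2 (Measure.addHaarScalarFactor_volume_hausdorffMeasure_ne_zero (n - 1)),
      Measure.euclideanHausdorffMeasure_def _⟩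
  refine ⟨C₁.toNNReal / κ + κ * (10 ^ (n - 1) / c).toNNReal, by positivity,
    fun E hE A hA => ?_⟩
  obtain ⟨m, f, h, hf1, hp⟩ := exists_isGaussGreenPair hE.2
  have := h.finite
  have hup : m A ≤ ENNReal.ofReal C₁ * μH[(n - 1 : ℕ)] A := by
    refine measure_le_hausdorffMeasure_of_closedBall_le hC₁0 fun x hx => ?_
    obtain ⟨R, hR, hflux, -⟩ := h.fluxControlsMass_of_mem_reducedBoundary hp (hA hx)
    refine ⟨R / 2, half_pos hR, fun r hr hrR => ?_⟩
    rw [← ofReal_measureReal (measure_ne_top _ _)]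
    exact ENNReal.ofReal_le_ofReal (h.measureReal_closedBall_le (by omega) hflux hr (by linarith))
  have hdown : μH[(n - 1 : ℕ)] A ≤ ENNReal.ofReal (10 ^ (n - 1) / c) * m A := by
    refine hausdorffMeasure_le_of_le_closedBall hc fun x hx ε hε => ?_
    obtain ⟨R, hR, hflux, hpos⟩ := h.fluxControlsMass_of_mem_reducedBoundary hp (hA hx)
    have hmin : 0 < min R ε := lt_min hR hε
    exact ⟨min R ε / 2, half_pos hmin, (half_lt_self hmin).trans_le (min_le_right _ _),
      hlow E m f h hE.1 x R hflux hpos _ (half_pos hmin)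
        ((half_le_self hmin.le).trans (min_le_left _ _))⟩
  have hκA : μHE[n - 1] A = κ * μH[(n - 1 : ℕ)] A := by rw [hκ]; rfl
  rw [hp, hκA]
  have hκ1 : (κ : ℝ≥0∞) ≠ 0 := by exact_mod_cast hκ0.ne'
  constructor
  · calc m A ≤ ENNReal.ofReal C₁ * μH[(n - 1 : ℕ)] A := hup
      _ = (ENNReal.ofReal C₁ / κ) * (κ * μH[(n - 1 : ℕ)] A) := by
          rw [← mul_assoc, ENNReal.div_mul_cancel hκ1 ENNReal.coe_ne_top]
      _ ≤ _ := by
          gcongr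
          rw [ENNReal.coe_add, ENNReal.coe_div hκ0.ne']
          exact le_self_add
  · calc κ * μH[(n - 1 : ℕ)] A ≤ κ * (ENNReal.ofReal (10 ^ (n - 1) / c) * m A) := by gcongr
      _ = (κ * ENNReal.ofReal (10 ^ (n - 1) / c)) * m A := by rw [mul_assoc]
      _ ≤ _ := by
          gcongr
          rw [ENNReal.coe_add, ENNReal.coe_mul]
          exact le_add_self

theorem perimeter_compl_reducedBoundary (hE : HasFinitePerimeter E) :
    perimeter E (reducedBoundary E)ᶜ = 0 := by
  obtain ⟨m, f, h, hf1, hp⟩ := exists_isGaussGreenPair hE.2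
  rw [hp]
  exact h.measure_compl_reducedBoundary hf1 hp

/-- A measurable hull of the complement is null for the perimeter; the part of the reduced boundary
inside it is therefore null for the Hausdorff measure, by comparability. -/
theorem nullMeasurableSet_reducedBoundary (hn : 2 ≤ n) (hE : HasFinitePerimeter E) :
    NullMeasurableSet (reducedBoundary E) (μHE[n - 1]) := by
  obtain ⟨C, -, hC⟩ := exists_perimeter_comparable_of_subset hn
  set N := toMeasurable (gaussGreenMeasure E).variation (reducedBoundary E)ᶜ with hN
  have hN0 : (gaussGreenMeasure E).variation N = 0 := by
    rw [hN, measure_toMeasurable]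
    exact perimeter_compl_reducedBoundary hE
  have hsub : Nᶜ ⊆ reducedBoundary E := compl_subset_comm.1 (subset_toMeasurable _ _)
  have hnull : μHE[n - 1] (reducedBoundary E ∩ N) = 0 := by
    have h1 := (hC E hE _ (inter_subset_left : reducedBoundary E ∩ N ⊆ _)).2
    have h2 : perimeter E (reducedBoundary E ∩ N) = 0 := measure_mono_null inter_subset_right hN0
    simpa [h2] using h1
  have heq : reducedBoundary E = Nᶜ ∪ (reducedBoundary E ∩ N) := by
    rw [← inter_eq_right.2 hsub, ← inter_union_distrib_left, compl_union_self, inter_univ]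
  rw [heq]
  exact (measurableSet_toMeasurable _ _).compl.nullMeasurableSet.union
    (NullMeasurableSet.of_null hnull)

/-- The perimeter measure is concentrated on the reduced boundary, so the comparison of subsets
extends to arbitrary sets U. -/
theorem exists_perimeter_comparable (hn : 2 ≤ n) : ∃ C : NNReal, 0 < C ∧
    ∀ E : Set (EuclideanSpace ℝ (Fin n)), HasFinitePerimeter E →
      ∀ U : Set (EuclideanSpace ℝ (Fin n)),
        perimeter E U ≤ C * μHE[n - 1] (reducedBoundary E ∩ U) ∧
          μHE[n - 1] (reducedBoundary E ∩ U) ≤ C * perimeter E U := by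
  obtain ⟨C, hC0, hC⟩ := exists_perimeter_comparable_of_subset hn
  refine ⟨C, hC0, fun E hE U => ?_⟩
  obtain ⟨h1, h2⟩ := hC E hE _ (inter_subset_left : reducedBoundary E ∩ U ⊆ _)
  refine ⟨le_trans ?_ h1, h2.trans (by gcongr; exact measure_mono inter_subset_right)⟩
  have h3 : (gaussGreenMeasure E).variation (reducedBoundary E)ᶜ = 0 :=
    perimeter_compl_reducedBoundary hE
  exact (measure_mono (fun y hy => (em (y ∈ reducedBoundary E)).imp (fun h => ⟨h, hy⟩) id :
    U ⊆ reducedBoundary E ∩ U ∪ (reducedBoundary E)ᶜ)).trans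
    ((measure_union_le _ _).trans_eq (by rw [h3, add_zero]; rfl))

end ReducedBoundaryHausdorff

/-! ### Comparison with the set obtained by removing a ball -/

section Comparison

variable {n : ℕ} {E F : Set (EuclideanSpace ℝ (Fin n))}
  {m m' : Measure (EuclideanSpace ℝ (Fin n))}
  {f f' : EuclideanSpace ℝ (Fin n) → EuclideanSpace ℝ (Fin n)}
  {x ν : EuclideanSpace ℝ (Fin n)} {U : Set (EuclideanSpace ℝ (Fin n))}
  {Φ : EuclideanSpace ℝ (Fin n) → EuclideanSpace ℝ (Fin n) → ℝ} {lam : ℝ}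

/-- Normals are local: only balls contained in U matter in the limit. -/
theorem IsOuterNormalAt.congr_of_eqOn (hν : IsOuterNormalAt E x ν) (h : IsGaussGreenPair E m f)
    (h' : IsGaussGreenPair F m' f') (hU : IsOpen U) (hm : m'.restrict U = m.restrict U)
    (hf : EqOn f' f U) (hx : x ∈ U) : IsOuterNormalAt F x ν := by
  obtain ⟨ε, hε, hεU⟩ := Metric.isOpen_iff.1 hU x hx
  have hsub {r : ℝ} (hr : r ≤ ε) : Metric.ball x r ⊆ U := (Metric.ball_subset_ball hr).trans hεU
  have hmr {r : ℝ} (hr : r ≤ ε) :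
      m'.restrict (Metric.ball x r) = m.restrict (Metric.ball x r) := by
    rw [← inter_eq_left.2 (hsub hr), ← Measure.restrict_restrict Metric.isOpen_ball.measurableSet,
      hm, Measure.restrict_restrict Metric.isOpen_ball.measurableSet]
  have hper {r : ℝ} (hr : r ≤ ε) :
      perimeter F (Metric.ball x r) = perimeter E (Metric.ball x r) := by
    rw [h.perimeter_eq, h'.perimeter_eq, withDensity_apply _ Metric.isOpen_ball.measurableSet,
      withDensity_apply _ Metric.isOpen_ball.measurableSet, hmr hr]
    exact setLIntegral_congr_fun Metric.isOpen_ball.measurableSet fun y hy => by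
      simp only [hf (hsub hr hy)]
  have hgg {r : ℝ} (hr : r ≤ ε) :
      gaussGreenMeasure F (Metric.ball x r) = gaussGreenMeasure E (Metric.ball x r) := by
    rw [h.gaussGreenMeasure_apply Metric.isOpen_ball.measurableSet,
      h'.gaussGreenMeasure_apply Metric.isOpen_ball.measurableSet, hmr hr]
    exact setIntegral_congr_fun Metric.isOpen_ball.measurableSet fun y hy => hf (hsub hr hy)
  refine ⟨fun r hr => ?_, hν.2.1, hν.2.2.congr' ?_⟩
  · have h1 : 0 < perimeter F (Metric.ball x (min r ε)) := by
      rw [hper (min_le_right _ _)]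
      exact hν.1 _ (lt_min hr hε)
    exact h1.trans_le (measure_mono (Metric.ball_subset_ball (min_le_left _ _)))
  · filter_upwards [Ioo_mem_nhdsGT hε] with r hr
    rw [hper hr.2.le, hgg hr.2.le]

theorem IsGaussGreenPair.isOuterNormalAt_eq_of_eqOn (h : IsGaussGreenPair E m f)
    (h' : IsGaussGreenPair F m' f') (hU : IsOpen U) (hm : m'.restrict U = m.restrict U)
    (hf : EqOn f' f U) (hx : x ∈ U) : IsOuterNormalAt F x = IsOuterNormalAt E x :=
  funext fun _ => propext ⟨fun hν => hν.congr_of_eqOn h' h hU hm.symm hf.symm hx,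
    fun hν => hν.congr_of_eqOn h h' hU hm hf hx⟩

theorem outerNormal_congr {y : EuclideanSpace ℝ (Fin n)}
    (h : IsOuterNormalAt F x = IsOuterNormalAt E y) : outerNormal F x = outerNormal E y := by
  by_cases hx : y ∈ reducedBoundary E
  · refine IsOuterNormalAt.outerNormal_eq ?_
    rw [h]
    exact isOuterNormalAt_outerNormal hx
  · have hx : ¬∃ ν, IsOuterNormalAt E y ν := hx
    rw [outerNormal, outerNormal, dif_neg hx, dif_neg (by rwa [h])]

/-- The part of the anisotropic perimeter in a set `A`. -/
noncomputable def anisotropicPerimeterIn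
    (Φ : EuclideanSpace ℝ (Fin n) → EuclideanSpace ℝ (Fin n) → ℝ)
    (E A : Set (EuclideanSpace ℝ (Fin n))) : ℝ≥0∞ :=
  ∫⁻ x in A, ENNReal.ofReal (Φ x (outerNormal E x)) ∂(μHE[n - 1].restrict (reducedBoundary E))

theorem anisotropicPerimeterIn_add_compl
    (Φ : EuclideanSpace ℝ (Fin n) → EuclideanSpace ℝ (Fin n) → ℝ)
    (E : Set (EuclideanSpace ℝ (Fin n))) {A : Set (EuclideanSpace ℝ (Fin n))}
    (hA : MeasurableSet A) :
    anisotropicPerimeterIn Φ E A + anisotropicPerimeterIn Φ E Aᶜ = anisotropicPerimeter Φ E :=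
  lintegral_add_compl _ hA

theorem anisotropicPerimeterIn_congr {A : Set (EuclideanSpace ℝ (Fin n))} (hA : MeasurableSet A)
    (h : ∀ x ∈ A, IsOuterNormalAt F x = IsOuterNormalAt E x) :
    anisotropicPerimeterIn Φ F A = anisotropicPerimeterIn Φ E A := by
  have hRB : A ∩ reducedBoundary F = A ∩ reducedBoundary E := by
    ext x
    simp only [mem_inter_iff, reducedBoundary, mem_ofPred_eq]
    exact and_congr_right fun hx => by rw [h x hx]
  rw [anisotropicPerimeterIn, anisotropicPerimeterIn, Measure.restrict_restrict hA, hRB,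
    ← Measure.restrict_restrict hA]
  exact setLIntegral_congr_fun hA fun x hx => by simp only [outerNormal_congr (h x hx)]

/-- The normal is a unit vector only on the reduced boundary and takes the default value 0
elsewhere; null measurability makes the pointwise bounds on Φ hold almost everywhere for the
restricted measure. -/
theorem le_anisotropicPerimeterIn (hn : 2 ≤ n) (hE : HasFinitePerimeter E)
    (hΦ : ∀ x ν, ‖ν‖ = 1 → 1 / lam ≤ Φ x ν ∧ Φ x ν ≤ lam)
    {A : Set (EuclideanSpace ℝ (Fin n))} (hA : MeasurableSet A) :
    ENNReal.ofReal (1 / lam) * μHE[n - 1] (reducedBoundary E ∩ A) ≤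
      anisotropicPerimeterIn Φ E A := by
  calc ENNReal.ofReal (1 / lam) * μHE[n - 1] (reducedBoundary E ∩ A)
      = ∫⁻ _ in A, ENNReal.ofReal (1 / lam) ∂(μHE[n - 1].restrict (reducedBoundary E)) := by
        rw [setLIntegral_const, Measure.restrict_apply hA, inter_comm]
    _ ≤ _ := by
        refine lintegral_mono_ae (ae_restrict_of_ae ?_)
        filter_upwards [ae_restrict_mem₀ (nullMeasurableSet_reducedBoundary hn hE)] with x hx
        exact ENNReal.ofReal_le_ofReal (hΦ x _ (isOuterNormalAt_outerNormal hx).2.1).1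

theorem anisotropicPerimeterIn_le (hn : 2 ≤ n) (hE : HasFinitePerimeter E)
    (hΦ : ∀ x ν, ‖ν‖ = 1 → 1 / lam ≤ Φ x ν ∧ Φ x ν ≤ lam)
    {A : Set (EuclideanSpace ℝ (Fin n))} (hA : MeasurableSet A) :
    anisotropicPerimeterIn Φ E A ≤
      ENNReal.ofReal lam * μHE[n - 1] (reducedBoundary E ∩ A) := by
  calc _ ≤ ∫⁻ _ in A, ENNReal.ofReal lam ∂(μHE[n - 1].restrict (reducedBoundary E)) := by
        refine lintegral_mono_ae (ae_restrict_of_ae ?_)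
        filter_upwards [ae_restrict_mem₀ (nullMeasurableSet_reducedBoundary hn hE)] with x hx
        exact ENNReal.ofReal_le_ofReal (hΦ x _ (isOuterNormalAt_outerNormal hx).2.1).2
    _ = _ := by rw [setLIntegral_const, Measure.restrict_apply hA, inter_comm]

theorem perimeter_ne_top (hE : HasFinitePerimeter E) (A : Set (EuclideanSpace ℝ (Fin n))) :
    perimeter E A ≠ ∞ := by
  have := (gaussGreenMeasure_spec hE.2).1
  exact measure_ne_top _ _

/-- Almost minimality, tested with the removal of a ball. -/
theorem exists_perimeter_closedBall_le (hn : 2 ≤ n) (hlam : 1 ≤ lam) : ∃ C : ℝ, 0 < C ∧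
    ∀ Φ : EuclideanSpace ℝ (Fin n) → EuclideanSpace ℝ (Fin n) → ℝ,
      (∀ x ν, ‖ν‖ = 1 → 1 / lam ≤ Φ x ν ∧ Φ x ν ≤ lam) →
      ∀ Lam r₀ : ℝ, 0 ≤ Lam → ∀ E, IsAlmostMinimizer Φ Lam r₀ E →
      ∀ x s r d, 0 < s → s < r → r ≤ r₀ → HasDerivAt (ballVolume E x) d s →
        perimeter E (Metric.closedBall x s) ≤ ENNReal.ofReal (C * (d + Lam * r ^ (n - 1))) := by
  obtain ⟨C, hC0, hC⟩ := exists_perimeter_comparable hn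
  have hK := transitionBound_pos
  have hlam0 : 0 < lam := by linarith
  refine ⟨C * lam * (lam * C * (2 * transitionBound) + 1), by positivity,
    fun Φ hΦ Lam r₀ hLam E hmin x s r d hs hsr hr hd => ?_⟩
  have hE := hmin.1
  have hd0 : 0 ≤ d := hd.nonneg_of_monotone monotone_ballVolume
  obtain ⟨m, f, h, hf1, hp⟩ := exists_isGaussGreenPair hE.2
  obtain ⟨m', f', h', hm, hf, hm'⟩ := h.sdiff_closedBall hs hd
  set B := Metric.closedBall x s with hB
  have hBm : MeasurableSet B := Metric.isClosed_closedBall.measurableSet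
  set F := E \ B with hF
  have hFfin : HasFinitePerimeter F :=
    ⟨hE.1.diff hBm.nullMeasurableSet, _, h'.isGaussGreenMeasure⟩
  have hsymm : symmDiff E F ⊆ Metric.ball x r := by
    intro y hy
    refine Metric.closedBall_subset_ball hsr ?_
    rcases hy with ⟨h1, h2⟩ | ⟨h1, h2⟩
    · by_contra h3
      exact h2 ⟨h1, h3⟩
    · exact absurd h1.1 h2
  have hle := hmin.2 x r (hs.trans hsr) hr F hFfin hsymm
  have hcompl : anisotropicPerimeterIn Φ F Bᶜ = anisotropicPerimeterIn Φ E Bᶜ :=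
    anisotropicPerimeterIn_congr hBm.compl fun y hy =>
      h.isOuterNormalAt_eq_of_eqOn h' Metric.isClosed_closedBall.isOpen_compl hm hf hy
  have hfin : anisotropicPerimeterIn Φ E Bᶜ ≠ ∞ := by
    refine ne_top_of_le_ne_top ?_ ((anisotropicPerimeterIn_le hn hE hΦ hBm.compl).trans
      (mul_le_mul_right (hC E hE Bᶜ).2 _))
    exact ENNReal.mul_ne_top ENNReal.ofReal_ne_top
      (ENNReal.mul_ne_top ENNReal.coe_ne_top (perimeter_ne_top hE _))
  -- The energies of E and of E \ B outside the ball are equal and finite, so they cancel, leaving a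
  -- comparison inside the closed ball.
  rw [← anisotropicPerimeterIn_add_compl Φ E hBm, ← anisotropicPerimeterIn_add_compl Φ F hBm,
    hcompl, add_right_comm, ENNReal.add_le_add_iff_right hfin] at hle
  have hFper : perimeter F B ≤ ENNReal.ofReal (2 * transitionBound * d) := by
    refine le_trans ?_ hm'
    rw [h'.perimeter_eq, withDensity_apply _ hBm]
    calc ∫⁻ y in B, ‖f' y‖ₑ ∂m' ≤ ∫⁻ _ in B, 1 ∂m' := by
          refine lintegral_mono fun y => ?_
          rw [← ofReal_norm, ← ENNReal.ofReal_one]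
          exact ENNReal.ofReal_le_ofReal (h'.norm_le y)
      _ = m' B := by simp
  have hCr : (C : ℝ≥0∞) = ENNReal.ofReal C := by simp
  have hlow : perimeter E B ≤ ENNReal.ofReal (C * lam) * anisotropicPerimeterIn Φ E B := by
    calc perimeter E B ≤ C * μHE[n - 1] (reducedBoundary E ∩ B) := (hC E hE B).1
      _ = ENNReal.ofReal (C * lam) *
          (ENNReal.ofReal (1 / lam) * μHE[n - 1] (reducedBoundary E ∩ B)) := by
          rw [← mul_assoc, ← ENNReal.ofReal_mul (by positivity), hCr]
          congr 2
          field_simp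
      _ ≤ _ := by gcongr; exact le_anisotropicPerimeterIn hn hE hΦ hBm
  have hup : anisotropicPerimeterIn Φ F B ≤
      ENNReal.ofReal (lam * C * (2 * transitionBound * d)) := by
    calc _ ≤ ENNReal.ofReal lam * (C * ENNReal.ofReal (2 * transitionBound * d)) := by
          refine (anisotropicPerimeterIn_le hn hFfin hΦ hBm).trans ?_
          gcongr
          exact (hC F hFfin B).2.trans (by gcongr)
      _ = _ := by
          rw [hCr, ← ENNReal.ofReal_mul (by positivity), ← ENNReal.ofReal_mul (by positivity)]
          congr 1
          ring
  have hr0 : 0 < r := hs.trans hsr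
  calc perimeter E B ≤ ENNReal.ofReal (C * lam) * anisotropicPerimeterIn Φ E B := hlow
    _ ≤ ENNReal.ofReal (C * lam) * (ENNReal.ofReal (lam * C * (2 * transitionBound * d)) +
          ENNReal.ofReal (Lam * r ^ (n - 1))) := by
        gcongr
        exact hle.trans (by gcongr)
    _ = ENNReal.ofReal (C * lam * (lam * C * (2 * transitionBound * d) + Lam * r ^ (n - 1))) := by
        rw [← ENNReal.ofReal_add (by positivity) (by positivity),
          ← ENNReal.ofReal_mul (by positivity)]
    _ ≤ _ := by
        refine ENNReal.ofReal_le_ofReal ?_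
        rw [mul_assoc (C * lam)]
        refine mul_le_mul_of_nonneg_left ?_ (by positivity)
        have h1 : 0 ≤ lam * C * (2 * transitionBound) * (Lam * r ^ (n - 1)) := by positivity
        nlinarith

end Comparison

/-! ### Density estimates for almost minimizers -/

section AlmostMinimizerDensity

variable {n : ℕ} {lam : ℝ}

theorem measureReal_closedBall_eq (x : EuclideanSpace ℝ (Fin n)) {r : ℝ}
    (hr : 0 ≤ r) : volume.real (Metric.closedBall x r) =
      r ^ n * volume.real (Metric.closedBall (0 : EuclideanSpace ℝ (Fin n)) 1) := by
  rw [measureReal_def, Measure.addHaar_closedBall' _ _ hr, ENNReal.toReal_mul,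
    ENNReal.toReal_ofReal (by positivity), finrank_euclideanSpace_fin, measureReal_def]

/-- If an almost minimizer has small density in a ball, it has small density in the concentric
ball of one fourth of the radius. -/
theorem exists_ballVolume_decay (hn : 2 ≤ n) (hlam : 1 ≤ lam) : ∃ δ₀ : ℝ, 0 < δ₀ ∧
    ∀ δ : ℝ, 0 < δ → δ ≤ δ₀ →
    ∀ Φ : EuclideanSpace ℝ (Fin n) → EuclideanSpace ℝ (Fin n) → ℝ,
      (∀ x ν, ‖ν‖ = 1 → 1 / lam ≤ Φ x ν ∧ Φ x ν ≤ lam) →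
      ∀ Lam r₀ : ℝ, 0 ≤ Lam → Lam ≤ δ → ∀ E, IsAlmostMinimizer Φ Lam r₀ E →
      ∀ x r, 0 < r → r ≤ r₀ → ballVolume E x r ≤ δ * r ^ n →
        ballVolume E x (r / 4) ≤ δ * (r / 4) ^ n := by
  obtain ⟨C, hC0, hC⟩ := exists_perimeter_closedBall_le hn hlam
  obtain ⟨D, hD0, hD⟩ := exists_volume_closedBall_le hn
  have hK := transitionBound_pos
  obtain ⟨k, rfl⟩ : ∃ k, n = k + 1 := ⟨n - 1, by omega⟩
  simp only [add_tsub_cancel_right] at hC hD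
  -- M is the constant in V(r/4)^(n-1) ≤ δ M (δ (r/4)^n)^(n-1). The surplus factor δ comes from the
  -- exponent n in the isoperimetric inequality, and δ M ≤ 1 closes the step.
  set M : ℝ := D * (3 * C + 16 * transitionBound) ^ (k + 1) * 4 ^ ((k + 1) * k) with hM
  have hM0 : 0 < M := by positivity
  refine ⟨1 / M, by positivity, fun δ hδ hδM Φ hΦ Lam r₀ hLam hLamδ E hmin x r hr hr0 hV => ?_⟩
  rw [le_div_iff₀ hM0] at hδM
  obtain ⟨s, ⟨hs1, hs2⟩, d, hd, hdle⟩ := exists_hasDerivAt_le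
    (monotone_ballVolume (E := E) (x := x)) (half_lt_self hr)
  have hd' : d ≤ 2 * δ * r ^ k := by
    refine hdle.trans ?_
    rw [div_le_iff₀ (by linarith)]
    have h1 : (2 * δ * r ^ k) * (r - r / 2) = δ * r ^ (k + 1) := by ring
    rw [h1]
    linarith [ballVolume_nonneg (E := E) (x := x) (r / 2)]
  obtain ⟨m, f, h, hf1, hp⟩ := exists_isGaussGreenPair hmin.1.2
  have hper := hC Φ hΦ Lam r₀ hLam E hmin x s r d (by linarith) hs2 hr0 hd
  have hper : m (Metric.ball x (r / 2)) ≤ ENNReal.ofReal (3 * C * δ * r ^ k) := by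
    rw [hp] at hper
    refine (measure_mono ((Metric.ball_subset_ball hs1.le).trans
      Metric.ball_subset_closedBall)).trans (hper.trans (ENNReal.ofReal_le_ofReal ?_))
    have h1 : d + Lam * r ^ k ≤ 3 * δ * r ^ k := by
      have : Lam * r ^ k ≤ δ * r ^ k := by gcongr
      linarith
    calc C * (d + Lam * r ^ k) ≤ C * (3 * δ * r ^ k) := by gcongr
      _ = _ := by ring
  have hvol := hD E m f h hmin.1.1 x (r / 4) (r / 2) (by positivity) (by linarith)
  have hV2 : ENNReal.ofReal (4 * transitionBound / (r / 2 - r / 4)) *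
      volume (E ∩ Metric.closedBall x (r / 2)) ≤
        ENNReal.ofReal (16 * transitionBound * δ * r ^ k) := by
    rw [← ofReal_ballVolume, ← ENNReal.ofReal_mul (div_nonneg (by positivity) (by linarith))]
    refine ENNReal.ofReal_le_ofReal ?_
    have h1 : ballVolume E x (r / 2) ≤ δ * r ^ (k + 1) :=
      (monotone_ballVolume (by linarith)).trans hV
    have h2 : 4 * transitionBound / (r / 2 - r / 4) = 16 * transitionBound / r := by
      have : r / 2 - r / 4 = r / 4 := by ring
      rw [this]; field_simp; norm_num
    rw [h2]
    calc _ ≤ 16 * transitionBound / r * (δ * r ^ (k + 1)) := by gcongr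
      _ = _ := by rw [pow_succ]; field_simp
  have hkey : ballVolume E x (r / 4) ^ k ≤ (δ * (r / 4) ^ (k + 1)) ^ k := by
    have h1 : ENNReal.ofReal (ballVolume E x (r / 4) ^ k) ≤
        ENNReal.ofReal (D * ((3 * C + 16 * transitionBound) * δ * r ^ k) ^ (k + 1)) := by
      rw [ENNReal.ofReal_pow (ballVolume_nonneg _), ofReal_ballVolume]
      refine hvol.trans ?_
      rw [ENNReal.ofReal_mul (by positivity), ENNReal.ofReal_pow (by positivity),
        ENNReal.ofReal_coe_nnreal]
      gcongr
      refine (add_le_add hper hV2).trans_eq ?_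
      rw [← ENNReal.ofReal_add (by positivity) (by positivity)]
      congr 1
      ring
    have h2 := (ENNReal.ofReal_le_ofReal_iff (by positivity)).1 h1
    refine h2.trans ?_
    have h3 : D * ((3 * C + 16 * transitionBound) * δ * r ^ k) ^ (k + 1) =
        (δ * M) * (δ * (r / 4) ^ (k + 1)) ^ k := by
      have h4 : ((r / 4) ^ (k + 1)) ^ k * 4 ^ ((k + 1) * k) = (r ^ k) ^ (k + 1) := by
        rw [← pow_mul, ← mul_pow, div_mul_cancel₀ _ (by norm_num), ← pow_mul, mul_comm]
      rw [mul_pow, mul_pow, ← h4, hM, mul_pow δ, pow_succ δ]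
      ring
    rw [h3]
    exact mul_le_of_le_one_left (by positivity) hδM
  exact le_of_pow_le_pow_left₀ (by omega) (by positivity) hkey

/-- Small density would propagate to all scales r/(2·4^k) about every point of the half ball, which
the Lebesgue density theorem allows only if E is null there. -/
theorem exists_lt_ballVolume_of_isAlmostMinimizer (hn : 2 ≤ n) (hlam : 1 ≤ lam) :
    ∃ δ : ℝ, 0 < δ ∧
    ∀ Φ : EuclideanSpace ℝ (Fin n) → EuclideanSpace ℝ (Fin n) → ℝ,
      (∀ x ν, ‖ν‖ = 1 → 1 / lam ≤ Φ x ν ∧ Φ x ν ≤ lam) →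
      ∀ Lam r₀ : ℝ, 0 ≤ Lam → Lam ≤ δ → ∀ E, IsAlmostMinimizer Φ Lam r₀ E →
      ∀ x, (∀ ρ : ℝ, 0 < ρ → 0 < volume (E ∩ Metric.ball x ρ)) → ∀ r, 0 < r → r ≤ r₀ →
        δ * (r / 2) ^ n < ballVolume E x r := by
  obtain ⟨δ₀, hδ₀, hdecay⟩ := exists_ballVolume_decay hn hlam
  have : NeZero n := ⟨by omega⟩
  set ω := volume.real (Metric.closedBall (0 : EuclideanSpace ℝ (Fin n)) 1) with hωdef
  have hω : 0 < ω :=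
    ENNReal.toReal_pos (Metric.measure_closedBall_pos _ _ one_pos).ne' measure_closedBall_lt_top.ne
  -- δ ≤ ω/2 keeps the density quotients at most 1/2, away from 1.
  set δ := min δ₀ (ω / 2) with hδdef
  have hδ : 0 < δ := lt_min hδ₀ (by positivity)
  refine ⟨δ, hδ, fun Φ hΦ Lam r₀ hLam hLamδ E hmin x hx r hr hr0 => ?_⟩
  by_contra! hV
  -- The bound with (r/2)^n is inherited by the balls of radius r/2 about points y of the half ball,
  -- since these lie in the ball of radius r about x.
  have hsmall (y : EuclideanSpace ℝ (Fin n)) (hy : y ∈ Metric.ball x (r / 2)) (k : ℕ) :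
      ballVolume E y (r / 2 / 4 ^ k) ≤ δ * (r / 2 / 4 ^ k) ^ n := by
    induction k with
    | zero =>
      rw [pow_zero, div_one]
      refine le_trans (measureReal_mono (inter_subset_inter_right _ ?_)
        (volume_inter_closedBall_ne_top _)) hV
      exact Metric.closedBall_subset_closedBall' (by linarith [Metric.mem_ball.1 hy])
    | succ k ih =>
      have h4 : (1 : ℝ) ≤ 4 ^ k := one_le_pow₀ (by norm_num)
      have h5 : r / 2 / 4 ^ k ≤ r₀ := (div_le_self (by positivity) h4).trans (by linarith)
      have := hdecay δ hδ (min_le_left _ _) Φ hΦ Lam r₀ hLam hLamδ E hmin y _ (by positivity) h5 ih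
      rwa [pow_succ, ← div_div]
  have hscale : Tendsto (fun k : ℕ => r / 2 / 4 ^ k) atTop (𝓝[>] 0) := by
    refine tendsto_nhdsWithin_iff.2 ⟨?_, Eventually.of_forall fun k => ?_⟩
    · have := (tendsto_pow_atTop_nhds_zero_of_lt_one (r := (1 / 4 : ℝ)) (by norm_num)
        (by norm_num)).const_mul (r / 2)
      simpa [div_eq_mul_inv] using this
    · exact mem_Ioi.2 (by positivity)
  have hnull : volume (Metric.ball x (r / 2) ∩ E) = 0 := by
    have hd := Besicovitch.ae_tendsto_measure_inter_div volume E
    rw [← Measure.restrict_apply Metric.isOpen_ball.measurableSet]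
    rw [ae_iff] at hd
    refine measure_mono_null (fun y hy => ?_) hd
    rw [mem_ofPred_eq]
    intro hlim
    have hlim := hlim.comp hscale
    have hle (k : ℕ) : volume (E ∩ Metric.closedBall y (r / 2 / 4 ^ k)) /
        volume (Metric.closedBall y (r / 2 / 4 ^ k)) ≤ ENNReal.ofReal (1 / 2) := by
      have h0 : 0 < r / 2 / 4 ^ k := by positivity
      rw [← ofReal_ballVolume, ← ofReal_measureReal (measure_closedBall_lt_top.ne),
        measureReal_closedBall_eq _ h0.le, ← ENNReal.ofReal_div_of_pos (by positivity)]
      refine ENNReal.ofReal_le_ofReal ?_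
      rw [div_le_iff₀ (by positivity)]
      refine (hsmall y hy k).trans ?_
      calc δ * (r / 2 / 4 ^ k) ^ n ≤ ω / 2 * (r / 2 / 4 ^ k) ^ n := by
            gcongr; exact min_le_right _ _
        _ = _ := by ring
    have h1 : (1 : ℝ≥0∞) ≤ ENNReal.ofReal (1 / 2) :=
      le_of_tendsto hlim (Eventually.of_forall hle)
    rw [← ENNReal.ofReal_one, ENNReal.ofReal_le_ofReal_iff (by norm_num)] at h1
    norm_num at h1
  exact (hx (r / 2) (by positivity)).ne' (by rw [inter_comm]; exact hnull)

end AlmostMinimizerDensity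

/-! ### Complements of almost minimizers -/

section Complement

variable {n : ℕ} {E : Set (EuclideanSpace ℝ (Fin n))} {x ν : EuclideanSpace ℝ (Fin n)}
  {Φ : EuclideanSpace ℝ (Fin n) → EuclideanSpace ℝ (Fin n) → ℝ} {Lam r₀ : ℝ}

theorem HasFinitePerimeter.compl (hE : HasFinitePerimeter E) : HasFinitePerimeter Eᶜ := by
  obtain ⟨m, f, h, -, -⟩ := exists_isGaussGreenPair hE.2
  exact ⟨hE.1.compl, _, (h.compl hE.1).isGaussGreenMeasure⟩

theorem HasFinitePerimeter.perimeter_compl (hE : HasFinitePerimeter E) :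
    perimeter Eᶜ = perimeter E := by
  obtain ⟨m, f, h, -, -⟩ := exists_isGaussGreenPair hE.2
  rw [h.perimeter_eq, (h.compl hE.1).perimeter_eq]
  simp

theorem IsOuterNormalAt.compl (hE : HasFinitePerimeter E) (h : IsOuterNormalAt E x ν) :
    IsOuterNormalAt Eᶜ x (-ν) := by
  obtain ⟨m, f, hp, -, -⟩ := exists_isGaussGreenPair hE.2
  rw [IsOuterNormalAt, hE.perimeter_compl]
  refine ⟨h.1, by rw [norm_neg, h.2.1], h.2.2.neg.congr fun r => ?_⟩
  rw [hp.gaussGreenMeasure_apply Metric.isOpen_ball.measurableSet,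
    (hp.compl hE.1).gaussGreenMeasure_apply Metric.isOpen_ball.measurableSet, ← smul_neg]
  simp [integral_neg]

theorem HasFinitePerimeter.reducedBoundary_compl (hE : HasFinitePerimeter E) :
    reducedBoundary Eᶜ = reducedBoundary E :=
  Subset.antisymm (fun _ ⟨ν, hν⟩ => ⟨-ν, compl_compl E ▸ hν.compl hE.compl⟩)
    fun _ ⟨ν, hν⟩ => ⟨-ν, hν.compl hE⟩

/-- Complementation keeps the reduced boundary and reverses the normal, which the reflected
integrand undoes. -/
theorem HasFinitePerimeter.anisotropicPerimeter_compl (hE : HasFinitePerimeter E)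
    (Φ : EuclideanSpace ℝ (Fin n) → EuclideanSpace ℝ (Fin n) → ℝ) :
    anisotropicPerimeter (fun x ν => Φ x (-ν)) Eᶜ = anisotropicPerimeter Φ E := by
  have hout (x : EuclideanSpace ℝ (Fin n)) : -outerNormal Eᶜ x = outerNormal E x := by
    by_cases hx : x ∈ reducedBoundary E
    · rw [((isOuterNormalAt_outerNormal hx).compl hE).outerNormal_eq, neg_neg]
    · have hx' : ¬∃ ν, IsOuterNormalAt Eᶜ x ν := by
        rw [← hE.reducedBoundary_compl] at hx
        exact hx
      have hx : ¬∃ ν, IsOuterNormalAt E x ν := hx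
      rw [outerNormal, outerNormal, dif_neg hx, dif_neg hx', neg_zero]
  simp only [anisotropicPerimeter, hE.reducedBoundary_compl, hout]

/-- Competitors of the complement are complements of competitors, with the same symmetric
difference. -/
theorem IsAlmostMinimizer.compl (h : IsAlmostMinimizer Φ Lam r₀ E) :
    IsAlmostMinimizer (fun x ν => Φ x (-ν)) Lam r₀ Eᶜ := by
  refine ⟨h.1.compl, fun x r hr hr0 F hF hsub => ?_⟩
  have h1 := h.2 x r hr hr0 Fᶜ hF.compl (by rwa [← compl_symmDiff_compl, compl_compl])
  have h2 := hF.compl.anisotropicPerimeter_compl Φ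
  rw [compl_compl] at h2
  rwa [h.1.anisotropicPerimeter_compl, h2]

end Complement

/-! ### Upper perimeter bound and conclusion -/

/-- The upper perimeter bound for almost minimizers. -/
theorem exists_perimeter_ball_le {n : ℕ} {lam : ℝ} (hn : 2 ≤ n) (hlam : 1 ≤ lam) (M : ℝ)
    (hM : 0 ≤ M) : ∃ C : ℝ, 0 < C ∧
    ∀ Φ : EuclideanSpace ℝ (Fin n) → EuclideanSpace ℝ (Fin n) → ℝ,
      (∀ x ν, ‖ν‖ = 1 → 1 / lam ≤ Φ x ν ∧ Φ x ν ≤ lam) →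
      ∀ Lam r₀ : ℝ, 0 ≤ Lam → Lam ≤ M → ∀ E, IsAlmostMinimizer Φ Lam r₀ E →
      ∀ x r, 0 < r → r ≤ r₀ →
        perimeter E (Metric.ball x r) ≤ ENNReal.ofReal (C * r ^ (n - 1)) := by
  obtain ⟨C, hC0, hC⟩ := exists_perimeter_closedBall_le hn hlam
  have : NeZero n := ⟨by omega⟩
  set ω := volume.real (Metric.closedBall (0 : EuclideanSpace ℝ (Fin n)) 1) with hωdef
  have hω : 0 < ω :=
    ENNReal.toReal_pos (Metric.measure_closedBall_pos _ _ one_pos).ne' measure_closedBall_lt_top.ne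
  have hn0 : (0 : ℝ) < n := by exact_mod_cast (by omega : 0 < n)
  refine ⟨C * (n * ω + M), by positivity, fun Φ hΦ Lam r₀ hLam hLamM E hmin x r hr hr0 => ?_⟩
  have := (gaussGreenMeasure_spec hmin.1.2).1
  have hclosed (ρ : ℝ) (hρ : ρ < r) : (gaussGreenMeasure E).variation.real (Metric.closedBall x ρ) ≤
      C * (n * ω + M) * r ^ (n - 1) := by
    -- The maximum with r/2 keeps s positive when ρ is small or negative.
    obtain ⟨s, ⟨hs1, hs2⟩, d, hd, -⟩ := exists_hasDerivAt_le
      (monotone_ballVolume (E := E) (x := x)) (max_lt hρ (half_lt_self hr))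
    have hs0 : 0 < s := (half_pos hr).trans ((le_max_right _ _).trans_lt hs1)
    have hd1 := hasDerivAt_ballVolume_le (by omega) hs0 hd
    refine ENNReal.toReal_le_of_le_ofReal (by positivity) ?_
    refine (measure_mono (Metric.closedBall_subset_closedBall
      ((le_max_left _ _).trans_lt hs1).le)).trans
      ((hC Φ hΦ Lam r₀ hLam E hmin x s r d hs0 hs2 hr0 hd).trans (ENNReal.ofReal_le_ofReal ?_))
    rw [mul_assoc C, add_mul]
    gcongr
    exact hd1.trans (by gcongr)
  have h1 := le_of_tendsto (tendsto_measureReal_closedBall_sub (gaussGreenMeasure E).variation x r)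
    (Eventually.of_forall fun k : ℕ => hclosed _ (by
      have : 0 < 1 / ((k : ℝ) + 1) := by positivity
      linarith))
  change (gaussGreenMeasure E).variation _ ≤ _
  rw [← ofReal_measureReal (measure_ne_top _ _)]
  exact ENNReal.ofReal_le_ofReal h1

theorem proposition3p1 (n : ℕ) (hn : 2 ≤ n) (lam : ℝ) (hlam : 1 ≤ lam) :
    ∃ ε c C : ℝ, 0 < ε ∧ 0 < c ∧ 0 < C ∧
      ∀ (ell : ℝ) (Φ : EuclideanSpace ℝ (Fin n) → EuclideanSpace ℝ (Fin n) → ℝ),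
        IsRegularAnisotropy lam ell Φ →
      ∀ Lam r₀ : ℝ, 0 < Lam → 0 < r₀ → Lam < ε →
      ∀ E : Set (EuclideanSpace ℝ (Fin n)), IsAlmostMinimizer Φ Lam r₀ E →
      ∀ x ∈ measureBoundary E, ∀ r : ℝ, 0 < r → r ≤ r₀ →
        ENNReal.ofReal (c * r ^ n) ≤
            min (volume (E ∩ Metric.ball x r)) (volume (Metric.ball x r \ E)) ∧
        ENNReal.ofReal (c * r ^ (n - 1)) ≤ perimeter E (Metric.ball x r) ∧
        perimeter E (Metric.ball x r) ≤ ENNReal.ofReal (C * r ^ (n - 1)) := by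
  obtain ⟨δ, hδ, hvol⟩ := exists_lt_ballVolume_of_isAlmostMinimizer hn hlam
  obtain ⟨C, hC0, hC⟩ := exists_perimeter_ball_le hn hlam δ hδ.le
  have : NeZero n := ⟨by omega⟩
  set ω := volume.real (Metric.closedBall (0 : EuclideanSpace ℝ (Fin n)) 1) with hωdef
  have hω : 0 < ω :=
    ENNReal.toReal_pos (Metric.measure_closedBall_pos _ _ one_pos).ne' measure_closedBall_lt_top.ne
  set c₁ : ℝ := δ / 4 ^ n with hc₁
  have hc₁0 : 0 < c₁ := by positivity
  set c₂ : ℝ := c₁ ^ 2 / (2 ^ (n + 1) * ω) / 2 ^ (n - 1) with hc₂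
  have hc₂0 : 0 < c₂ := by positivity
  refine ⟨δ, min c₁ c₂, C, hδ, lt_min hc₁0 hc₂0, hC0,
    fun ell Φ hΦ Lam r₀ hLam _ hLamδ E hmin x hx r hr hr0 => ?_⟩
  have hΦneg : ∀ x ν, ‖ν‖ = 1 → 1 / lam ≤ Φ x (-ν) ∧ Φ x (-ν) ≤ lam := fun x ν hν =>
    hΦ.bounds x (-ν) (by rwa [norm_neg])
  have hdensity (ρ : ℝ) (hρ : 0 < ρ) (hρ0 : ρ ≤ r₀) :
      ENNReal.ofReal (c₁ * ρ ^ n) ≤ volume (E ∩ Metric.ball x ρ) ∧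
        ENNReal.ofReal (c₁ * ρ ^ n) ≤ volume (Metric.ball x ρ \ E) := by
    have h1 := hvol Φ hΦ.bounds Lam r₀ hLam.le hLamδ.le E hmin x (fun s hs => (hx s hs).1) (ρ / 2)
      (by positivity) (by linarith)
    have h2 := hvol _ hΦneg Lam r₀ hLam.le hLamδ.le Eᶜ hmin.compl x
      (fun s hs => by
        rw [inter_comm, ← sdiff_eq]
        exact (hx s hs).2) (ρ / 2) (by positivity) (by linarith)
    have h3 := ballVolume_compl_closedBall_le (E := E) (x := x) (half_lt_self hρ)
    -- The first halving comes from using a closed ball of radius ρ/2, the second from the (r/2)^n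
    -- in the volume bound; hence 4^n in c₁.
    have h4 : c₁ * ρ ^ n = δ * (ρ / 2 / 2) ^ n := by
      rw [div_div, div_pow, hc₁]
      norm_num
      ring
    rw [h4]
    exact ⟨(ENNReal.ofReal_le_ofReal h1.le).trans h3.1, (ENNReal.ofReal_le_ofReal h2.le).trans h3.2⟩
  refine ⟨?_, ?_, hC Φ hΦ.bounds Lam r₀ hLam.le hLamδ.le E hmin x r hr hr0⟩
  · have h1 : ENNReal.ofReal (min c₁ c₂ * r ^ n) ≤ ENNReal.ofReal (c₁ * r ^ n) :=
      ENNReal.ofReal_le_ofReal (by gcongr; exact min_le_left _ _)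
    obtain ⟨h2, h3⟩ := hdensity r hr hr0
    exact le_min (h1.trans h2) (h1.trans h3)
  · obtain ⟨m, f, h, -, hp⟩ := exists_isGaussGreenPair hmin.1.2
    -- Volume bounds at radius r/2 give the perimeter bound at radius r, since the isoperimetric
    -- inequality doubles the radius.
    obtain ⟨h2, h3⟩ := hdensity (r / 2) (half_pos hr) (by linarith)
    have h4 := h.le_measureReal_ball (by omega) hmin.1.1 hc₁0 (half_pos hr) h2 h3
    rw [mul_div_cancel₀ r two_ne_zero] at h4
    rw [hp]
    refine le_trans (ENNReal.ofReal_le_ofReal ?_) h4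
    calc min c₁ c₂ * r ^ (n - 1) ≤ c₂ * r ^ (n - 1) := by gcongr; exact min_le_right _ _
      _ = _ := by rw [hc₂, div_pow r]; ring
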